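/- Let $N\ge 1$, $p>1$, $q>1$, $q>p-1$, $K_1,K_2>0$, $l\ge \frac{2qp^2}{q-p+1}$ and $\Lambda\ge 1$. There is a constant $\gamma>0$ depending only on $N,p,q,K_1,K_2,l,\Lambda$ such that the following holds. Let $\Omega\subset\mathbb R^N$ be open, $T>0$, $\Omega_T=\Omega\times(0,T)$, and let $\mathbf A:\Omega_T\times\mathbb R\times\mathbb R^N\to\mathbb R^N$ be Lebesgue measurable in $(x,t)\in\Omega_T$ for all $(v,\xi)$, continuous in $(v,\xi)$ for a.e. $(x,t)$, with $$\mathbf A(x,t,v,\xi)\cdot\xi\ge K_1|\xi|^p,\qquad |\mathbf A(x,t,v,\xi)|\le K_2|\xi|^{p-1}$$ for a.e. $(x,t)\in\Omega_T$ and all $v\in\mathbb R$, $\xi\in\mathbb R^N$. Let $u$ be a locally bounded local weak solution of $$\partial_t\big(|u|^{q-1}u\big)-\operatorname{div}\mathbf A(x,t,u,Du)=0\quad\text{in }\Omega_T,$$ that is, $u\in C_{loc}(0,T;L^{q+1}_{loc}(\Omega))\cap L^p_{loc}(0,T;W^{1,p}_{loc}(\Omega))$ and, for every compact $E\subset\Omega$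 and every $[t_1,t_2]\subset(0,T)$, $$\int_E|u|^{q-1}u\,\varphi\,dx\Big|_{t_1}^{t_2}+\int_{t_1}^{t_2}\!\!\int_E\big\{-|u|^{q-1}u\,\varphi_t+\mathbf A(x,\tau,u,Du)\cdot D\varphi\big\}\,dx\,d\tau=0$$ for all non-negative $\varphi\in W^{1,q+1}_{loc}(0,T;L^{q+1}(E))\cap L^p_{loc}(0,T;W^{1,p}_0(E))$. Let $r>0$, $s<t$, $B_r(y)\times(s,t)\subset\Omega_T$, and let $\mu^-\le u\le\mu^+$ a.e. in $B_r(y)\times(s,t)$. Then for any $\delta,\sigma\in(0,1)$, any $\zeta\in C^1_0(B_r(y))$ (continuously differentiable with compact support in $B_r(y)$) with $0\le\zeta\le1$, $\zeta=1$ in $B_{(1-\sigma)r}(y)$ and $|D\zeta|\le\frac{\Lambda}{\sigma r}$, and for either choice of the sign $\pm$, the integrals $$\mathcal I_\pm(\tau)=\frac1{|B_r(y)|}\int_{B_r(y)}\pm\big(|\mu^\pm|^{q-1}\mu^\pm-|u(x,\tau)|^{q-1}u(x,\tau)\big)\,\zeta^l(x)\,dx$$ exist for all $\tau\in[s,t]\cap(0,T)$,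 are bounded in $\tau$, and satisfy $$\sup_{\tau\in[s,t]\cap(0,T)}\mathcal I_\pm(\tau)\le\frac1{1-\delta}\,\inf_{\tau\in[s,t]\cap(0,T)}\mathcal I_\pm(\tau)+\frac{\gamma}{(1-\delta)\,\delta^\gamma\sigma^\gamma}\Big(\frac{t-s}{r^p}\Big)^{\frac q{q-p+1}}.$$ -/

import Mathlib

open Set Filter Topology MeasureTheory
open scoped ContDiff

noncomputable section

/-- The space `ℝ^N` with its Euclidean norm and Lebesgue measure. -/
abbrev RSpace (N : ℕ) : Type := EuclideanSpace ℝ (Fin N)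

/-- The space-time cylinder `Ω_T = Ω × (0, T)`. -/
def spaceTime {N : ℕ} (Ω : Set (RSpace N)) (T : ℝ) : Set (RSpace N × ℝ) :=
  Ω ×ˢ Ioo 0 T

/-- The signed power `|a|^(q-1) a`. -/
def signedPow (q a : ℝ) : ℝ := |a| ^ (q - 1) * a

/-- The assumptions on the vector field `A(x, t, v, ξ)`: it is a Carathéodory function on
`Ω_T × ℝ × ℝ^N` (Lebesgue measurable in `(x, t)`, continuous in `(v, ξ)`) with
`A(x, t, v, ξ) · ξ ≥ K₁ |ξ|^p` and `|A(x, t, v, ξ)| ≤ K₂ |ξ|^(p-1)`. -/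
structure StructureConditions {N : ℕ} (p K₁ K₂ : ℝ) (Ω : Set (RSpace N)) (T : ℝ)
    (A : RSpace N → ℝ → ℝ → RSpace N → RSpace N) : Prop where
  measurable : ∀ (v : ℝ) (ξ : RSpace N),
    AEStronglyMeasurable (fun z : RSpace N × ℝ => A z.1 z.2 v ξ)
      (volume.restrict (spaceTime Ω T))
  continuous : ∀ᵐ z : RSpace N × ℝ ∂(volume.restrict (spaceTime Ω T)),
    Continuous (fun w : ℝ × RSpace N => A z.1 z.2 w.1 w.2)
  coercive : ∀ᵐ z : RSpace N × ℝ ∂(volume.restrict (spaceTime Ω T)),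
    ∀ (v : ℝ) (ξ : RSpace N), K₁ * ‖ξ‖ ^ p ≤ inner ℝ (A z.1 z.2 v ξ) ξ
  growth : ∀ᵐ z : RSpace N × ℝ ∂(volume.restrict (spaceTime Ω T)),
    ∀ (v : ℝ) (ξ : RSpace N), ‖A z.1 z.2 v ξ‖ ≤ K₂ * ‖ξ‖ ^ (p - 1)

/-- `φ` belongs to `C_c^∞(U)`. -/
def IsSmoothTest {N : ℕ} (U : Set (RSpace N)) (φ : RSpace N → ℝ) : Prop :=
  ContDiff ℝ ∞ φ ∧ HasCompactSupport φ ∧ tsupport φ ⊆ U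

/-- `g` is the weak gradient of `v` in the open set `Ω`: `∫ v ∇φ = - ∫ φ g` for all
`φ ∈ C_c^∞(Ω)`. -/
def IsWeakGradient {N : ℕ} (Ω : Set (RSpace N)) (v : RSpace N → ℝ)
    (g : RSpace N → RSpace N) : Prop :=
  ∀ φ : RSpace N → ℝ, IsSmoothTest Ω φ →
    ∫ x in Ω, v x • gradient φ x = - ∫ x in Ω, φ x • g x

/-- `v` belongs to `W_0^{1,p}(E)`, the closure in `W^{1,p}` of the smooth functions with compact
support in the interior of `E`, and `g` is its gradient. -/
def MemW0 {N : ℕ} (p : ℝ) (E : Set (RSpace N)) (v : RSpace N → ℝ)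
    (g : RSpace N → RSpace N) : Prop :=
  ∃ φ : ℕ → RSpace N → ℝ, (∀ k, IsSmoothTest (interior E) (φ k)) ∧
    Tendsto (fun k => eLpNorm (fun x => φ k x - v x) (ENNReal.ofReal p) (volume.restrict E))
      atTop (𝓝 0) ∧
    Tendsto (fun k => eLpNorm (fun x => gradient (φ k) x - g x) (ENNReal.ofReal p)
      (volume.restrict E)) atTop (𝓝 0)

/-- `u ∈ C_loc(0, T; L^{q+1}_loc(Ω)) ∩ L^p_loc(0, T; W^{1,p}_loc(Ω))`, with spatial weak
gradient `Du`. The function `x ↦ u x t` is the value at time `t` of the continuous curve in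
`L^{q+1}_loc(Ω)`. -/
structure InSolutionSpace {N : ℕ} (p q : ℝ) (Ω : Set (RSpace N)) (T : ℝ)
    (u : RSpace N → ℝ → ℝ) (Du : RSpace N → ℝ → RSpace N) : Prop where
  measurable : AEStronglyMeasurable (fun z : RSpace N × ℝ => u z.1 z.2)
    (volume.restrict (spaceTime Ω T))
  memLp_slice : ∀ K : Set (RSpace N), IsCompact K → K ⊆ Ω → ∀ t ∈ Ioo 0 T,
    MemLp (fun x => u x t) (ENNReal.ofReal (q + 1)) (volume.restrict K)
  continuous_slice : ∀ K : Set (RSpace N), IsCompact K → K ⊆ Ω → ∀ t ∈ Ioo 0 T,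
    Tendsto (fun τ => eLpNorm (fun x => u x τ - u x t) (ENNReal.ofReal (q + 1))
      (volume.restrict K)) (𝓝 t) (𝓝 0)
  memLp : ∀ K : Set (RSpace N), IsCompact K → K ⊆ Ω → ∀ t₁ t₂ : ℝ, 0 < t₁ → t₂ < T →
    MemLp (fun z : RSpace N × ℝ => u z.1 z.2) (ENNReal.ofReal p)
      (volume.restrict (K ×ˢ Icc t₁ t₂))
  memLp_gradient : ∀ K : Set (RSpace N), IsCompact K → K ⊆ Ω → ∀ t₁ t₂ : ℝ, 0 < t₁ → t₂ < T →
    MemLp (fun z : RSpace N × ℝ => Du z.1 z.2) (ENNReal.ofReal p)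
      (volume.restrict (K ×ˢ Icc t₁ t₂))
  gradient : ∀ᵐ t ∂(volume.restrict (Ioo 0 T)),
    IsWeakGradient Ω (fun x => u x t) (fun x => Du x t)

/-- Non-negative `ζ ∈ W^{1,q+1}_loc(0, T; L^{q+1}(E)) ∩ L^p_loc(0, T; W_0^{1,p}(E))`, with time
derivative `ζt` and spatial gradient `Dζ`. Membership in the first space, with `ζ` the
representative that is continuous in time, says that `ζ` and `ζt` are locally in `L^{q+1}` in time
and that `ζ` is the integral of `ζt` between any two times. -/
structure IsTestFunction {N : ℕ} (p q : ℝ) (E : Set (RSpace N)) (T : ℝ)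
    (ζ ζt : RSpace N → ℝ → ℝ) (Dζ : RSpace N → ℝ → RSpace N) : Prop where
  nonneg : ∀ᵐ z : RSpace N × ℝ ∂(volume.restrict (spaceTime E T)), 0 ≤ ζ z.1 z.2
  memLp_time : ∀ t₁ t₂ : ℝ, 0 < t₁ → t₂ < T →
    MemLp (fun z : RSpace N × ℝ => ζ z.1 z.2) (ENNReal.ofReal (q + 1))
      (volume.restrict (E ×ˢ Icc t₁ t₂))
  memLp_timeDeriv : ∀ t₁ t₂ : ℝ, 0 < t₁ → t₂ < T →
    MemLp (fun z : RSpace N × ℝ => ζt z.1 z.2) (ENNReal.ofReal (q + 1))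
      (volume.restrict (E ×ˢ Icc t₁ t₂))
  timeDeriv : ∀ t₁ ∈ Ioo 0 T, ∀ t₂ ∈ Ioo 0 T, ∀ᵐ x ∂(volume.restrict E),
    ζ x t₂ - ζ x t₁ = ∫ τ in t₁..t₂, ζt x τ
  memLp_space : ∀ t₁ t₂ : ℝ, 0 < t₁ → t₂ < T →
    MemLp (fun z : RSpace N × ℝ => ζ z.1 z.2) (ENNReal.ofReal p)
      (volume.restrict (E ×ˢ Icc t₁ t₂))
  memLp_gradient : ∀ t₁ t₂ : ℝ, 0 < t₁ → t₂ < T →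
    MemLp (fun z : RSpace N × ℝ => Dζ z.1 z.2) (ENNReal.ofReal p)
      (volume.restrict (E ×ˢ Icc t₁ t₂))
  gradient : ∀ᵐ t ∂(volume.restrict (Ioo 0 T)), MemW0 p E (fun x => ζ x t) (fun x => Dζ x t)

/-- The left-hand side of the weak formulation,
`∫_E |u|^(q-1) u ζ dx |_{t₁}^{t₂} + ∫_{t₁}^{t₂} ∫_E (-|u|^(q-1) u ζ_t + A(x, τ, u, Du) · Dζ)`. -/
def weakForm {N : ℕ} (q : ℝ) (A : RSpace N → ℝ → ℝ → RSpace N → RSpace N)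
    (u : RSpace N → ℝ → ℝ) (Du : RSpace N → ℝ → RSpace N) (E : Set (RSpace N)) (t₁ t₂ : ℝ)
    (ζ ζt : RSpace N → ℝ → ℝ) (Dζ : RSpace N → ℝ → RSpace N) : ℝ :=
  ((∫ x in E, signedPow q (u x t₂) * ζ x t₂) - ∫ x in E, signedPow q (u x t₁) * ζ x t₁) +
    ∫ τ in t₁..t₂, ∫ x in E,
      (-(signedPow q (u x τ) * ζt x τ) + inner ℝ (A x τ (u x τ) (Du x τ)) (Dζ x τ))

/-- Local weak sub-solutions of `∂_t (|u|^(q-1) u) - div A(x, t, u, Du) = 0` in `Ω_T`. -/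
def IsLocalWeakSubsolution {N : ℕ} (p q : ℝ) (Ω : Set (RSpace N)) (T : ℝ)
    (A : RSpace N → ℝ → ℝ → RSpace N → RSpace N) (u : RSpace N → ℝ → ℝ) : Prop :=
  ∃ Du : RSpace N → ℝ → RSpace N, InSolutionSpace p q Ω T u Du ∧
    ∀ E : Set (RSpace N), IsCompact E → E ⊆ Ω →
    ∀ t₁ t₂ : ℝ, 0 < t₁ → t₁ < t₂ → t₂ < T →
    ∀ (ζ ζt : RSpace N → ℝ → ℝ) (Dζ : RSpace N → ℝ → RSpace N),
      IsTestFunction p q E T ζ ζt Dζ → weakForm q A u Du E t₁ t₂ ζ ζt Dζ ≤ 0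

/-- Local weak super-solutions of `∂_t (|u|^(q-1) u) - div A(x, t, u, Du) = 0` in `Ω_T`. -/
def IsLocalWeakSupersolution {N : ℕ} (p q : ℝ) (Ω : Set (RSpace N)) (T : ℝ)
    (A : RSpace N → ℝ → ℝ → RSpace N → RSpace N) (u : RSpace N → ℝ → ℝ) : Prop :=
  ∃ Du : RSpace N → ℝ → RSpace N, InSolutionSpace p q Ω T u Du ∧
    ∀ E : Set (RSpace N), IsCompact E → E ⊆ Ω →
    ∀ t₁ t₂ : ℝ, 0 < t₁ → t₁ < t₂ → t₂ < T →
    ∀ (ζ ζt : RSpace N → ℝ → ℝ) (Dζ : RSpace N → ℝ → RSpace N),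
      IsTestFunction p q E T ζ ζt Dζ → 0 ≤ weakForm q A u Du E t₁ t₂ ζ ζt Dζ

/-- Local weak solutions. -/
def IsLocalWeakSolution {N : ℕ} (p q : ℝ) (Ω : Set (RSpace N)) (T : ℝ)
    (A : RSpace N → ℝ → ℝ → RSpace N → RSpace N) (u : RSpace N → ℝ → ℝ) : Prop :=
  IsLocalWeakSubsolution p q Ω T A u ∧ IsLocalWeakSupersolution p q Ω T A u

/-- `u` is essentially bounded on every compact subset of `Ω_T`. -/
def IsLocallyBounded {N : ℕ} (Ω : Set (RSpace N)) (T : ℝ) (u : RSpace N → ℝ → ℝ) : Prop :=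
  ∀ K : Set (RSpace N × ℝ), IsCompact K → K ⊆ spaceTime Ω T →
    ∃ M : ℝ, ∀ᵐ z : RSpace N × ℝ ∂(volume.restrict K), |u z.1 z.2| ≤ M

/-- A cutoff function `ζ ∈ C^1_0(B_r(y))` with `0 ≤ ζ ≤ 1`, `ζ = 1` in `B_{(1-σ)r}(y)` and
`|Dζ| ≤ Λ / (σ r)`. -/
structure IsCutoff {N : ℕ} (Λ : ℝ) (y : RSpace N) (r σ : ℝ) (ζ : RSpace N → ℝ) : Prop where
  contDiff : ContDiff ℝ 1 ζ
  hasCompactSupport : HasCompactSupport ζ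
  tsupport_subset : tsupport ζ ⊆ Metric.ball y r
  nonneg : ∀ x, 0 ≤ ζ x
  le_one : ∀ x, ζ x ≤ 1
  eq_one : ∀ x ∈ Metric.ball y (r * (1 - σ)), ζ x = 1
  gradient_le : ∀ x, ‖gradient ζ x‖ ≤ Λ / (σ * r)

/-- The integrand `e (|μ|^(q-1) μ - |u|^(q-1) u) ζ^l` at time `τ`, where `e = ±1` is a sign. -/
def signedIntegrand {N : ℕ} (q l e μ : ℝ) (u : RSpace N → ℝ → ℝ) (ζ : RSpace N → ℝ) (τ : ℝ)
    (x : RSpace N) : ℝ :=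
  e * (signedPow q μ - signedPow q (u x τ)) * ζ x ^ l

/-- The average of `signedIntegrand` over the ball `B_r(y)` at time `τ`. -/
def signedAverage {N : ℕ} (q l e μ : ℝ) (u : RSpace N → ℝ → ℝ) (ζ : RSpace N → ℝ)
    (y : RSpace N) (r τ : ℝ) : ℝ :=
  ⨍ x in Metric.ball y r, signedIntegrand q l e μ u ζ τ x

end

/-! Write `b(z) = |z|^(q-1) z`, `W(τ) = ∫ (b(μ) - b(u(τ))) ζ^l` and `V = |B_r(y)|`, and let `S`
bound `W` from above on the time interval. Testing the equation with `ζ^l` bounds `|W(t₁) - W(t₂)|`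
by the flux integral `R = ∬ K |Du|^(p-1) ζ^(l-1)` with `K` proportional to `1 / (σ r)`
(`LocalSetting.abs_integral_sub_le`). Everything reduces to `R ≤ δ (S + κ^q V)` for a level `κ` with
`κ^(q-p+1)` proportional to `(t - s) / r^p`.

The gradient is controlled by testing with `ζ^l (μ - u + κ)^(-β)`. This weight increases with `u`,
so coercivity produces the energy `∬ |Du|^p (μ - u + κ)^(-β-1) ζ^l`, bounded by a multiple of
`κ^(-β) (S + R)` (`LocalSetting.energy_le`). Young's inequality splits the integrand of `R` into
this energy density and the weight `(μ - u + κ)^a ζ^(l-p)`, `a = (p-1)(1+β)`. The choice of `β`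
makes `a < q`, and `l` is large enough for the weight to be dominated by `κ^a` times `1 + (b(μ) -
b(u)) ζ^l / κ^q` (`weight_le`), whose integral is at most `(t - s) (V + S / κ^q)`. So `R` occurs on
both sides with a small factor on the right (`LocalSetting.flux_le`); suitable `ε` and `κ` absorb it
(`LocalSetting.integral_sub_le`). With `S` the supremum of `W`, the inequality `W(τ₁) - W(τ₂) ≤ δ (S
+ κ^q V)` rearranges to the claim (`sSup_le_of_sub_le`).

The difficulty is that `u` has no time derivative. The weak formulation is therefore used on `[τ -
h, τ]` with the test function frozen at time `τ`. A primitive of the weight that is concave as a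
function of `b(u)` turns the time difference into a difference of values of one function of time
(`exists_primitive_signedPow`), and integrating in `τ` and letting `h` tend to zero needs only
continuity of translations in `L^(p/(p-1))` (`integral_inner_le_of_difference`). Admissibility of
the frozen function in `W_0^{1,p}` is proved by mollification (`memW0_mul_comp`). The lower sign
follows by applying the upper one to `-u`. -/

/-! ### Translations, dominated convergence and mollification in `L^P` -/

open scoped ENNReal in
/-- Translations act continuously on `L^P`. -/
theorem tendsto_eLpNorm_translate_sub {V F : Type*} [NormedAddCommGroup V] [NormedSpace ℝ V]
    [FiniteDimensional ℝ V] [MeasurableSpace V] [BorelSpace V] {μ : Measure V}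
    [μ.IsAddHaarMeasure] [NormedAddCommGroup F] {P : ℝ≥0∞} (hP : 1 ≤ P) (hP' : P ≠ ⊤)
    {f : V → F} (hf : MemLp f P μ) :
    Tendsto (fun a : V => eLpNorm (fun z => f (z - a) - f z) P μ) (𝓝 0) (𝓝 0) := by
  have : Fact (1 ≤ P) := ⟨hP⟩
  let g : V → C(V, V) := fun a => ⟨fun z => z - a, by fun_prop⟩
  have hg : Continuous g :=
    ContinuousMap.continuous_of_continuous_uncurry _ (by
      change Continuous fun x : V × V => x.2 - x.1
      fun_prop)
  have hgm : ∀ a, MeasurePreserving (g a) μ μ := fun a => measurePreserving_sub_right μ a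
  have hc : Continuous fun a => Lp.compMeasurePreserving (g a) (hgm a) hf.toLp :=
    Continuous.compMeasurePreservingLp continuous_const hg hgm hP'
  have h0 := (Lp.tendsto_Lp_iff_tendsto_eLpNorm' _ _).1 (hc.tendsto 0)
  refine h0.congr fun a => eLpNorm_congr_ae ?_
  have h1 : ∀ a, (Lp.compMeasurePreserving (g a) (hgm a) hf.toLp : V → F) =ᵐ[μ]
      fun z => f (z - a) := by
    intro a
    refine (Lp.coeFn_compMeasurePreserving _ (hgm a)).trans ?_
    exact (hgm a).quasiMeasurePreserving.ae_eq hf.coeFn_toLp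
  filter_upwards [h1 a, h1 0] with z hz hz0
  simp only [Pi.sub_apply, hz, hz0, sub_zero]

open scoped ENNReal in
/-- Dominated convergence in `L^P`. -/
theorem tendsto_eLpNorm_sub_of_dominated {α F : Type*} [MeasurableSpace α] {μ : Measure α}
    [NormedAddCommGroup F] {P : ℝ≥0∞} (hP : 1 ≤ P) (hP' : P ≠ ⊤)
    {f : ℕ → α → F} {f₀ : α → F} {g : α → ℝ} (hfm : ∀ n, AEStronglyMeasurable (f n) μ)
    (hf₀ : AEStronglyMeasurable f₀ μ)
    (hg : MemLp g P μ) (hb : ∀ n, ∀ᵐ x ∂μ, ‖f n x - f₀ x‖ ≤ g x)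
    (hl : ∀ᵐ x ∂μ, Tendsto (fun n => f n x) atTop (𝓝 (f₀ x))) :
    Tendsto (fun n => eLpNorm (fun x => f n x - f₀ x) P μ) atTop (𝓝 0) := by
  have hP0 : P ≠ 0 := (zero_lt_one.trans_le hP).ne'
  have hpos : 0 < P.toReal := ENNReal.toReal_pos hP0 hP'
  simp only [eLpNorm_eq_lintegral_rpow_enorm_toReal hP0 hP']
  have key : Tendsto (fun n => ∫⁻ x, ‖f n x - f₀ x‖ₑ ^ P.toReal ∂μ) atTop (𝓝 (∫⁻ _, 0 ∂μ)) := by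
    refine tendsto_lintegral_of_dominated_convergence' (fun x => ‖g x‖ₑ ^ P.toReal)
      (fun n => ((hfm n).sub hf₀).enorm.pow_const _) (fun n => ?_) ?_ ?_
    · filter_upwards [hb n] with x hx
      refine ENNReal.rpow_le_rpow (enorm_le_iff_norm_le.2 ?_) hpos.le
      exact hx.trans (Real.le_norm_self _)
    · exact (lintegral_rpow_enorm_lt_top_of_eLpNorm_lt_top hP0 hP' hg.2).ne
    · filter_upwards [hl] with x hx
      have : Tendsto (fun n => ‖f n x - f₀ x‖ₑ) atTop (𝓝 0) := by
        have := (hx.sub_const (f₀ x)).enorm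
        simpa using this
      have := (ENNReal.continuous_rpow_const (y := P.toReal)).tendsto 0 |>.comp this
      simpa [ENNReal.zero_rpow_of_pos hpos, Function.comp_def] using this
  rw [lintegral_zero] at key
  have := (ENNReal.continuous_rpow_const (y := 1 / P.toReal)).tendsto 0 |>.comp key
  simpa [ENNReal.zero_rpow_of_pos (inv_pos.2 hpos), Function.comp_def] using this

open scoped ENNReal Convolution in
/-- Mollification of an `L^P` function by smooth bumps converges in `L^P`. -/
theorem tendsto_eLpNorm_convolution_sub {V F : Type*} [NormedAddCommGroup V] [NormedSpace ℝ V]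
    [FiniteDimensional ℝ V] [MeasurableSpace V] [BorelSpace V] {μ : Measure V}
    [μ.IsAddHaarMeasure] [NormedAddCommGroup F] [NormedSpace ℝ F] [CompleteSpace F]
    {P : ℝ≥0∞} (hP : 1 ≤ P) (hP' : P ≠ ⊤)
    {f : V → F} (hf : MemLp f P μ) {φ : ℕ → ContDiffBump (0 : V)}
    (hφ : Tendsto (fun k => (φ k).rOut) atTop (𝓝 0)) :
    Tendsto (fun k => eLpNorm
      (fun x => ((φ k).normed μ ⋆[ContinuousLinearMap.lsmul ℝ ℝ, μ] f) x - f x) P μ)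
      atTop (𝓝 0) := by
  have hP0 : P ≠ 0 := (zero_lt_one.trans_le hP).ne'
  have hpos : 0 < P.toReal := ENNReal.toReal_pos hP0 hP'
  have htr := tendsto_eLpNorm_translate_sub hP hP' hf
  rw [ENNReal.tendsto_nhds_zero] at htr ⊢
  intro ε hε
  obtain ⟨d, hd, hball⟩ := Metric.eventually_nhds_iff.1 (htr ε hε)
  have hloc : LocallyIntegrable f μ := hf.locallyIntegrable hP
  filter_upwards [hφ.eventually (gt_mem_nhds hd)] with k hk
  set ρ := (φ k).normed μ with hρ
  have hρc : Continuous ρ := (φ k).continuous_normed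
  have hρi : ∫⁻ t, ENNReal.ofReal (ρ t) ∂μ = 1 := by
    rw [← ofReal_integral_eq_lintegral_ofReal (φ k).integrable_normed
      (Eventually.of_forall (φ k).nonneg_normed), (φ k).integral_normed, ENNReal.ofReal_one]
  -- The normalized bump is treated as a probability density: Jensen's inequality becomes the
  -- monotonicity of `L^P` norms in the exponent, and `ν` only charges translations shorter than
  -- `rOut`, for which the translation error is already at most `ε`.
  set ν := μ.withDensity fun t => ENNReal.ofReal (ρ t) with hν
  have hmeasρ : Measurable fun t => ENNReal.ofReal (ρ t) :=
    ENNReal.measurable_ofReal.comp hρc.measurable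
  have : IsProbabilityMeasure ν := ⟨by rw [hν, withDensity_apply _ MeasurableSet.univ]; simpa using hρi⟩
  have hνac : ν ≪ μ := withDensity_absolutelyContinuous _ _
  have hjoint : AEStronglyMeasurable (fun z : V × V => f (z.1 - z.2) - f z.1) (μ.prod μ) := by
    refine (hf.1.comp_quasiMeasurePreserving (quasiMeasurePreserving_sub μ μ)).sub hf.1.comp_fst
  have hsl : ∀ x, AEStronglyMeasurable (fun t => f (x - t) - f x) μ := fun x =>
    (hf.1.comp_quasiMeasurePreserving (quasiMeasurePreserving_sub_left μ x)).sub
      aestronglyMeasurable_const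
  have hpt : ∀ x, ‖(ρ ⋆[ContinuousLinearMap.lsmul ℝ ℝ, μ] f) x - f x‖ₑ ^ P.toReal ≤
      ∫⁻ t, ‖f (x - t) - f x‖ₑ ^ P.toReal ∂ν := by
    intro x
    have hconv : ConvolutionExistsAt ρ f x (ContinuousLinearMap.lsmul ℝ ℝ) μ :=
      (φ k).hasCompactSupport_normed.convolutionExists_left _ hρc hloc x
    have h1 : (ρ ⋆[ContinuousLinearMap.lsmul ℝ ℝ, μ] f) x - f x =
        ∫ t, ρ t • (f (x - t) - f x) ∂μ := by
      simp_rw [smul_sub]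
      have hconv' : Integrable (fun t => ρ t • f (x - t)) μ := hconv
      rw [integral_sub hconv' ((φ k).integrable_normed.smul_const _), (φ k).integral_normed_smul]
      rfl
    have h2 : ‖∫ t, ρ t • (f (x - t) - f x) ∂μ‖ₑ ≤ eLpNorm (fun t => f (x - t) - f x) 1 ν := by
      refine (enorm_integral_le_lintegral_enorm _).trans ?_
      rw [eLpNorm_one_eq_lintegral_enorm, hν, lintegral_withDensity_eq_lintegral_mul₀
        hmeasρ.aemeasurable (hsl x).enorm]
      refine lintegral_mono fun t => ?_
      simp only [Pi.mul_apply, enorm_smul]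
      rw [Real.enorm_of_nonneg ((φ k).nonneg_normed t)]
    rw [h1]
    refine (ENNReal.rpow_le_rpow (h2.trans (eLpNorm_le_eLpNorm_of_exponent_le hP
      ((hsl x).mono_ac hνac))) hpos.le).trans ?_
    rw [eLpNorm_eq_lintegral_rpow_enorm_toReal hP0 hP', ← ENNReal.rpow_mul, one_div,
      inv_mul_cancel₀ hpos.ne', ENNReal.rpow_one]
  rw [eLpNorm_eq_lintegral_rpow_enorm_toReal hP0 hP']
  have hswap : ∫⁻ x, ∫⁻ t, ‖f (x - t) - f x‖ₑ ^ P.toReal ∂ν ∂μ =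
      ∫⁻ t, ∫⁻ x, ‖f (x - t) - f x‖ₑ ^ P.toReal ∂μ ∂ν :=
    lintegral_lintegral_swap ((hjoint.mono_ac
      (Measure.AbsolutelyContinuous.rfl.prod hνac)).enorm.pow_const _)
  have hle : ∫⁻ x, ‖(ρ ⋆[ContinuousLinearMap.lsmul ℝ ℝ, μ] f) x - f x‖ₑ ^ P.toReal ∂μ ≤
      ε ^ P.toReal := by
    refine (lintegral_mono hpt).trans (hswap.le.trans ?_)
    have hae : ∀ᵐ t ∂ν, ∫⁻ x, ‖f (x - t) - f x‖ₑ ^ P.toReal ∂μ ≤ ε ^ P.toReal := by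
      rw [hν, ae_withDensity_iff hmeasρ]
      refine Eventually.of_forall fun t ht => ?_
      have ht' : ρ t ≠ 0 := fun h => ht (by simp [h])
      have hmem : t ∈ Metric.ball (0 : V) (φ k).rOut := by
        rw [← (φ k).support_normed_eq (μ := μ)]; exact ht'
      have := hball (lt_trans (Metric.mem_ball.1 hmem) hk)
      rw [eLpNorm_eq_lintegral_rpow_enorm_toReal hP0 hP'] at this
      have h3 := ENNReal.rpow_le_rpow this hpos.le
      rwa [← ENNReal.rpow_mul, one_div, inv_mul_cancel₀ hpos.ne', ENNReal.rpow_one] at h3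
    refine (lintegral_mono_ae hae).trans ?_
    simp
  refine (ENNReal.rpow_le_rpow hle (by positivity)).trans ?_
  rw [← ENNReal.rpow_mul, one_div, mul_inv_cancel₀ hpos.ne', ENNReal.rpow_one]

open scoped ENNReal in
/-- Hölder's inequality for the integral of an inner product. -/
theorem norm_integral_inner_le {α F : Type*} [MeasurableSpace α] {μ : Measure α}
    [NormedAddCommGroup F] [InnerProductSpace ℝ F] {P Q : ℝ≥0∞} [P.HolderConjugate Q]
    {f g : α → F} (hf : MemLp f P μ) (hg : MemLp g Q μ) :
    Integrable (fun x => inner ℝ (f x) (g x)) μ ∧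
    ‖∫ x, inner ℝ (f x) (g x) ∂μ‖ₑ ≤ eLpNorm f P μ * eLpNorm g Q μ ∧
    ∫⁻ x, ‖(inner ℝ (f x) (g x) : ℝ)‖ₑ ∂μ ≤ eLpNorm f P μ * eLpNorm g Q μ := by
  have hb : eLpNorm (fun x => (inner ℝ (f x) (g x) : ℝ)) 1 μ ≤ eLpNorm f P μ * eLpNorm g Q μ := by
    have := eLpNorm_le_eLpNorm_mul_eLpNorm_of_nnnorm (r := 1) (p := P) (q := Q) hf.1 hg.1
      (fun a b => (inner ℝ a b : ℝ)) 1 (Eventually.of_forall fun x => by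
        simpa using nnnorm_inner_le_nnnorm (𝕜 := ℝ) (f x) (g x))
    simpa using this
  have hm : AEStronglyMeasurable (fun x => (inner ℝ (f x) (g x) : ℝ)) μ := hf.1.inner hg.1
  rw [eLpNorm_one_eq_lintegral_enorm] at hb
  exact ⟨⟨hm, hb.trans_lt (ENNReal.mul_lt_top hf.2 hg.2)⟩,
    (enorm_integral_le_lintegral_enorm _).trans hb, hb⟩

/-! ### Elementary inequalities for powers and the signed power -/

theorem rpow_add_le_two_rpow {q x y : ℝ} (hq : 0 ≤ q) (hx : 0 ≤ x) (hy : 0 ≤ y) :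
    (x + y) ^ q ≤ 2 ^ q * (x ^ q + y ^ q) := by
  have hx' := Real.rpow_nonneg hx q
  have hy' := Real.rpow_nonneg hy q
  have h2 : (0 : ℝ) ≤ 2 ^ q := by positivity
  rcases le_total x y with h | h
  · calc (x + y) ^ q ≤ (2 * y) ^ q := Real.rpow_le_rpow (by positivity) (by linarith) hq
      _ = 2 ^ q * y ^ q := Real.mul_rpow (by norm_num) hy
      _ ≤ _ := by gcongr; linarith
  · calc (x + y) ^ q ≤ (2 * x) ^ q := Real.rpow_le_rpow (by positivity) (by linarith) hq
      _ = 2 ^ q * x ^ q := Real.mul_rpow (by norm_num) hx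
      _ ≤ _ := by gcongr; linarith

theorem rpow_sub_le_sub_rpow {q x y : ℝ} (hq : 1 ≤ q) (hy : 0 ≤ y) (hxy : y ≤ x) :
    (x - y) ^ q ≤ x ^ q - y ^ q := by
  have h := NNReal.add_rpow_le_rpow_add ⟨x - y, sub_nonneg.2 hxy⟩ ⟨y, hy⟩ hq
  have h' : (x - y) ^ q + y ^ q ≤ (x - y + y) ^ q := by exact_mod_cast h
  rw [sub_add_cancel] at h'
  linarith

theorem signedPow_neg (q a : ℝ) : signedPow q (-a) = -signedPow q a := by
  simp [signedPow]

theorem signedPow_of_nonneg {q a : ℝ} (hq : 0 < q) (ha : 0 ≤ a) : signedPow q a = a ^ q := by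
  rcases ha.eq_or_lt with rfl | ha'
  · simp [signedPow, Real.zero_rpow hq.ne']
  · rw [signedPow, abs_of_pos ha', Real.rpow_sub_one ha'.ne']
    field_simp

theorem signedPow_of_nonpos {q a : ℝ} (hq : 0 < q) (ha : a ≤ 0) :
    signedPow q a = -(-a) ^ q := by
  rw [← signedPow_of_nonneg hq (neg_nonneg.2 ha), signedPow_neg, neg_neg]

theorem signedPow_mono {q : ℝ} (hq : 0 < q) : Monotone (signedPow q) := by
  intro a b hab
  rcases le_total 0 a with ha | ha
  · rw [signedPow_of_nonneg hq ha, signedPow_of_nonneg hq (ha.trans hab)]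
    exact Real.rpow_le_rpow ha hab hq.le
  · rw [signedPow_of_nonpos hq ha]
    rcases le_total 0 b with hb | hb
    · rw [signedPow_of_nonneg hq hb]
      have := Real.rpow_nonneg (neg_nonneg.2 ha) q
      have := Real.rpow_nonneg hb q
      linarith
    · rw [signedPow_of_nonpos hq hb, neg_le_neg_iff]
      exact Real.rpow_le_rpow (by linarith) (by linarith) hq.le

theorem continuous_signedPow {q : ℝ} (hq : 1 < q) : Continuous (signedPow q) :=
  (continuous_abs.rpow_const fun _ => Or.inr (by linarith)).mul continuous_id

theorem signedPow_inv_signedPow {q : ℝ} (hq : 0 < q) (z : ℝ) :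
    signedPow q⁻¹ (signedPow q z) = z := by
  have hq' : 0 < q⁻¹ := inv_pos.2 hq
  rcases le_total 0 z with hz | hz
  · rw [signedPow_of_nonneg hq hz, signedPow_of_nonneg hq' (Real.rpow_nonneg hz q),
      Real.rpow_rpow_inv hz hq.ne']
  · have hz' : 0 ≤ -z := neg_nonneg.2 hz
    rw [signedPow_of_nonpos hq hz, signedPow_neg,
      signedPow_of_nonneg hq' (Real.rpow_nonneg hz' q), Real.rpow_rpow_inv hz' hq.ne', neg_neg]

/-- Superadditivity of `x ^ q` settles equal signs with constant one; the factor `2 ^ q` is needed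
only when `z` and `μ` lie on opposite sides of zero. This is what lets powers of `μ - u` be measured
by the integrand of the averages. -/
theorem rpow_sub_le_two_rpow_mul_signedPow {q z μ : ℝ} (hq : 1 < q) (h : z ≤ μ) :
    (μ - z) ^ q ≤ 2 ^ q * (signedPow q μ - signedPow q z) := by
  have hq0 : 0 < q := by linarith
  have hone : (1 : ℝ) ≤ 2 ^ q := Real.one_le_rpow (by norm_num) hq0.le
  have hmono := sub_nonneg.2 (signedPow_mono hq0 h)
  rcases le_total 0 z with hz | hz
  · rw [signedPow_of_nonneg hq0 hz, signedPow_of_nonneg hq0 (hz.trans h)] at hmono ⊢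
    exact (rpow_sub_le_sub_rpow hq.le hz h).trans (le_mul_of_one_le_left hmono hone)
  · rcases le_total 0 μ with hμ | hμ
    · rw [signedPow_of_nonpos hq0 hz, signedPow_of_nonneg hq0 hμ, sub_neg_eq_add, sub_eq_add_neg]
      exact rpow_add_le_two_rpow hq0.le hμ (neg_nonneg.2 hz)
    · rw [signedPow_of_nonpos hq0 hz, signedPow_of_nonpos hq0 hμ] at hmono ⊢
      have := rpow_sub_le_sub_rpow hq.le (neg_nonneg.2 hμ) (neg_le_neg h)
      rw [show -z - -μ = μ - z by ring] at this
      refine this.trans (le_trans (le_of_eq (by ring)) (le_mul_of_one_le_left hmono hone))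

/-- Convexity: Bernoulli's inequality at `y / x` says that the graph of the power lies above its
tangent at `x`. -/
theorem rpow_sub_rpow_le {q M x y : ℝ} (hq : 1 < q) (hy : 0 ≤ y) (hxy : y ≤ x) (hx : x ≤ M) :
    x ^ q - y ^ q ≤ q * M ^ (q - 1) * (x - y) := by
  have hx0 : 0 ≤ x := hy.trans hxy
  rcases hx0.eq_or_lt with h0 | h0
  · have : y = 0 := by linarith
    subst this; subst h0; simp
  have h1 := one_add_mul_self_le_rpow_one_add (s := y / x - 1) (by
    have : 0 ≤ y / x := by positivity
    linarith) hq.le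
  rw [add_sub_cancel, Real.div_rpow hy hx0] at h1
  have h2 : x ^ q = x ^ (q - 1) * x := by
    rw [Real.rpow_sub_one h0.ne']; field_simp
  have hxq : 0 < x ^ q := Real.rpow_pos_of_pos h0 q
  have h3 : x ^ q * (1 + q * (y / x - 1)) ≤ y ^ q := by
    calc x ^ q * (1 + q * (y / x - 1)) ≤ x ^ q * (y ^ q / x ^ q) := by gcongr
      _ = y ^ q := by field_simp
  have h4 : x ^ q * (1 + q * (y / x - 1)) = x ^ q - q * x ^ (q - 1) * (x - y) := by
    rw [h2]; field_simp; ring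
  have h5 : x ^ (q - 1) ≤ M ^ (q - 1) := Real.rpow_le_rpow hx0 hx (by linarith)
  have h6 : q * x ^ (q - 1) * (x - y) ≤ q * M ^ (q - 1) * (x - y) := by
    have : 0 ≤ x - y := by linarith
    gcongr
  linarith

/-- The signed power is Lipschitz on bounded sets. -/
theorem abs_signedPow_sub_le {q M x y : ℝ} (hq : 1 < q) (hx : |x| ≤ M) (hy : |y| ≤ M) :
    |signedPow q x - signedPow q y| ≤ q * M ^ (q - 1) * |x - y| := by
  have hq0 : 0 < q := by linarith
  have key : ∀ x y : ℝ, y ≤ x → |x| ≤ M → |y| ≤ M →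
      signedPow q x - signedPow q y ≤ q * M ^ (q - 1) * (x - y) := by
    intro x y hyx hx hy
    obtain ⟨hx1, hx2⟩ := abs_le.1 hx
    obtain ⟨hy1, hy2⟩ := abs_le.1 hy
    rcases le_total 0 y with h0 | h0
    · rw [signedPow_of_nonneg hq0 h0, signedPow_of_nonneg hq0 (h0.trans hyx)]
      exact rpow_sub_rpow_le hq h0 hyx hx2
    · rcases le_total 0 x with h1 | h1
      · rw [signedPow_of_nonpos hq0 h0, signedPow_of_nonneg hq0 h1]
        have e1 := rpow_sub_rpow_le hq le_rfl h1 hx2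
        have e2 := rpow_sub_rpow_le (M := M) hq le_rfl (neg_nonneg.2 h0) (by linarith)
        rw [Real.zero_rpow hq0.ne'] at e1 e2
        nlinarith
      · rw [signedPow_of_nonpos hq0 h0, signedPow_of_nonpos hq0 h1]
        have := rpow_sub_rpow_le (M := M) hq (neg_nonneg.2 h1) (neg_le_neg hyx) (by linarith)
        rw [show -y - -x = x - y by ring] at this
        linarith
  rcases le_total y x with h | h
  · rw [abs_of_nonneg (sub_nonneg.2 (signedPow_mono hq0 h)), abs_of_nonneg (sub_nonneg.2 h)]
    exact key x y h hx hy
  · rw [abs_sub_comm, abs_sub_comm x,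
      abs_of_nonneg (sub_nonneg.2 (signedPow_mono hq0 h)), abs_of_nonneg (sub_nonneg.2 h)]
    exact key y x h hy hx

/-- Elementary form of Young's inequality. -/
theorem rpow_sub_one_mul_le {p ε X Y : ℝ} (hp : 1 < p) (hε : 0 < ε) (hX : 0 ≤ X) (hY : 0 ≤ Y) :
    X ^ (p - 1) * Y ≤ ε * X ^ p + ε ^ (1 - p) * Y ^ p := by
  have hsplit : ∀ z : ℝ, 0 ≤ z → z ^ p = z ^ (p - 1) * z := by
    intro z hz
    rcases hz.eq_or_lt with rfl | hz'
    · simp [Real.zero_rpow (show p ≠ 0 by linarith)]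
    · rw [Real.rpow_sub_one hz'.ne']; field_simp
  have h1 : 0 ≤ X ^ (p - 1) := Real.rpow_nonneg hX _
  -- No convex duality is needed: whichever of `Y` and `ε X` is larger, one of the two terms on the
  -- right dominates alone.
  rcases le_total Y (ε * X) with h | h
  · have : X ^ (p - 1) * Y ≤ ε * X ^ p := by
      rw [hsplit X hX]
      calc X ^ (p - 1) * Y ≤ X ^ (p - 1) * (ε * X) := by gcongr
        _ = _ := by ring
    have : 0 ≤ ε ^ (1 - p) * Y ^ p := by positivity
    linarith
  · have : X ^ (p - 1) * Y ≤ ε ^ (1 - p) * Y ^ p := by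
      have h2 : X ^ (p - 1) ≤ (Y / ε) ^ (p - 1) :=
        Real.rpow_le_rpow hX (by rw [le_div_iff₀ hε]; linarith) (by linarith)
      rw [hsplit Y hY]
      calc X ^ (p - 1) * Y ≤ (Y / ε) ^ (p - 1) * Y := by gcongr
        _ = _ := by
          rw [Real.div_rpow hY hε.le, show (1 - p) = -(p - 1) by ring, Real.rpow_neg hε.le]
          ring
    have : 0 ≤ ε * X ^ p := by positivity
    linarith

/-- Young's inequality with the weights of the energy estimate. -/
theorem weighted_young {p l β η K d v ζ : ℝ} (hp : 1 < p) (hl : p < l) (hη : 0 < η) (hK : 0 ≤ K)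
    (hd : 0 ≤ d) (hv : 0 < v) (hζ : 0 ≤ ζ) :
    K * d ^ (p - 1) * ζ ^ (l - 1) ≤
      η * (d ^ p * v ^ (-β - 1) * ζ ^ l) +
        η ^ (1 - p) * K ^ p * (v ^ ((p - 1) * (1 + β)) * ζ ^ (l - p)) := by
  rcases hζ.eq_or_lt with rfl | hζ'
  · rw [Real.zero_rpow (by linarith), Real.zero_rpow (by linarith), Real.zero_rpow (by linarith)]
    simp
  -- The parameter depends on the point. It is chosen so that, after multiplication by `ζ ^ (l -
  -- 1)`, the first term is exactly the energy density; its power `1 - p` then fixes the second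
  -- weight.
  have h := rpow_sub_one_mul_le (ε := η * v ^ (-β - 1) * ζ) hp (by positivity) hd hK
  have h' := mul_le_mul_of_nonneg_right h (Real.rpow_nonneg hζ (l - 1))
  refine le_trans (le_of_eq (by ring)) (h'.trans (le_of_eq ?_))
  rw [Real.mul_rpow (by positivity) hζ, Real.mul_rpow hη.le (by positivity), ← Real.rpow_mul hv.le,
    show (-β - 1) * (1 - p) = (p - 1) * (1 + β) by ring, Real.rpow_sub_one hζ'.ne',
    show l - p = (1 - p) + (l - 1) by ring, Real.rpow_add hζ', Real.rpow_sub_one hζ'.ne']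
  field_simp

/-- With `v = d + κ` and `X = v^q ζ^l / κ^q`, the condition `p ≤ l (1 - a/q)` says `l a/q ≤ l - p`,
so lowering the cutoff exponent bounds the weight by `κ^a X^(a/q)`. As `a < q`, `X^(a/q) ≤ 1 + X`,
and `X` is linear in `W` up to constants because `v^q` is bounded by a multiple of `W + κ^q`. -/
theorem weight_le {p q l a κ d W ζ : ℝ} (hq : 1 < q) (hpl : p < l) (ha : 0 < a) (haq : a < q)
    (hl : p ≤ l * (1 - a / q)) (hp : 0 < p) (hκ : 0 < κ) (hd : 0 ≤ d) (hdW : d ^ q ≤ 2 ^ q * W)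
    (hζ : 0 ≤ ζ) (hζ1 : ζ ≤ 1) :
    (d + κ) ^ a * ζ ^ (l - p) ≤ κ ^ a * ((1 + 4 ^ q) * (1 + W * ζ ^ l / κ ^ q)) := by
  have hq0 : 0 < q := by linarith
  have hl0 : 0 < l := by linarith
  set v := d + κ with hv
  have hv0 : 0 < v := by linarith
  have hκq : 0 < κ ^ q := Real.rpow_pos_of_pos hκ q
  set X := v ^ q * ζ ^ l / κ ^ q with hX
  have hX0 : 0 ≤ X := by positivity
  have hζl : 0 ≤ ζ ^ l := Real.rpow_nonneg hζ l
  have h1 : v ^ a * ζ ^ (l - p) ≤ κ ^ a * X ^ (a / q) := by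
    have e1 : X ^ (a / q) = v ^ a * ζ ^ (l * (a / q)) / κ ^ a := by
      rw [hX, Real.div_rpow (by positivity) hκq.le, Real.mul_rpow (by positivity) hζl,
        ← Real.rpow_mul hv0.le, ← Real.rpow_mul hζ, ← Real.rpow_mul hκ.le,
        mul_div_cancel₀ a hq0.ne']
    have e2 : ζ ^ (l - p) ≤ ζ ^ (l * (a / q)) :=
      Real.rpow_le_rpow_of_exponent_ge' hζ hζ1 (by positivity) (by linarith)
    rw [e1, mul_div_cancel₀ _ (Real.rpow_pos_of_pos hκ a).ne']
    gcongr
  have h2 : X ^ (a / q) ≤ 1 + X := by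
    have haq' : 0 < a / q := by positivity
    have haq1 : a / q ≤ 1 := (div_le_one hq0).2 haq.le
    rcases le_total X 1 with hx | hx
    · exact (Real.rpow_le_one hX0 hx haq'.le).trans (by linarith)
    · calc X ^ (a / q) ≤ X ^ (1 : ℝ) := Real.rpow_le_rpow_of_exponent_le hx haq1
        _ ≤ 1 + X := by rw [Real.rpow_one]; linarith
  have h24 : (2 : ℝ) ^ q * 2 ^ q = 4 ^ q := by
    rw [← Real.mul_rpow (by norm_num) (by norm_num)]; norm_num
  have h2q : (1 : ℝ) ≤ 2 ^ q := Real.one_le_rpow (by norm_num) hq0.le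
  have h3 : v ^ q ≤ 4 ^ q * (W + κ ^ q) := by
    calc v ^ q ≤ 2 ^ q * (d ^ q + κ ^ q) := rpow_add_le_two_rpow hq0.le hd hκ.le
      _ ≤ 2 ^ q * (2 ^ q * W + 2 ^ q * κ ^ q) := by
        gcongr; exact le_mul_of_one_le_left hκq.le h2q
      _ = _ := by rw [← h24]; ring
  have h4 : X ≤ 4 ^ q * (1 + W * ζ ^ l / κ ^ q) := by
    have : X ≤ 4 ^ q * (W + κ ^ q) * ζ ^ l / κ ^ q := by rw [hX]; gcongr
    refine this.trans ?_
    have hζl1 : ζ ^ l ≤ 1 := Real.rpow_le_one hζ hζ1 hl0.le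
    have : 4 ^ q * (W + κ ^ q) * ζ ^ l / κ ^ q = 4 ^ q * (ζ ^ l + W * ζ ^ l / κ ^ q) := by
      field_simp; ring
    rw [this]
    gcongr
  have hW : 0 ≤ W := by
    have : 0 ≤ 2 ^ q * W := (Real.rpow_nonneg hd q).trans hdW
    exact nonneg_of_mul_nonneg_right this (by positivity)
  have h5 : 0 ≤ W * ζ ^ l / κ ^ q := by positivity
  calc v ^ a * ζ ^ (l - p) ≤ κ ^ a * X ^ (a / q) := h1
    _ ≤ κ ^ a * (1 + X) := by gcongr
    _ ≤ κ ^ a * ((1 + 4 ^ q) * (1 + W * ζ ^ l / κ ^ q)) := by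
      gcongr
      linarith

/-- The primitive of `(μ - z + κ)^(-β)` with respect to the signed power. -/
theorem exists_primitive_signedPow {q β κ : ℝ} (μ : ℝ) (hq : 1 < q) (hβ : 0 < β) (hκ : 0 < κ) :
    ∃ G : ℝ → ℝ, Continuous G ∧
      (∀ z ≤ μ, 0 ≤ G z ∧ G z ≤ κ ^ (-β) * (signedPow q μ - signedPow q z)) ∧
      ∀ x ≤ μ, ∀ y ≤ μ,
        G x - G y ≤ (μ - y + κ) ^ (-β) * (signedPow q y - signedPow q x) := by
  have hq0 : 0 < q := by linarith
  -- The weight as a function of `B = signedPow q z`. Truncating at zero keeps the base at least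
  -- `κ`, so `F` is bounded and monotone on the whole line, and it agrees with the weight for `z ≤
  -- μ`.
  set F : ℝ → ℝ := fun B => (max (μ - signedPow q⁻¹ B) 0 + κ) ^ (-β) with hF
  have hpos : ∀ B, 0 < max (μ - signedPow q⁻¹ B) 0 + κ := fun B => by positivity
  have hmono : Monotone F := by
    intro B B' h
    refine Real.rpow_le_rpow_of_nonpos (hpos B') ?_ (by linarith)
    have := signedPow_mono (inv_pos.2 hq0) h
    gcongr
  have hint : ∀ a b, IntervalIntegrable F volume a b := fun a b => hmono.intervalIntegrable
  have hFle : ∀ B, F B ≤ κ ^ (-β) := fun B =>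
    Real.rpow_le_rpow_of_nonpos hκ (by simp) (by linarith)
  have hF0 : ∀ B, 0 ≤ F B := fun B => Real.rpow_nonneg (hpos B).le _
  have hFb : ∀ y ≤ μ, F (signedPow q y) = (μ - y + κ) ^ (-β) := by
    intro y hy
    simp only [hF]
    rw [signedPow_inv_signedPow hq0, max_eq_left (by linarith)]
  -- As a function of `B` this integral has slope `-F`, and `F` is nondecreasing, so it is concave.
  -- The last property says that it lies below its tangent at `signedPow q y`.
  refine ⟨fun z => ∫ B in (signedPow q z)..(signedPow q μ), F B, ?_, ?_, ?_⟩
  · have : (fun z => ∫ B in (signedPow q z)..(signedPow q μ), F B) =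
        fun z => -∫ B in (signedPow q μ)..(signedPow q z), F B := by
      ext z; rw [intervalIntegral.integral_symm]
    rw [this]
    exact ((intervalIntegral.continuous_primitive hint _).comp (continuous_signedPow hq)).neg
  · intro z hz
    have h := signedPow_mono hq0 hz
    refine ⟨intervalIntegral.integral_nonneg h fun B _ => hF0 B, ?_⟩
    calc ∫ B in (signedPow q z)..(signedPow q μ), F B
        ≤ ∫ B in (signedPow q z)..(signedPow q μ), κ ^ (-β) :=
          intervalIntegral.integral_mono_on h (hint _ _) intervalIntegrable_const
            fun B _ => hFle B
      _ = _ := by rw [intervalIntegral.integral_const, smul_eq_mul, mul_comm]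
  · intro x hx y hy
    simp only
    rw [intervalIntegral.integral_interval_sub_interval_comm (hint _ _) (hint _ _) (hint _ _),
      intervalIntegral.integral_same, sub_zero, ← hFb y hy]
    rcases le_total x y with h | h
    · have h' := signedPow_mono hq0 h
      calc ∫ B in (signedPow q x)..(signedPow q y), F B
          ≤ ∫ B in (signedPow q x)..(signedPow q y), F (signedPow q y) :=
            intervalIntegral.integral_mono_on h' (hint _ _) intervalIntegrable_const
              fun B hB => hmono hB.2
        _ = _ := by rw [intervalIntegral.integral_const, smul_eq_mul, mul_comm]
    · have h' := signedPow_mono hq0 h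
      rw [intervalIntegral.integral_symm]
      have : ∫ B in (signedPow q y)..(signedPow q x), F (signedPow q y) ≤
          ∫ B in (signedPow q y)..(signedPow q x), F B :=
            intervalIntegral.integral_mono_on h' intervalIntegrable_const (hint _ _)
              fun B hB => hmono hB.1
      rw [intervalIntegral.integral_const, smul_eq_mul] at this
      linarith

/-! ### Mollification of cutoffs and Sobolev functions; membership in `W_0^{1,p}` -/

open scoped Convolution in
/-- Mollification of `f` with a normalized bump function. -/
noncomputable def mollify {V F : Type*} [NormedAddCommGroup V] [InnerProductSpace ℝ V]
    [FiniteDimensional ℝ V] [MeasurableSpace V] [BorelSpace V] [NormedAddCommGroup F]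
    [NormedSpace ℝ F] (φ : ContDiffBump (0 : V)) (f : V → F) : V → F :=
  φ.normed volume ⋆[ContinuousLinearMap.lsmul ℝ ℝ, volume] f

section mollify

variable {V F : Type*} [NormedAddCommGroup V] [InnerProductSpace ℝ V] [FiniteDimensional ℝ V]
  [MeasurableSpace V] [BorelSpace V] [NormedAddCommGroup F] [NormedSpace ℝ F]

theorem mollify_apply (φ : ContDiffBump (0 : V)) (f : V → F) (x : V) :
    mollify φ f x = ∫ t, φ.normed volume t • f (x - t) := rfl

theorem mollify_apply_swap (φ : ContDiffBump (0 : V)) (f : V → F) (x : V) :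
    mollify φ f x = ∫ t, φ.normed volume (x - t) • f t := by
  rw [mollify, convolution_eq_swap]
  rfl

theorem integrable_mollify (φ : ContDiffBump (0 : V)) {f : V → F}
    (hf : LocallyIntegrable f) (x : V) :
    Integrable fun t => φ.normed volume t • f (x - t) :=
  φ.hasCompactSupport_normed.convolutionExists_left (ContinuousLinearMap.lsmul ℝ ℝ)
    φ.continuous_normed hf x

theorem contDiff_mollify (φ : ContDiffBump (0 : V)) {f : V → F}
    (hf : LocallyIntegrable f) : ContDiff ℝ ∞ (mollify φ f) :=
  φ.hasCompactSupport_normed.contDiff_convolution_left _ φ.contDiff_normed hf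

theorem mollify_mem_Icc (φ : ContDiffBump (0 : V)) {f : V → ℝ} {m M : ℝ}
    (hf : LocallyIntegrable f) (hb : ∀ x, f x ∈ Icc m M) (x : V) : mollify φ f x ∈ Icc m M := by
  have hi := integrable_mollify φ hf x
  have hc : ∀ c : ℝ, ∫ t, φ.normed volume t • c = c := fun c => φ.integral_normed_smul _ c
  have hci : ∀ c : ℝ, Integrable fun t => φ.normed volume t • c := fun c =>
    φ.integrable_normed.smul_const c
  constructor
  · rw [← hc m]
    exact integral_mono (hci m) hi fun t =>
      mul_le_mul_of_nonneg_left (hb _).1 (φ.nonneg_normed t)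
  · rw [← hc M]
    exact integral_mono hi (hci M) fun t =>
      mul_le_mul_of_nonneg_left (hb _).2 (φ.nonneg_normed t)

theorem norm_mollify_le (φ : ContDiffBump (0 : V)) {f : V → F} {C : ℝ}
    (hb : ∀ x, ‖f x‖ ≤ C) (x : V) : ‖mollify φ f x‖ ≤ C := by
  rw [← φ.integral_normed_smul volume C, mollify_apply]
  refine norm_integral_le_of_norm_le (φ.integrable_normed.smul_const C)
    (Eventually.of_forall fun t => ?_)
  rw [norm_smul, Real.norm_of_nonneg (φ.nonneg_normed t), smul_eq_mul]
  exact mul_le_mul_of_nonneg_left (hb _) (φ.nonneg_normed t)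

theorem mollify_eq_zero (φ : ContDiffBump (0 : V)) {f : V → F} {x : V}
    (h : ∀ t ∈ Metric.ball x φ.rOut, f t = 0) : mollify φ f x = 0 := by
  rw [mollify_apply]
  refine integral_eq_zero_of_ae (Eventually.of_forall fun t => ?_)
  by_cases ht : t ∈ Metric.ball (0 : V) φ.rOut
  · simp [h (x - t) (by simpa [dist_eq_norm] using ht)]
  · rw [← φ.support_normed_eq (μ := volume)] at ht
    simp [Function.notMem_support.1 ht]

theorem tendsto_mollify {φ : ℕ → ContDiffBump (0 : V)} [CompleteSpace F]
    (hφ : Tendsto (fun k => (φ k).rOut) atTop (𝓝 0)) {f : V → F} (hf : Continuous f) (x : V) :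
    Tendsto (fun k => mollify (φ k) f x) atTop (𝓝 (f x)) :=
  ContDiffBump.convolution_tendsto_right_of_continuous hφ hf x

/-- The mollification of a compactly supported `C¹` function has gradient the mollification of
the gradient. -/
theorem hasGradientAt_mollify (φ : ContDiffBump (0 : V)) {η : V → ℝ} (hη : ContDiff ℝ 1 η)
    (hs : HasCompactSupport η) (x : V) :
    HasGradientAt (mollify φ η) (mollify φ (gradient η) x) x := by
  have hρ : LocallyIntegrable (φ.normed volume) (volume : Measure V) :=
    φ.continuous_normed.locallyIntegrable
  rw [hasGradientAt_iff_hasFDerivAt]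
  convert! hs.hasFDerivAt_convolution_right (ContinuousLinearMap.lsmul ℝ ℝ) hρ hη x using 1
  rw [mollify_apply, convolution_def]
  have hcf : Continuous (fderiv ℝ η) := hη.continuous_fderiv one_ne_zero
  have hcg : Continuous (gradient η) := (InnerProductSpace.toDual ℝ V).symm.continuous.comp hcf
  have h1 := (InnerProductSpace.toDual ℝ V).toContinuousLinearEquiv.toContinuousLinearMap.integral_comp_comm
    (integrable_mollify φ (hcg.locallyIntegrable (μ := volume)) x)
  refine h1.symm.trans (integral_congr_ae (Eventually.of_forall fun t => ?_))
  ext w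
  simp [gradient, ContinuousLinearMap.precompR]

/-- The mollification of a function with a weak gradient near `x` has as its gradient the
mollification of the weak gradient. -/
theorem hasGradientAt_mollify_of_weak (φ : ContDiffBump (0 : V)) {v : V → ℝ} {g : V → V}
    (hv : LocallyIntegrable v) (x : V)
    (hw : ∫ z, v z • gradient (fun z => φ.normed volume (x - z)) z =
      -∫ z, φ.normed volume (x - z) • g z) :
    HasGradientAt (mollify φ v) (mollify φ g x) x := by
  set ρ := φ.normed (volume : Measure V) with hρ
  have hρd : ContDiff ℝ 1 ρ := φ.contDiff_normed
  have hcf : Continuous (fderiv ℝ ρ) := hρd.continuous_fderiv one_ne_zero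
  have hcg : Continuous (gradient ρ) := (InnerProductSpace.toDual ℝ V).symm.continuous.comp hcf
  -- Reflecting the bump changes the sign of its gradient, which cancels the minus sign in the
  -- definition of the weak gradient.
  have hgr : ∀ z, gradient (fun z => ρ (x - z)) z = -gradient ρ (x - z) := by
    intro z
    refine HasGradientAt.gradient ?_
    rw [hasGradientAt_iff_hasFDerivAt, map_neg]
    have h1 : HasFDerivAt ρ (InnerProductSpace.toDual ℝ V (gradient ρ (x - z))) (x - z) :=
      ((hρd.differentiable one_ne_zero) (x - z)).hasGradientAt.hasFDerivAt
    have h2 := h1.comp z ((hasFDerivAt_id z).const_sub x)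
    convert! h2 using 1
    ext w; simp
  rw [hasGradientAt_iff_hasFDerivAt]
  convert! φ.hasCompactSupport_normed.hasFDerivAt_convolution_left
    (ContinuousLinearMap.lsmul ℝ ℝ) hρd hv x using 1
  have hint : Integrable fun t => v t • gradient ρ (x - t) := by
    have hcs : HasCompactSupport (fun t => gradient ρ (x - t)) := by
      have h0 : HasCompactSupport (gradient ρ) :=
        (φ.hasCompactSupport_normed.fderiv ℝ).comp_left (g := (InnerProductSpace.toDual ℝ V).symm)
          (map_zero _)
      exact h0.comp_homeomorph (Homeomorph.subLeft x)
    exact hv.integrable_smul_right_of_hasCompactSupport (hcg.comp (by fun_prop)) hcs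
  have h1 := (InnerProductSpace.toDual ℝ V).toContinuousLinearEquiv.toContinuousLinearMap.integral_comp_comm hint
  have h2 : mollify φ g x = ∫ t, v t • gradient ρ (x - t) := by
    rw [mollify_apply_swap, ← neg_neg (∫ t, _), ← hw, ← integral_neg]
    simp only [hgr, smul_neg, neg_neg]
  rw [h2]
  refine h1.symm.trans ?_
  rw [convolution_eq_swap]
  refine integral_congr_ae (Eventually.of_forall fun t => ?_)
  ext w
  simp [gradient, mul_comm, hρ]

end mollify

/-- A sequence of bump functions with radii below `ε` tending to zero. -/
theorem exists_bump_seq {V : Type*} [NormedAddCommGroup V] {ε : ℝ} (hε : 0 < ε) :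
    ∃ φ : ℕ → ContDiffBump (0 : V), Tendsto (fun k => (φ k).rOut) atTop (𝓝 0) ∧
      (∀ k, (φ k).rOut < ε) ∧ ∀ k, (φ k).rOut ≤ 2 * (φ k).rIn := by
  -- The ratio of outer to inner radius stays equal to 2; a bounded ratio is what almost everywhere
  -- convergence of mollifications requires.
  refine ⟨fun k => ⟨ε / (k + 2) / 2, ε / (k + 2), by positivity,
    half_lt_self (by positivity)⟩, ?_, fun k => ?_, fun k => ?_⟩
  · refine tendsto_const_nhds.div_atTop ?_
    exact tendsto_atTop_add_const_right _ _ tendsto_natCast_atTop_atTop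
  · refine div_lt_self hε ?_
    have : (0 : ℝ) ≤ k := k.cast_nonneg
    linarith
  · simp only; linarith

theorem hasGradientAt_mul_comp {V : Type*} [NormedAddCommGroup V] [InnerProductSpace ℝ V]
    [CompleteSpace V] {η v : V → ℝ} {f : ℝ → ℝ} {a b x : V} {f' : ℝ} (hη : HasGradientAt η a x)
    (hv : HasGradientAt v b x) (hf : HasDerivAt f f' (v x)) :
    HasGradientAt (fun z => η z * f (v z)) (f (v x) • a + (η x * f') • b) x := by
  rw [hasGradientAt_iff_hasFDerivAt] at *
  convert! hη.mul (hf.comp_hasFDerivAt x hv) using 1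
  simp only [map_add, map_smul]
  rw [add_comm, mul_smul]
  rfl

theorem IsWeakGradient.integral_smoothTest {N : ℕ} {Ω B : Set (RSpace N)} {v : RSpace N → ℝ}
    {g : RSpace N → RSpace N} (h : IsWeakGradient Ω v g) (hΩ : MeasurableSet Ω)
    (hBΩ : B ⊆ Ω) {θ : RSpace N → ℝ} (hθ : IsSmoothTest B θ) :
    ∫ x in B, v x • gradient θ x = -∫ x in B, θ x • g x := by
  have hθ' : IsSmoothTest Ω θ := ⟨hθ.1, hθ.2.1, hθ.2.2.trans hBΩ⟩
  have hz : ∀ x ∉ B, θ x = 0 := fun x hx => image_eq_zero_of_notMem_tsupport fun h => hx (hθ.2.2 h)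
  have hz' : ∀ x ∉ B, gradient θ x = 0 := by
    intro x hx
    have : fderiv ℝ θ x = 0 := image_eq_zero_of_notMem_tsupport fun h =>
      hx (hθ.2.2 (tsupport_fderiv_subset ℝ h))
    simp [gradient, this]
  have e1 := setIntegral_eq_of_subset_of_forall_sdiff_eq_zero (μ := volume) hΩ hBΩ
    (f := fun x => v x • gradient θ x) fun x hx => by simp [hz' x hx.2]
  have e2 := setIntegral_eq_of_subset_of_forall_sdiff_eq_zero (μ := volume) hΩ hBΩ
    (f := fun x => θ x • g x) fun x hx => by simp [hz x hx.2]
  rw [← e1, ← e2]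
  exact h θ hθ'

set_option maxHeartbeats 800000 in
open scoped ENNReal in
/-- The product of a `C¹` cutoff function with a smooth function of a bounded Sobolev function
belongs to `W_0^{1,p}`. -/
theorem memW0_mul_comp {N : ℕ} {Ω : Set (RSpace N)} (hΩ : MeasurableSet Ω) {y : RSpace N}
    {r r' p m M : ℝ} (hp : 1 < p) (hr : r' < r) (hmM : m ≤ M)
    (hball : Metric.ball y r ⊆ Ω) {v : RSpace N → ℝ} {g : RSpace N → RSpace N}
    (hvg : IsWeakGradient Ω v g)
    (hv : AEStronglyMeasurable v (volume.restrict (Metric.ball y r)))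
    (hvb : ∀ᵐ x ∂(volume.restrict (Metric.ball y r)), v x ∈ Icc m M)
    (hg : MemLp g (ENNReal.ofReal p) (volume.restrict (Metric.ball y r)))
    {η : RSpace N → ℝ} (hη : ContDiff ℝ 1 η) (hηs : tsupport η ⊆ Metric.ball y r')
    {f : ℝ → ℝ} (hf : ∀ z ∈ Icc m M, ContDiffAt ℝ ∞ f z) :
    MemW0 p (Metric.closedBall y r') (fun x => η x * f (v x))
      (fun x => f (v x) • gradient η x + (η x * deriv f (v x)) • g x) := by
  have hP : 1 ≤ ENNReal.ofReal p := by
    rw [← ENNReal.ofReal_one]; exact ENNReal.ofReal_le_ofReal hp.le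
  have hP' : ENNReal.ofReal p ≠ ⊤ := ENNReal.ofReal_ne_top
  have hηc : HasCompactSupport η := by
    refine (isCompact_closedBall y r').of_isClosed_subset (isClosed_tsupport η) ?_
    exact hηs.trans Metric.ball_subset_closedBall
  -- Two margins are needed: `r' - r₀` keeps the mollified cutoff supported inside the ball of
  -- radius `r'`, and `r - r'` keeps the bumps centred in that ball inside the region where `v` has
  -- a gradient.
  obtain ⟨r₀, hr₀, hsub⟩ : ∃ r₀ < r', tsupport η ⊆ Metric.closedBall y r₀ := by
    rcases (tsupport η).eq_empty_or_nonempty with he | hne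
    · exact ⟨r' - 1, by linarith, by simp [he]⟩
    · obtain ⟨x, hx, hmax⟩ := hηc.isCompact.exists_isMaxOn hne
        (f := fun x => dist x y) (by fun_prop)
      exact ⟨dist x y, hηs hx, fun z hz => hmax hz⟩
  obtain ⟨φ, hφ0, hφε, hφ2⟩ := exists_bump_seq (V := RSpace N)
    (ε := min (r - r') (r' - r₀)) (lt_min (by linarith) (by linarith))
  have hφ1 : ∀ k, (φ k).rOut < r - r' := fun k => (hφε k).trans_le (min_le_left _ _)
  have hφ3 : ∀ k, (φ k).rOut < r' - r₀ := fun k => (hφε k).trans_le (min_le_right _ _)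
  set E := Metric.closedBall y r' with hE
  have hEB : E ⊆ Metric.ball y r := Metric.closedBall_subset_ball hr
  set B := Metric.ball y r with hB
  have hBm : MeasurableSet B := Metric.isOpen_ball.measurableSet
  have hEm : MeasurableSet E := Metric.isClosed_closedBall.measurableSet
  -- extensions to the whole space
  set vt : RSpace N → ℝ := fun x => B.indicator (fun x => max m (min M (v x)) - m) x + m with hvt
  -- Clamping everywhere, not just almost everywhere, forces every mollification into `[m, M]`, the
  -- only place where `f` is known to be smooth.
  have hvtI : ∀ x, vt x ∈ Icc m M := by
    intro x
    by_cases hx : x ∈ B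
    · simp only [hvt, indicator_of_mem hx, sub_add_cancel]
      exact ⟨le_max_left _ _, max_le hmM (min_le_left _ _)⟩
    · simp only [hvt, indicator_of_notMem hx, zero_add]
      exact ⟨le_rfl, hmM⟩
  have hvtm : AEStronglyMeasurable vt volume := by
    refine AEStronglyMeasurable.add ?_ aestronglyMeasurable_const
    rw [aestronglyMeasurable_indicator_iff hBm]
    have hc : Continuous fun z : ℝ => max m (min M z) - m := by fun_prop
    exact hc.comp_aestronglyMeasurable hv
  have hvtl : LocallyIntegrable vt := by
    refine (memLp_top_of_bound hvtm (max |m| |M|) (Eventually.of_forall fun x => ?_)).locallyIntegrable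
      le_top
    exact abs_le_max_abs_abs (hvtI x).1 (hvtI x).2
  have hvtv : ∀ᵐ x ∂(volume.restrict B), vt x = v x := by
    filter_upwards [hvb, ae_restrict_mem hBm] with x hx hxB
    simp only [hvt, indicator_of_mem hxB, sub_add_cancel]
    rw [min_eq_right hx.2, max_eq_right hx.1]
  set gt : RSpace N → RSpace N := B.indicator g with hgt
  have hgtL : MemLp gt (ENNReal.ofReal p) volume := (memLp_indicator_iff_restrict hBm).2 hg
  have hgtl : LocallyIntegrable gt := hgtL.locallyIntegrable hP
  -- gradients of the mollified functions
  have hgradη : ∀ k x, HasGradientAt (mollify (φ k) η) (mollify (φ k) (gradient η) x) x :=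
    fun k x => hasGradientAt_mollify (φ k) hη hηc x
  have hgradv : ∀ k, ∀ x ∈ E, HasGradientAt (mollify (φ k) vt) (mollify (φ k) gt x) x := by
    intro k x hx
    refine hasGradientAt_mollify_of_weak (φ k) hvtl x ?_
    set θ : RSpace N → ℝ := fun z => (φ k).normed volume (x - z) with hθ
    have hθt : tsupport θ ⊆ Metric.closedBall x (φ k).rOut := by
      refine closure_minimal (fun z hz => ?_) Metric.isClosed_closedBall
      have hz' : x - z ∈ Function.support ((φ k).normed (volume : Measure (RSpace N))) := hz
      rw [(φ k).support_normed_eq] at hz'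
      rw [mem_ball_zero_iff] at hz'
      rw [Metric.mem_closedBall, dist_comm, dist_eq_norm]
      exact hz'.le
    have hθB : tsupport θ ⊆ B := by
      refine hθt.trans fun z hz => ?_
      have h1 : dist z y ≤ dist z x + dist x y := dist_triangle _ _ _
      have h2 : dist x y ≤ r' := hx
      have h3 : dist z x ≤ (φ k).rOut := hz
      have h4 := hφ1 k
      exact Metric.mem_ball.2 (by linarith)
    have hθtest : IsSmoothTest B θ :=
      ⟨(φ k).contDiff_normed.comp (contDiff_const.sub contDiff_id),
        (isCompact_closedBall x (φ k).rOut).of_isClosed_subset (isClosed_tsupport _) hθt, hθB⟩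
    have key := hvg.integral_smoothTest hΩ hball hθtest
    have hz : ∀ x ∉ B, θ x = 0 := fun x hx =>
      image_eq_zero_of_notMem_tsupport fun h => hx (hθB h)
    have hz' : ∀ x ∉ B, gradient θ x = 0 := by
      intro x hx
      have : fderiv ℝ θ x = 0 := image_eq_zero_of_notMem_tsupport fun h =>
        hx (hθB (tsupport_fderiv_subset ℝ h))
      simp [gradient, this]
    rw [← setIntegral_eq_integral_of_forall_compl_eq_zero (s := B)
      (fun x hx => by simp [hz' x hx]),
      ← setIntegral_eq_integral_of_forall_compl_eq_zero (s := B)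
      (f := fun z => θ z • gt z) (fun x hx => by simp [hz x hx])]
    rw [integral_congr_ae (g := fun x => v x • gradient θ x)
      (by filter_upwards [hvtv] with x hx; rw [hx]), key]
    congr 1
    refine setIntegral_congr_fun hBm fun x hx => ?_
    simp [hgt, hx]
  have hvk : ∀ k x, mollify (φ k) vt x ∈ Icc m M := fun k x =>
    mollify_mem_Icc (φ k) hvtl hvtI x
  have hηl : LocallyIntegrable η := hη.continuous.locallyIntegrable
  have hcg : Continuous (gradient η) :=
    (InnerProductSpace.toDual ℝ _).symm.continuous.comp (hη.continuous_fderiv one_ne_zero)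
  have hηk : ∀ k, ContDiff ℝ ∞ (mollify (φ k) η) := fun k => contDiff_mollify (φ k) hηl
  have hvks : ∀ k, ContDiff ℝ ∞ (mollify (φ k) vt) := fun k => contDiff_mollify (φ k) hvtl
  -- bounds
  obtain ⟨Cη, hCη⟩ := hη.continuous.bounded_above_of_compact_support hηc
  obtain ⟨Cg, hCg⟩ := hcg.bounded_above_of_compact_support
    ((hηc.fderiv ℝ).comp_left (g := (InnerProductSpace.toDual ℝ (RSpace N)).symm) (map_zero _))
  have hfc : ContinuousOn f (Icc m M) := fun z hz => (hf z hz).continuousAt.continuousWithinAt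
  have hf'c0 : ∀ z ∈ Icc m M, ContinuousAt (deriv f) z := by
    intro z hz
    have h1 : ContDiffAt ℝ 0 (fderiv ℝ f) z := (hf z hz).fderiv_right (by simp)
    exact h1.continuousAt.clm_apply continuousAt_const
  have hf'c : ContinuousOn (deriv f) (Icc m M) := fun z hz => (hf'c0 z hz).continuousWithinAt
  obtain ⟨Cf, hCf⟩ := isCompact_Icc.exists_bound_of_continuousOn hfc
  obtain ⟨Cd, hCd⟩ := isCompact_Icc.exists_bound_of_continuousOn hf'c
  have hCη0 : 0 ≤ Cη := (norm_nonneg _).trans (hCη 0)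
  have hCg0 : 0 ≤ Cg := (norm_nonneg _).trans (hCg 0)
  have hCf0 : 0 ≤ Cf := (norm_nonneg _).trans (hCf m ⟨le_rfl, hmM⟩)
  have hCd0 : 0 ≤ Cd := (norm_nonneg _).trans (hCd m ⟨le_rfl, hmM⟩)
  have hηkb : ∀ k x, ‖mollify (φ k) η x‖ ≤ Cη := fun k x => norm_mollify_le (φ k) hCη x
  have hgkb : ∀ k x, ‖mollify (φ k) (gradient η) x‖ ≤ Cg := fun k x => norm_mollify_le (φ k) hCg x
  -- pointwise limits
  have hlimv : ∀ᵐ x ∂(volume.restrict E), Tendsto (fun k => mollify (φ k) vt x) atTop (𝓝 (v x)) := by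
    have h1 := ContDiffBump.ae_convolution_tendsto_right_of_locallyIntegrable (K := 2) hφ0
      (Eventually.of_forall hφ2) hvtl
    filter_upwards [ae_restrict_of_ae h1, ae_restrict_of_ae_restrict_of_subset hEB hvtv]
      with x hx hxv
    rw [← hxv]; exact hx
  have hvbE := ae_restrict_of_ae_restrict_of_subset hEB hvb
  have hlimη : ∀ x, Tendsto (fun k => mollify (φ k) η x) atTop (𝓝 (η x)) :=
    tendsto_mollify hφ0 hη.continuous
  have hlimg : ∀ x, Tendsto (fun k => mollify (φ k) (gradient η) x) atTop (𝓝 (gradient η x)) :=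
    tendsto_mollify hφ0 hcg
  have hfk : ∀ k, Continuous fun x => f (mollify (φ k) vt x) := fun k =>
    hfc.comp_continuous (hvks k).continuous (hvk k)
  have hdk : ∀ k, Continuous fun x => deriv f (mollify (φ k) vt x) := fun k =>
    hf'c.comp_continuous (hvks k).continuous (hvk k)
  have hgkc : ∀ k, Continuous (mollify (φ k) (gradient η)) := fun k =>
    (contDiff_mollify (φ k) hcg.locallyIntegrable).continuous
  have hgE : MemLp g (ENNReal.ofReal p) (volume.restrict E) :=
    hg.mono_measure (Measure.restrict_mono hEB le_rfl)
  have hfin : IsFiniteMeasure (volume.restrict E) :=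
    ⟨by rw [Measure.restrict_apply_univ]; exact (isCompact_closedBall y r').measure_lt_top⟩
  refine ⟨fun k x => mollify (φ k) η x * f (mollify (φ k) vt x), fun k => ?_, ?_, ?_⟩
  · have hts : tsupport (fun x => mollify (φ k) η x * f (mollify (φ k) vt x)) ⊆
        Metric.closedBall y (r₀ + (φ k).rOut) := by
      refine closure_minimal (fun x hx => ?_) Metric.isClosed_closedBall
      by_contra hcon
      refine hx ?_
      have h0 : mollify (φ k) η x = 0 := by
        refine mollify_eq_zero _ fun t ht => image_eq_zero_of_notMem_tsupport fun h => hcon ?_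
        have h1 : dist t y ≤ r₀ := hsub h
        have h2 : dist t x < (φ k).rOut := ht
        have h3 := dist_triangle x t y
        rw [dist_comm x t] at h3
        exact Metric.mem_closedBall.2 (by linarith)
      simp only [h0, zero_mul]
    refine ⟨?_, (isCompact_closedBall y _).of_isClosed_subset (isClosed_tsupport _) hts, ?_⟩
    · refine (hηk k).mul ?_
      rw [contDiff_iff_contDiffAt]
      intro x
      exact (hf _ (hvk k x)).comp x (hvks k).contDiffAt
    · refine hts.trans (Subset.trans ?_ Metric.ball_subset_interior_closedBall)
      exact Metric.closedBall_subset_ball (by linarith [hφ3 k])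
  · have hl : ∀ᵐ x ∂(volume.restrict E), Tendsto
        (fun k => mollify (φ k) η x * f (mollify (φ k) vt x)) atTop (𝓝 (η x * f (v x))) := by
      filter_upwards [hlimv, hvbE] with x hx hxb
      exact (hlimη x).mul ((hf _ hxb).continuousAt.tendsto.comp hx)
    have hm : ∀ k, AEStronglyMeasurable (fun x => mollify (φ k) η x * f (mollify (φ k) vt x))
        (volume.restrict E) := fun k => ((hηk k).continuous.mul (hfk k)).aestronglyMeasurable
    refine tendsto_eLpNorm_sub_of_dominated hP hP' hm
      (aestronglyMeasurable_of_tendsto_ae atTop hm hl) (memLp_const (Cη * Cf + Cη * Cf))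
      (fun k => ?_) hl
    filter_upwards [hvbE] with x hx
    refine (norm_sub_le _ _).trans (add_le_add ?_ ?_)
    · rw [norm_mul]
      exact mul_le_mul (hηkb k x) (hCf _ (hvk k x)) (norm_nonneg _) hCη0
    · rw [norm_mul]
      exact mul_le_mul (hCη x) (hCf _ hx) (norm_nonneg _) hCη0
  -- `D₁ k` is the gradient of the approximant with `g` in place of its mollification, so that
  -- dominated convergence with majorant `‖g‖` applies. The remaining error `D₂` is a bounded
  -- multiple of `mollify gt - g`, which vanishes in `L^p`.
  · set D₁ : ℕ → RSpace N → RSpace N := fun k x =>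
      f (mollify (φ k) vt x) • mollify (φ k) (gradient η) x +
        (mollify (φ k) η x * deriv f (mollify (φ k) vt x)) • g x with hD₁
    set D : RSpace N → RSpace N := fun x =>
      f (v x) • gradient η x + (η x * deriv f (v x)) • g x with hD
    have hl : ∀ᵐ x ∂(volume.restrict E), Tendsto (fun k => D₁ k x) atTop (𝓝 (D x)) := by
      filter_upwards [hlimv, hvbE] with x hx hxb
      exact (((hf _ hxb).continuousAt.tendsto.comp hx).smul (hlimg x)).add
        (((hlimη x).mul ((hf'c0 _ hxb).tendsto.comp hx)).smul_const _)
    have hm : ∀ k, AEStronglyMeasurable (D₁ k) (volume.restrict E) := fun k =>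
      (((hfk k).smul (hgkc k)).aestronglyMeasurable).add
        ((((hηk k).continuous.mul (hdk k)).aestronglyMeasurable).smul hgE.1)
    have hDm := aestronglyMeasurable_of_tendsto_ae atTop hm hl
    have hdom : MemLp (fun x => (Cf * Cg + Cf * Cg) + (Cη * Cd + Cη * Cd) * ‖g x‖)
        (ENNReal.ofReal p) (volume.restrict E) := by
      have h1 : MemLp (fun _ : RSpace N => Cf * Cg + Cf * Cg) (ENNReal.ofReal p)
        (volume.restrict E) := memLp_const _
      exact h1.add (hgE.norm.const_mul (Cη * Cd + Cη * Cd))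
    have t1 : Tendsto (fun k => eLpNorm (fun x => D₁ k x - D x) (ENNReal.ofReal p)
        (volume.restrict E)) atTop (𝓝 0) := by
      refine tendsto_eLpNorm_sub_of_dominated hP hP' hm hDm
        (g := fun x => (Cf * Cg + Cf * Cg) + (Cη * Cd + Cη * Cd) * ‖g x‖)
        hdom (fun k => ?_) hl
      filter_upwards [hvbE] with x hx
      have b1 : ‖D₁ k x‖ ≤ Cf * Cg + Cη * Cd * ‖g x‖ := by
        refine (norm_add_le _ _).trans (add_le_add ?_ ?_)
        · rw [norm_smul]
          exact mul_le_mul (hCf _ (hvk k x)) (hgkb k x) (norm_nonneg _) hCf0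
        · rw [norm_smul, norm_mul]
          gcongr
          · exact hηkb k x
          · exact hCd _ (hvk k x)
      have b2 : ‖D x‖ ≤ Cf * Cg + Cη * Cd * ‖g x‖ := by
        refine (norm_add_le _ _).trans (add_le_add ?_ ?_)
        · rw [norm_smul]
          exact mul_le_mul (hCf _ hx) (hCg x) (norm_nonneg _) hCf0
        · rw [norm_smul, norm_mul]
          gcongr
          · exact hCη x
          · exact hCd _ hx
      refine (norm_sub_le _ _).trans ((add_le_add b1 b2).trans (le_of_eq (by ring)))
    have t2 : Tendsto (fun k => ENNReal.ofReal (Cη * Cd) *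
        eLpNorm (fun x => mollify (φ k) gt x - gt x) (ENNReal.ofReal p) volume)
        atTop (𝓝 0) := by
      have := ENNReal.Tendsto.const_mul (a := ENNReal.ofReal (Cη * Cd))
        (tendsto_eLpNorm_convolution_sub hP hP' hgtL hφ0) (Or.inr ENNReal.ofReal_ne_top)
      simpa [mollify] using this
    have t3 := t2.add t1
    rw [add_zero] at t3
    refine tendsto_of_tendsto_of_tendsto_of_le_of_le tendsto_const_nhds t3
      (fun _ => zero_le) fun k => ?_
    have hgkm : Continuous (mollify (φ k) gt) := (contDiff_mollify (φ k) hgtl).continuous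
    set D₂ : RSpace N → RSpace N := fun x =>
      (mollify (φ k) η x * deriv f (mollify (φ k) vt x)) • (mollify (φ k) gt x - g x) with hD₂
    have hcongr : ∀ᵐ x ∂(volume.restrict E),
        gradient (fun x => mollify (φ k) η x * f (mollify (φ k) vt x)) x - D x =
          D₂ x + (D₁ k x - D x) := by
      filter_upwards [ae_restrict_mem hEm] with x hx
      have hd : HasDerivAt f (deriv f (mollify (φ k) vt x)) (mollify (φ k) vt x) :=
        ((hf _ (hvk k x)).differentiableAt (by simp)).hasDerivAt
      rw [(hasGradientAt_mul_comp (hgradη k x) (hgradv k x hx) hd).gradient]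
      simp only [hD₂, hD₁, smul_sub]
      abel
    have hD₂m : AEStronglyMeasurable D₂ (volume.restrict E) :=
      (((hηk k).continuous.mul (hdk k)).aestronglyMeasurable).smul
        (hgkm.aestronglyMeasurable.sub hgE.1)
    rw [eLpNorm_congr_ae hcongr]
    refine (eLpNorm_add_le hD₂m ((hm k).sub hDm) hP).trans (add_le_add ?_ le_rfl)
    have hle : eLpNorm D₂ (ENNReal.ofReal p) (volume.restrict E) ≤ ENNReal.ofReal (Cη * Cd) *
        eLpNorm (fun x => mollify (φ k) gt x - gt x) (ENNReal.ofReal p) (volume.restrict E) := by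
      refine eLpNorm_le_mul_eLpNorm_of_ae_le_mul ?_ _
      filter_upwards [ae_restrict_mem hEm] with x hx
      have : gt x = g x := by simp [hgt, hEB hx]
      rw [this, hD₂, norm_smul, norm_mul]
      gcongr
      · exact hηkb k x
      · exact hCd _ (hvk k x)
    refine hle.trans ?_
    gcongr
    exact Measure.restrict_le_self

/-! ### Measurability, slicing, and the weak formulation with one gradient -/

/-- A Carathéodory function composed with a measurable function is measurable. -/
theorem aestronglyMeasurable_caratheodory {Z W F : Type*} [MeasurableSpace Z] {μ : Measure Z}
    [TopologicalSpace W] [TopologicalSpace F] [TopologicalSpace.PseudoMetrizableSpace F]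
    {B : Z → W → F} (hB : ∀ w, AEStronglyMeasurable (fun z => B z w) μ)
    (hc : ∀ᵐ z ∂μ, Continuous (B z)) {w : Z → W} (hw : AEStronglyMeasurable w μ) :
    AEStronglyMeasurable (fun z => B z (w z)) μ := by
  -- For simple functions the argument is frozen on each of finitely many level sets; continuity in
  -- the second variable then passes to the limit along simple approximations of `w`.
  have key : ∀ s : SimpleFunc Z W, AEStronglyMeasurable (fun z => B z (s z)) μ := by
    intro s
    have hcov : (⋃ c : s.range, s ⁻¹' {(c : W)}) = univ := by
      refine eq_univ_of_forall fun z => mem_iUnion.2 ⟨⟨s z, s.mem_range_self z⟩, rfl⟩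
    rw [← Measure.restrict_univ (μ := μ), ← hcov, aestronglyMeasurable_iUnion_iff]
    intro c
    refine ((hB c).restrict (s := s ⁻¹' {(c : W)})).congr ?_
    filter_upwards [ae_restrict_mem (s.measurableSet_preimage _)] with z hz
    have hz' : s z = c := hz
    rw [hz']
  have hsm := hw.stronglyMeasurable_mk
  refine aestronglyMeasurable_of_tendsto_ae atTop (fun n => key (hsm.approx n)) ?_
  filter_upwards [hc, hw.ae_eq_mk] with z hz hzw
  rw [hzw]
  exact (hz.tendsto _).comp (hsm.tendsto_approx z)

theorem volume_restrict_prod {V : Type*} [MeasureSpace V] [SFinite (volume : Measure V)]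
    (E : Set V) (I : Set ℝ) :
    (volume : Measure (V × ℝ)).restrict (E ×ˢ I) = (volume.restrict E).prod (volume.restrict I) := by
  rw [Measure.volume_eq_prod, Measure.prod_restrict]

theorem ae_ae_of_ae_prod_swap {α β : Type*} [MeasurableSpace α] [MeasurableSpace β]
    {μ : Measure α} {ν : Measure β} [SFinite μ] [SFinite ν] {P : α × β → Prop}
    (h : ∀ᵐ z ∂(μ.prod ν), P z) : ∀ᵐ b ∂ν, ∀ᵐ a ∂μ, P (a, b) := by
  have h' : ∀ᵐ z ∂(ν.prod μ), P z.swap := by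
    rw [← Measure.prod_swap] at h
    exact ae_of_ae_map measurable_swap.aemeasurable h
  exact Measure.ae_ae_of_ae_prod h'

open scoped ENNReal in
theorem MeasureTheory.MemLp.prodMk_right {α β F : Type*} [MeasurableSpace α] [MeasurableSpace β]
    {μ : Measure α} {ν : Measure β} [SFinite μ] [SFinite ν] [NormedAddCommGroup F] {P : ℝ≥0∞}
    (hP : P ≠ 0) (hP' : P ≠ ⊤) {f : α × β → F} (hf : MemLp f P (μ.prod ν)) :
    ∀ᵐ b ∂ν, MemLp (fun a => f (a, b)) P μ := by
  have h1 := lintegral_rpow_enorm_lt_top_of_eLpNorm_lt_top hP hP' hf.2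
  have hm : AEMeasurable (fun z => ‖f z‖ₑ ^ P.toReal) (μ.prod ν) := hf.1.enorm.pow_const _
  rw [lintegral_prod_symm _ hm] at h1
  filter_upwards [hf.1.prodMk_right, ae_lt_top' hm.lintegral_prod_left' h1.ne] with b hb hb'
  exact ⟨hb, (eLpNorm_lt_top_iff_lintegral_rpow_enorm_lt_top hP hP').2 hb'⟩

/-- Weak gradients are unique. -/
theorem IsWeakGradient.ae_eq {N : ℕ} {U : Set (RSpace N)} (hU : IsOpen U) {v : RSpace N → ℝ}
    {g g' : RSpace N → RSpace N} (h : IsWeakGradient U v g) (h' : IsWeakGradient U v g')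
    (hg : IntegrableOn g U) (hg' : IntegrableOn g' U) :
    ∀ᵐ x ∂(volume.restrict U), g x = g' x := by
  have hd : IntegrableOn (fun x => g x - g' x) U := hg.sub hg'
  have := hU.ae_eq_zero_of_integral_contDiff_smul_eq_zero (f := fun x => g x - g' x)
    (μ := volume) hd.locallyIntegrableOn (fun θ hθ hθc hθs => by
      have hz : ∀ x ∉ U, θ x = 0 := fun x hx =>
        image_eq_zero_of_notMem_tsupport fun h => hx (hθs h)
      obtain ⟨C, hC⟩ := hθ.continuous.bounded_above_of_compact_support hθc
      have hint : ∀ k : RSpace N → RSpace N, IntegrableOn k U →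
          IntegrableOn (fun x => θ x • k x) U := fun k hk =>
        hk.bdd_smul C hθ.continuous.aestronglyMeasurable (Eventually.of_forall hC)
      rw [← setIntegral_eq_integral_of_forall_compl_eq_zero (s := U)
        (fun x hx => by simp [hz x hx])]
      simp_rw [smul_sub]
      rw [integral_sub (hint g hg) (hint g' hg'), sub_eq_zero, ← neg_inj, ← h θ ⟨hθ, hθc, hθs⟩,
        ← h' θ ⟨hθ, hθc, hθs⟩])
  rw [ae_restrict_iff' hU.measurableSet]
  filter_upwards [this] with x hx hxU
  exact sub_eq_zero.1 (hx hxU)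

theorem IsWeakGradient.mono {N : ℕ} {U Ω : Set (RSpace N)} (hΩ : MeasurableSet Ω) (hU : U ⊆ Ω)
    {v : RSpace N → ℝ} {g : RSpace N → RSpace N} (h : IsWeakGradient Ω v g) :
    IsWeakGradient U v g := fun _ hθ => h.integral_smoothTest hΩ hU hθ

/-- Time-independent admissible test functions. -/
theorem isTestFunction_const {N : ℕ} {p q C T : ℝ} {E : Set (RSpace N)} (hE : IsCompact E)
    {ψ : RSpace N → ℝ} {g : RSpace N → RSpace N}
    (hψ : AEStronglyMeasurable ψ (volume.restrict E))
    (hb : ∀ᵐ x ∂(volume.restrict E), 0 ≤ ψ x ∧ ψ x ≤ C)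
    (hg : MemLp g (ENNReal.ofReal p) (volume.restrict E)) (hW : MemW0 p E ψ g) :
    IsTestFunction p q E T (fun x _ => ψ x) (fun _ _ => 0) (fun x _ => g x) := by
  have hfin : IsFiniteMeasure (volume.restrict E) :=
    ⟨by rw [Measure.restrict_apply_univ]; exact hE.measure_lt_top⟩
  have hψL : ∀ P, MemLp ψ P (volume.restrict E) := fun P =>
    MemLp.of_bound hψ C (by
      filter_upwards [hb] with x hx
      rw [Real.norm_of_nonneg hx.1]; exact hx.2)
  refine ⟨?_, fun t₁ t₂ _ _ => ?_, fun t₁ t₂ _ _ => ?_, fun t₁ _ t₂ _ => ?_, fun t₁ t₂ _ _ => ?_,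
    fun t₁ t₂ _ _ => ?_, Eventually.of_forall fun t => hW⟩
  · rw [spaceTime, volume_restrict_prod]
    exact Measure.quasiMeasurePreserving_fst.ae (hb.mono fun x hx => hx.1)
  · rw [volume_restrict_prod]
    exact (hψL _).comp_fst _
  · exact MemLp.zero
  · exact Eventually.of_forall fun x => by simp
  · rw [volume_restrict_prod]
    exact (hψL _).comp_fst _
  · rw [volume_restrict_prod]
    exact hg.comp_fst _

/-- A local weak solution has a spatial gradient for which the weak formulation with
time-independent test functions is an identity. -/
theorem IsLocalWeakSolution.exists_gradient {N : ℕ} {p q T : ℝ} {Ω : Set (RSpace N)}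
    {A : RSpace N → ℝ → ℝ → RSpace N → RSpace N} {u : RSpace N → ℝ → ℝ} (hp : 1 < p)
    (hΩ : IsOpen Ω) (h : IsLocalWeakSolution p q Ω T A u) :
    ∃ Du : RSpace N → ℝ → RSpace N, InSolutionSpace p q Ω T u Du ∧
      ∀ (y : RSpace N) (ρ r' : ℝ), r' < ρ → Metric.closedBall y ρ ⊆ Ω →
      ∀ t₁ t₂ : ℝ, 0 < t₁ → t₁ < t₂ → t₂ < T →
      ∀ (ψ : RSpace N → ℝ) (g : RSpace N → RSpace N) (C : ℝ),
        AEStronglyMeasurable ψ (volume.restrict (Metric.closedBall y r')) →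
        (∀ᵐ x ∂(volume.restrict (Metric.closedBall y r')), 0 ≤ ψ x ∧ ψ x ≤ C) →
        MemLp g (ENNReal.ofReal p) (volume.restrict (Metric.closedBall y r')) →
        MemW0 p (Metric.closedBall y r') ψ g →
        ((∫ x in Metric.closedBall y r', signedPow q (u x t₂) * ψ x) -
          ∫ x in Metric.closedBall y r', signedPow q (u x t₁) * ψ x) +
        ∫ τ in t₁..t₂, ∫ x in Metric.closedBall y r',
          inner ℝ (A x τ (u x τ) (Du x τ)) (g x) = 0 := by
  obtain ⟨⟨Du, hDu, hsub⟩, Du', hDu', hsup⟩ := h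
  have hP : 1 ≤ ENNReal.ofReal p := by
    rw [← ENNReal.ofReal_one]; exact ENNReal.ofReal_le_ofReal hp.le
  have hP0 : ENNReal.ofReal p ≠ 0 := (zero_lt_one.trans_le hP).ne'
  refine ⟨Du, hDu, fun y ρ r' hr' hρ t₁ t₂ ht₁ ht ht₂ ψ g C hψ hb hg hW => ?_⟩
  set E := Metric.closedBall y r' with hE
  have hEρ : E ⊆ Metric.ball y ρ := Metric.closedBall_subset_ball hr'
  have hEΩ : E ⊆ Ω := (hEρ.trans Metric.ball_subset_closedBall).trans hρ
  have hEc : IsCompact E := isCompact_closedBall y r'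
  have htest := isTestFunction_const (T := T) (q := q) hEc hψ hb hg hW
  have h1 := hsub E hEc hEΩ t₁ t₂ ht₁ ht ht₂ _ _ _ htest
  have h2 := hsup E hEc hEΩ t₁ t₂ ht₁ ht ht₂ _ _ _ htest
  simp only [weakForm, mul_zero, neg_zero, zero_add] at h1 h2
  -- The sub- and supersolution properties each supply their own gradient. Uniqueness of weak
  -- gradients on almost every time slice identifies the two flux terms, so the opposite
  -- inequalities combine.
  refine le_antisymm h1 (h2.trans_eq ?_)
  congr 1
  have hfin : IsFiniteMeasure (volume.restrict (Metric.closedBall y ρ)) :=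
    ⟨by rw [Measure.restrict_apply_univ]; exact (isCompact_closedBall y ρ).measure_lt_top⟩
  have hslice : ∀ D : RSpace N → ℝ → RSpace N, InSolutionSpace p q Ω T u D →
      ∀ᵐ τ ∂(volume.restrict (Icc t₁ t₂)),
        IntegrableOn (fun x => D x τ) (Metric.ball y ρ) ∧
        IsWeakGradient (Metric.ball y ρ) (fun x => u x τ) (fun x => D x τ) := by
    intro D hD
    have a1 := hD.memLp_gradient _ (isCompact_closedBall y ρ) hρ t₁ t₂ ht₁ ht₂
    rw [volume_restrict_prod] at a1
    have a2 := ae_restrict_of_ae_restrict_of_subset (t := Ioo 0 T) (s := Icc t₁ t₂)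
      (Icc_subset_Ioo ht₁ ht₂) hD.gradient
    filter_upwards [a1.prodMk_right hP0 ENNReal.ofReal_ne_top, a2] with τ b1 b2
    refine ⟨IntegrableOn.mono_set (b1.integrable hP) Metric.ball_subset_closedBall, ?_⟩
    exact b2.mono hΩ.measurableSet (Metric.ball_subset_closedBall.trans hρ)
  refine intervalIntegral.integral_congr_ae ?_
  rw [uIoc_of_le ht.le, ← ae_restrict_iff' measurableSet_Ioc]
  have hslice' := ae_restrict_of_ae_restrict_of_subset Ioc_subset_Icc_self
    ((hslice Du hDu).and (hslice Du' hDu'))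
  filter_upwards [hslice'] with τ hτ
  have := ae_restrict_of_ae_restrict_of_subset hEρ
    (hτ.1.2.ae_eq Metric.isOpen_ball hτ.2.2 hτ.1.1 hτ.2.1)
  refine integral_congr_ae ?_
  filter_upwards [this] with x hx
  rw [hx]

/-! ### Backward differences in time and their limit -/

/-- Fubini in three variables. It exchanges the integral over time, where the difference inequality
is available, with the integral over the shift, where the limit is taken. -/
theorem integral_prodAssoc_comm {α β γ : Type*} [MeasurableSpace α] [MeasurableSpace β]
    [MeasurableSpace γ] {μ : Measure α} {ν : Measure β} {κ : Measure γ} [SFinite μ] [SFinite ν]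
    [SFinite κ] {K : (α × β) × γ → ℝ} (hK : Integrable K ((μ.prod ν).prod κ)) :
    Integrable (fun b => ∫ c, ∫ a, K ((a, b), c) ∂μ ∂κ) ν ∧
      ∫ b, ∫ c, ∫ a, K ((a, b), c) ∂μ ∂κ ∂ν = ∫ c, ∫ z, K (z, c) ∂(μ.prod ν) ∂κ := by
  have hmp := measurePreserving_prodAssoc μ ν κ
  set K' : α × β × γ → ℝ := fun w => K (MeasurableEquiv.prodAssoc.symm w) with hK'
  have hint : Integrable K' (μ.prod (ν.prod κ)) := by
    rw [← hmp.integrable_comp_emb MeasurableEquiv.prodAssoc.measurableEmbedding]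
    exact hK
  have hk : Integrable (fun w : β × γ => ∫ a, K' (a, w) ∂μ) (ν.prod κ) := hint.integral_prod_right
  refine ⟨hk.integral_prod_left, ?_⟩
  have e1 := integral_prod _ hk
  have e2 := integral_prod_symm _ hint
  have e3 := hmp.integral_comp MeasurableEquiv.prodAssoc.measurableEmbedding K'
  have e4 := integral_prod_symm _ hK
  calc _ = ∫ w, ∫ a, K' (a, w) ∂μ ∂(ν.prod κ) := e1.symm
    _ = ∫ w, K' w ∂(μ.prod (ν.prod κ)) := e2.symm
    _ = ∫ w, K w ∂((μ.prod ν).prod κ) := e3.symm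
    _ = _ := e4

open scoped ENNReal in
-- Hölder's inequality reduces the claim to continuity of translations on the `L^P` factor; the
-- other factor stays fixed.
theorem tendsto_integral_inner_translate {V F : Type*} [NormedAddCommGroup V] [NormedSpace ℝ V]
    [FiniteDimensional ℝ V] [MeasurableSpace V] [BorelSpace V] {μ : Measure V}
    [μ.IsAddHaarMeasure] [NormedAddCommGroup F] [InnerProductSpace ℝ F] {P Q : ℝ≥0∞}
    [P.HolderConjugate Q] (hP1 : 1 ≤ P) (hP : P ≠ ⊤) {f g : V → F} (hf : MemLp f P μ)
    (hg : MemLp g Q μ) :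
    Tendsto (fun w : V => ∫ z, inner ℝ (f (z - w)) (g z) ∂μ) (𝓝 0)
      (𝓝 (∫ z, inner ℝ (f z) (g z) ∂μ)) := by
  rw [tendsto_iff_edist_tendsto_0]
  have h1 : Tendsto (fun w : V => eLpNorm (fun z => f (z - w) - f z) P μ * eLpNorm g Q μ)
      (𝓝 0) (𝓝 0) := by
    have h4 := ENNReal.Tendsto.mul_const (b := eLpNorm g Q μ)
      (tendsto_eLpNorm_translate_sub hP1 hP hf) (Or.inr hg.2.ne)
    simpa using h4
  refine tendsto_of_tendsto_of_tendsto_of_le_of_le tendsto_const_nhds h1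
    (fun _ => zero_le) fun w => ?_
  have hw : MemLp (fun z => f (z - w)) P μ :=
    hf.comp_measurePreserving (measurePreserving_sub_right μ w)
  simp only
  rw [edist_eq_enorm_sub, ← integral_sub (norm_integral_inner_le hw hg).1
    (norm_integral_inner_le hf hg).1]
  simp_rw [← inner_sub_left]
  exact (norm_integral_inner_le (hw.sub hf) hg).2.1

open scoped ENNReal in
-- Translation preserves the `L^P` norm, so Hölder's bound does not depend on the shift and can be
-- integrated against a finite measure of shifts. This justifies Fubini for the shifted pairing.
theorem integrable_inner_translate {V F : Type*} [NormedAddCommGroup V] [NormedSpace ℝ V]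
    [FiniteDimensional ℝ V] [MeasurableSpace V] [BorelSpace V] {μ : Measure V}
    [μ.IsAddHaarMeasure] [NormedAddCommGroup F] [InnerProductSpace ℝ F] {P Q : ℝ≥0∞}
    [P.HolderConjugate Q] {f g : V → F} (hf : MemLp f P μ) (hg : MemLp g Q μ)
    {S : Type*} [MeasurableSpace S] {κ : Measure S} [IsFiniteMeasure κ] {ι : S → V}
    (hι : Measurable ι) :
    Integrable (fun w : V × S => (inner ℝ (f (w.1 - ι w.2)) (g w.1) : ℝ)) (μ.prod κ) := by
  have hq : Measure.QuasiMeasurePreserving (fun w : V × S => w.1 - ι w.2) (μ.prod κ) μ := by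
    have h1 : MeasurePreserving (fun w : S × V => (w.1, w.2 - ι w.1)) (κ.prod μ) (κ.prod μ) :=
      MeasurePreserving.skew_product (g := fun θ z => z - ι θ)
        (MeasurePreserving.id _) (by fun_prop)
        (Eventually.of_forall fun θ => (measurePreserving_sub_right μ (ι θ)).map_eq)
    exact (Measure.quasiMeasurePreserving_snd.comp h1.quasiMeasurePreserving).comp
      Measure.measurePreserving_swap.quasiMeasurePreserving
  have hm : AEStronglyMeasurable (fun w : V × S => (inner ℝ (f (w.1 - ι w.2)) (g w.1) : ℝ))
      (μ.prod κ) := (hf.1.comp_quasiMeasurePreserving hq).inner hg.1.comp_fst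
  refine ⟨hm, ?_⟩
  change ∫⁻ w : V × S, ‖(inner ℝ (f (w.1 - ι w.2)) (g w.1) : ℝ)‖ₑ ∂_ < ⊤
  rw [lintegral_prod_symm _ hm.enorm]
  calc ∫⁻ θ, ∫⁻ z, ‖(inner ℝ (f (z - ι θ)) (g z) : ℝ)‖ₑ ∂μ ∂κ
      ≤ ∫⁻ _, eLpNorm f P μ * eLpNorm g Q μ ∂κ := by
        refine lintegral_mono fun θ => ?_
        have hmp := measurePreserving_sub_right μ (ι θ)
        have := (norm_integral_inner_le (hf.comp_measurePreserving hmp) hg).2.2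
        rwa [eLpNorm_comp_measurePreserving hf.1 hmp] at this
    _ < ⊤ := by
        rw [lintegral_const]
        exact ENNReal.mul_lt_top (ENNReal.mul_lt_top hf.2 hg.2) (measure_lt_top _ _)

set_option maxHeartbeats 400000 in
open scoped ENNReal in
/-- Passage to the limit in a backward-difference inequality with frozen test functions. -/
theorem integral_inner_le_of_difference {V : Type*} [NormedAddCommGroup V] [InnerProductSpace ℝ V]
    [FiniteDimensional ℝ V] [MeasurableSpace V] [BorelSpace V] {E : Set V} (hE : MeasurableSet E)
    {a t₁ t₂ c : ℝ} (ha : a < t₁) (ht : t₁ ≤ t₂) {P Q : ℝ≥0∞} [P.HolderConjugate Q]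
    (hP1 : 1 ≤ P) (hP : P ≠ ⊤) {F Φ : V → ℝ → V}
    (hF : MemLp (fun z : V × ℝ => F z.1 z.2) P (volume.restrict (E ×ˢ Icc a t₂)))
    (hΦ : MemLp (fun z : V × ℝ => Φ z.1 z.2) Q (volume.restrict (E ×ˢ Icc t₁ t₂)))
    {Z : ℝ → ℝ} (hZi : IntegrableOn Z (Icc a t₂)) (hZ : ∀ τ ∈ Icc a t₂, 0 ≤ Z τ ∧ Z τ ≤ c)
    (hdiff : ∀ h, 0 < h → h < t₁ - a → ∀ᵐ τ ∂(volume.restrict (Icc t₁ t₂)),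
      Z (τ - h) - Z τ + ∫ σ in (τ - h)..τ, ∫ x in E, inner ℝ (F x σ) (Φ x τ) ≤ 0) :
    ∫ z in E ×ˢ Icc t₁ t₂, inner ℝ (F z.1 z.2) (Φ z.1 z.2) ≤ c := by
  set Ft : V × ℝ → V := (E ×ˢ Icc a t₂).indicator fun z => F z.1 z.2 with hFt
  set Φt : V × ℝ → V := (E ×ˢ Icc t₁ t₂).indicator fun z => Φ z.1 z.2 with hΦt
  have hEa : MeasurableSet (E ×ˢ Icc a t₂) := hE.prod measurableSet_Icc
  have hE1 : MeasurableSet (E ×ˢ Icc t₁ t₂) := hE.prod measurableSet_Icc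
  have hFL : MemLp Ft P volume := (memLp_indicator_iff_restrict hEa).2 hF
  have hΦL : MemLp Φt Q volume := (memLp_indicator_iff_restrict hE1).2 hΦ
  have hhaar : (volume : Measure (V × ℝ)).IsAddHaarMeasure := by
    rw [Measure.volume_eq_prod]; infer_instance
  -- Pairing of `Φ` with `F` taken `θ` earlier. The target is `J 0`; the difference inequality only
  -- controls integrals of `J` over `[0, h]`.
  set J : ℝ → ℝ := fun θ => ∫ z, inner ℝ (Ft (z - (0, θ))) (Φt z) with hJ
  have hJ0 : J 0 = ∫ z in E ×ˢ Icc t₁ t₂, inner ℝ (F z.1 z.2) (Φ z.1 z.2) := by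
    simp only [hJ]
    rw [← setIntegral_eq_integral_of_forall_compl_eq_zero (s := E ×ˢ Icc t₁ t₂)
      (fun z hz => by simp [hΦt, indicator_of_notMem hz])]
    refine setIntegral_congr_fun hE1 fun z hz => ?_
    have hz' : z ∈ E ×ˢ Icc a t₂ := ⟨hz.1, ⟨ha.le.trans hz.2.1, hz.2.2⟩⟩
    have h0 : z - (0, 0) = z := sub_zero z
    simp only [hΦt, hFt, h0, indicator_of_mem hz, indicator_of_mem hz']
  have hJlim : Tendsto J (𝓝 0) (𝓝 (J 0)) := by
    have h2 : Tendsto (fun θ : ℝ => ((0 : V), θ)) (𝓝 0) (𝓝 0) := by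
      have : Continuous fun θ : ℝ => ((0 : V), θ) := by fun_prop
      exact this.tendsto 0
    have h3 := (tendsto_integral_inner_translate hP1 hP hFL hΦL).comp h2
    refine h3.trans_eq ?_
    have h0 : ∀ z : V × ℝ, z - ((0 : V), (0 : ℝ)) = z := sub_zero
    simp only [hJ, h0]
  set K : (V × ℝ) × ℝ → ℝ := fun w => inner ℝ (Ft (w.1 - (0, w.2))) (Φt w.1) with hK
  have hKi : ∀ h : ℝ, Integrable K
      (((volume : Measure V).prod (volume : Measure ℝ)).prod (volume.restrict (Ioc 0 h))) := by
    intro h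
    exact integrable_inner_translate (ι := fun θ : ℝ => ((0 : V), θ)) hFL hΦL (by fun_prop)
  have hmain : ∀ h, 0 < h → h < t₁ - a →
      IntervalIntegrable J volume 0 h ∧ ∫ θ in (0 : ℝ)..h, J θ ≤ h * c := by
    intro h hh0 hh
    have hJi : IntegrableOn J (Ioc 0 h) := (hKi h).integral_prod_right
    refine ⟨(intervalIntegrable_iff_integrableOn_Ioc_of_le hh0.le).2 hJi, ?_⟩
    obtain ⟨ki, keq⟩ := integral_prodAssoc_comm (hKi h)
    set k : ℝ → ℝ := fun τ => ∫ θ in Ioc 0 h, ∫ x, K ((x, τ), θ) with hk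
    have hk0 : ∀ τ ∉ Icc t₁ t₂, k τ = 0 := by
      intro τ hτ
      have : ∀ x : V, ∀ θ, K ((x, τ), θ) = 0 := by
        intro x θ
        have hz : (x, τ) ∉ E ×ˢ Icc t₁ t₂ := fun h => hτ h.2
        simp [hK, hΦt, indicator_of_notMem hz]
      simp [hk, this]
    have hkeq : ∀ τ ∈ Icc t₁ t₂,
        k τ = ∫ σ in (τ - h)..τ, ∫ x in E, inner ℝ (F x σ) (Φ x τ) := by
      intro τ hτ
      have h1 := intervalIntegral.integral_comp_sub_left (a := 0) (b := h)
        (fun σ => ∫ x in E, (inner ℝ (F x σ) (Φ x τ) : ℝ)) τ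
      rw [sub_zero] at h1
      rw [← h1, intervalIntegral.integral_of_le hh0.le]
      refine setIntegral_congr_fun measurableSet_Ioc fun θ hθ => ?_
      rw [← setIntegral_eq_integral_of_forall_compl_eq_zero (s := E) (fun x hx => by
        have hz : (x, τ) ∉ E ×ˢ Icc t₁ t₂ := fun h => hx h.1
        simp [hK, hΦt, indicator_of_notMem hz])]
      refine setIntegral_congr_fun hE fun x hx => ?_
      have hz : (x, τ) ∈ E ×ˢ Icc t₁ t₂ := ⟨hx, hτ⟩
      have hz' : (x, τ - θ) ∈ E ×ˢ Icc a t₂ :=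
        ⟨hx, ⟨by linarith [hτ.1, hθ.2], by linarith [hτ.2, hθ.1]⟩⟩
      simp only [hK, Prod.mk_sub_mk, sub_zero, hFt, hΦt, indicator_of_mem hz, indicator_of_mem hz']
    have hZii : ∀ b d, b ∈ Icc a t₂ → d ∈ Icc a t₂ → IntervalIntegrable Z volume b d := by
      intro b d hb hd
      rw [intervalIntegrable_iff]
      exact hZi.mono_set (uIoc_subset_uIcc.trans (uIcc_subset_Icc hb hd))
    have m1 : t₁ ∈ Icc a t₂ := ⟨ha.le, ht⟩
    have m2 : t₂ ∈ Icc a t₂ := ⟨ha.le.trans ht, le_rfl⟩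
    have m3 : t₁ - h ∈ Icc a t₂ := ⟨by linarith, by linarith⟩
    have m4 : t₂ - h ∈ Icc a t₂ := ⟨by linarith, by linarith⟩
    have hZs : IntervalIntegrable (fun τ => Z (τ - h)) volume t₁ t₂ := by
      have := (hZii _ _ m3 m4).comp_sub_right h
      simpa using this
    have hZd : IntervalIntegrable (fun τ => Z τ - Z (τ - h)) volume t₁ t₂ :=
      (hZii _ _ m1 m2).sub hZs
    calc ∫ θ in (0 : ℝ)..h, J θ = ∫ θ in Ioc 0 h, J θ :=
          intervalIntegral.integral_of_le hh0.le
      _ = ∫ τ, k τ := keq.symm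
      _ = ∫ τ in Icc t₁ t₂, k τ :=
          (setIntegral_eq_integral_of_forall_compl_eq_zero hk0).symm
      _ ≤ ∫ τ in Icc t₁ t₂, (Z τ - Z (τ - h)) := by
          refine setIntegral_mono_ae_restrict ki.integrableOn ?_ ?_
          · exact (intervalIntegrable_iff_integrableOn_Icc_of_le ht).1 hZd
          · filter_upwards [hdiff h hh0 hh, ae_restrict_mem measurableSet_Icc] with τ h1 h2
            rw [hkeq τ h2]
            linarith
      _ = ∫ τ in t₁..t₂, (Z τ - Z (τ - h)) := by
          rw [intervalIntegral.integral_of_le ht, integral_Icc_eq_integral_Ioc]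
      -- The differences telescope, leaving two layers of width `h`: the one at `t₂` is bounded by
      -- `h * c`, the one at `t₁` is dropped since `Z` is nonnegative.
      _ = (∫ τ in (t₂ - h)..t₂, Z τ) - ∫ τ in (t₁ - h)..t₁, Z τ := by
          rw [intervalIntegral.integral_sub (hZii _ _ m1 m2) hZs,
            intervalIntegral.integral_comp_sub_right,
            intervalIntegral.integral_interval_sub_interval_comm' (hZii _ _ m1 m2)
              (hZii _ _ m3 m4) (hZii _ _ m1 m3)]
      _ ≤ h * c - 0 := by
          refine sub_le_sub ?_ ?_
          · have h1 : ∫ τ in (t₂ - h)..t₂, Z τ ≤ ∫ τ in (t₂ - h)..t₂, c :=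
              intervalIntegral.integral_mono_on (by linarith) (hZii _ _ m4 m2)
                intervalIntegrable_const fun τ hτ => (hZ τ ⟨m4.1.trans hτ.1, hτ.2⟩).2
            rw [intervalIntegral.integral_const, smul_eq_mul] at h1
            linarith
          · exact intervalIntegral.integral_nonneg (by linarith) fun τ hτ =>
              (hZ τ ⟨m3.1.trans hτ.1, hτ.2.trans ht⟩).1
      _ = h * c := sub_zero _
  rw [← hJ0]
  -- Continuity of `J` at zero: if `J 0 > c`, then `J` exceeds some `c' > c` on a short interval,
  -- contradicting that its mean over `[0, h]` is at most `c`.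
  by_contra! hcon
  obtain ⟨c', hc, hc'⟩ := exists_between hcon
  obtain ⟨d, hd, hball⟩ := Metric.eventually_nhds_iff.1 (hJlim.eventually (lt_mem_nhds hc'))
  set h := min d (t₁ - a) / 2 with hh
  have hmin : 0 < min d (t₁ - a) := lt_min hd (by linarith)
  have hh0 : 0 < h := by positivity
  have hhd : h < d := by
    have := min_le_left d (t₁ - a)
    linarith
  have hha : h < t₁ - a := by
    have := min_le_right d (t₁ - a)
    linarith
  obtain ⟨hi, hle⟩ := hmain h hh0 hha
  have h1 : ∫ θ in (0 : ℝ)..h, c' ≤ ∫ θ in (0 : ℝ)..h, J θ :=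
    intervalIntegral.integral_mono_on hh0.le intervalIntegrable_const hi fun θ hθ =>
      (hball (by rw [Real.dist_eq, sub_zero, abs_of_nonneg hθ.1]; linarith [hθ.2])).le
  rw [intervalIntegral.integral_const, smul_eq_mul, sub_zero] at h1
  nlinarith

/-! ### Slices, continuity in time and integrability of the flux -/

/-- The standing assumptions for the local estimates on the ball `B_r(y)` and the times `(s, t)`:
a solution `u` with gradient `Du` and values in `[m, μ]`, for which the weak formulation with
time-independent test functions holds on the smaller ball `B_{r'}(y)`. -/
structure LocalSetting {N : ℕ} (p q K₁ K₂ : ℝ) (Ω : Set (RSpace N)) (T : ℝ)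
    (A : RSpace N → ℝ → ℝ → RSpace N → RSpace N) (u : RSpace N → ℝ → ℝ)
    (Du : RSpace N → ℝ → RSpace N) (y : RSpace N) (r r' s t m μ : ℝ) : Prop where
  one_lt_p : 1 < p
  one_lt_q : 1 < q
  isOpen : IsOpen Ω
  conditions : StructureConditions p K₁ K₂ Ω T A
  space : InSolutionSpace p q Ω T u Du
  r_pos : 0 < r
  r'_lt : r' < r
  time_lt : s < t
  subset : Metric.ball y r ×ˢ Ioo s t ⊆ spaceTime Ω T
  bounds : ∀ᵐ z : RSpace N × ℝ ∂(volume.restrict (Metric.ball y r ×ˢ Ioo s t)),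
    m ≤ u z.1 z.2 ∧ u z.1 z.2 ≤ μ
  identity : ∀ t₁ t₂ : ℝ, 0 < t₁ → t₁ < t₂ → t₂ < T →
    ∀ (ψ : RSpace N → ℝ) (g : RSpace N → RSpace N) (C : ℝ),
      AEStronglyMeasurable ψ (volume.restrict (Metric.closedBall y r')) →
      (∀ᵐ x ∂(volume.restrict (Metric.closedBall y r')), 0 ≤ ψ x ∧ ψ x ≤ C) →
      MemLp g (ENNReal.ofReal p) (volume.restrict (Metric.closedBall y r')) →
      MemW0 p (Metric.closedBall y r') ψ g →
      ((∫ x in Metric.closedBall y r', signedPow q (u x t₂) * ψ x) -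
        ∫ x in Metric.closedBall y r', signedPow q (u x t₁) * ψ x) +
      ∫ τ in t₁..t₂, ∫ x in Metric.closedBall y r',
        inner ℝ (A x τ (u x τ) (Du x τ)) (g x) = 0

namespace LocalSetting

variable {N : ℕ} {p q K₁ K₂ : ℝ} {Ω : Set (RSpace N)} {T : ℝ}
  {A : RSpace N → ℝ → ℝ → RSpace N → RSpace N} {u : RSpace N → ℝ → ℝ}
  {Du : RSpace N → ℝ → RSpace N} {y : RSpace N} {r r' s t m μ : ℝ}

theorem ball_subset (H : LocalSetting p q K₁ K₂ Ω T A u Du y r r' s t m μ) :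
    Metric.ball y r ⊆ Ω := fun _ hx =>
  (H.subset (mk_mem_prod hx (⟨left_lt_add_div_two.2 H.time_lt, add_div_two_lt_right.2 H.time_lt⟩ :
    (s + t) / 2 ∈ Ioo s t))).1

theorem Ioo_subset (H : LocalSetting p q K₁ K₂ Ω T A u Du y r r' s t m μ) :
    Ioo s t ⊆ Ioo 0 T := fun _ hτ =>
  (H.subset (mk_mem_prod (Metric.mem_ball_self H.r_pos) hτ)).2

theorem closedBall_subset (H : LocalSetting p q K₁ K₂ Ω T A u Du y r r' s t m μ) {ρ : ℝ}
    (hρ : ρ < r) : Metric.closedBall y ρ ⊆ Ω :=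
  (Metric.closedBall_subset_ball hρ).trans H.ball_subset

theorem le (H : LocalSetting p q K₁ K₂ Ω T A u Du y r r' s t m μ) : m ≤ μ := by
  by_contra! hlt
  have h0 : ∀ᵐ z : RSpace N × ℝ ∂(volume.restrict (Metric.ball y r ×ˢ Ioo s t)), False := by
    filter_upwards [H.bounds] with z hz
    linarith
  rw [ae_iff] at h0
  simp only [not_false_eq_true, ofPred_true, Measure.restrict_apply_univ] at h0
  have hopen : IsOpen (Metric.ball y r ×ˢ Ioo s t) := Metric.isOpen_ball.prod isOpen_Ioo
  exact hopen.measure_ne_zero volume ⟨(y, (s + t) / 2), Metric.mem_ball_self H.r_pos,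
    left_lt_add_div_two.2 H.time_lt, add_div_two_lt_right.2 H.time_lt⟩ h0

theorem isFiniteMeasure_ball (y : RSpace N) (ρ : ℝ) :
    IsFiniteMeasure (volume.restrict (Metric.closedBall y ρ)) :=
  ⟨by rw [Measure.restrict_apply_univ]; exact (isCompact_closedBall y ρ).measure_lt_top⟩

/-- At every time the slice of `u` satisfies the bounds. -/
theorem slice_bounds (H : LocalSetting p q K₁ K₂ Ω T A u Du y r r' s t m μ) {ρ : ℝ} (hρ : ρ < r)
    {τ : ℝ} (hτ : τ ∈ Icc s t ∩ Ioo 0 T) :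
    ∀ᵐ x ∂(volume.restrict (Metric.closedBall y ρ)), u x τ ∈ Icc m μ := by
  have h1 := H.bounds
  rw [volume_restrict_prod] at h1
  have h2 : ∀ᵐ τ' ∂(volume : Measure ℝ), τ' ∈ Ioo s t →
      ∀ᵐ x ∂(volume.restrict (Metric.ball y r)), m ≤ u x τ' ∧ u x τ' ≤ μ :=
    (ae_restrict_iff' measurableSet_Ioo).1 (ae_ae_of_ae_prod_swap h1)
  -- The bounds are known only at almost every time. Such times are dense, so `τ` is a limit of
  -- them, endpoints included; convergence of slices in `L^(q+1)` gives almost everywhere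
  -- convergence along a subsequence, which preserves the bounds.
  have hcl : τ ∈ closure (Ioo s t ∩ {τ' | τ' ∈ Ioo s t →
      ∀ᵐ x ∂(volume.restrict (Metric.ball y r)), m ≤ u x τ' ∧ u x τ' ≤ μ}) := by
    have h3 := (Measure.dense_of_ae h2).open_subset_closure_inter (isOpen_Ioo (a := s) (b := t))
    have h4 : τ ∈ closure (Ioo s t) := by rw [closure_Ioo H.time_lt.ne]; exact hτ.1
    exact closure_minimal h3 isClosed_closure h4
  obtain ⟨τn, hτn, hlim⟩ := mem_closure_iff_seq_limit.1 hcl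
  have hK := H.closedBall_subset hρ
  have hKc := isCompact_closedBall y ρ
  have hq1 := H.one_lt_q
  have hconv := (H.space.continuous_slice _ hKc hK τ hτ.2).comp hlim
  have hmeas := tendstoInMeasure_of_tendsto_eLpNorm
    (ENNReal.ofReal_pos.2 (by linarith)).ne'
    (fun n => (H.space.memLp_slice _ hKc hK (τn n) (H.Ioo_subset (hτn n).1)).1)
    (H.space.memLp_slice _ hKc hK τ hτ.2).1 hconv
  obtain ⟨ns, -, hns⟩ := hmeas.exists_seq_tendsto_ae
  have hall : ∀ᵐ x ∂(volume.restrict (Metric.closedBall y ρ)), ∀ n,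
      m ≤ u x (τn n) ∧ u x (τn n) ≤ μ := by
    rw [ae_all_iff]
    exact fun n => ae_restrict_of_ae_restrict_of_subset (Metric.closedBall_subset_ball hρ)
      ((hτn n).2 (hτn n).1)
  filter_upwards [hns, hall] with x hx hxn
  exact ⟨ge_of_tendsto' hx fun n => (hxn _).1, le_of_tendsto' hx fun n => (hxn _).2⟩

/-- Continuous functions of a slice times a bounded cutoff are integrable. -/
theorem integrable_slice (H : LocalSetting p q K₁ K₂ Ω T A u Du y r r' s t m μ) {k : ℝ → ℝ}
    (hk : Continuous k) {η : RSpace N → ℝ} (hη : Continuous η) {τ : ℝ}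
    (hτ : τ ∈ Icc s t ∩ Ioo 0 T) :
    IntegrableOn (fun x => k (u x τ) * η x) (Metric.closedBall y r') := by
  have hfin := isFiniteMeasure_ball y r'
  have hKc := isCompact_closedBall y r'
  obtain ⟨C, hC⟩ := (isCompact_Icc (a := m) (b := μ)).exists_bound_of_continuousOn hk.continuousOn
  obtain ⟨C', hC'⟩ := hKc.exists_bound_of_continuousOn hη.continuousOn
  have hm : AEStronglyMeasurable (fun x => u x τ) (volume.restrict (Metric.closedBall y r')) :=
    (H.space.memLp_slice _ hKc (H.closedBall_subset H.r'_lt) τ hτ.2).1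
  refine Integrable.of_bound ((hk.comp_aestronglyMeasurable hm).mul hη.aestronglyMeasurable)
    (C * C') ?_
  filter_upwards [H.slice_bounds H.r'_lt hτ, ae_restrict_mem hKc.measurableSet] with x hx hxm
  rw [norm_mul]
  exact mul_le_mul (hC _ hx) (hC' _ hxm) (norm_nonneg _) ((norm_nonneg _).trans (hC _ hx))

/-- The weighted integrals of the signed power of `u` are continuous in time. -/
theorem continuousWithinAt_integral (H : LocalSetting p q K₁ K₂ Ω T A u Du y r r' s t m μ)
    {η : RSpace N → ℝ} (hη : Continuous η) (hη0 : ∀ x, 0 ≤ η x) (hη1 : ∀ x, η x ≤ 1) {τ : ℝ}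
    (hτ : τ ∈ Icc s t ∩ Ioo 0 T) :
    ContinuousWithinAt
      (fun τ => ∫ x in Metric.closedBall y r', (signedPow q μ - signedPow q (u x τ)) * η x)
      (Icc s t ∩ Ioo 0 T) τ := by
  set E := Metric.closedBall y r' with hE
  have hfin := isFiniteMeasure_ball y r'
  have hKc := isCompact_closedBall y r'
  have hKΩ := H.closedBall_subset H.r'_lt
  have hq1 := H.one_lt_q
  -- Lipschitz constant of the signed power on `[m, μ]`. It reduces continuity of the integral to
  -- continuity of slices in `L^1`, hence in `L^(q+1)` on a set of finite measure.
  set C := q * (max |m| |μ|) ^ (q - 1) with hC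
  have hC0 : 0 ≤ C := by positivity
  have hk : Continuous fun z => signedPow q μ - signedPow q z :=
    continuous_const.sub (continuous_signedPow hq1)
  rw [ContinuousWithinAt, tendsto_iff_edist_tendsto_0]
  have hlim : Tendsto (fun τ' => ENNReal.ofReal C *
      (eLpNorm (fun x => u x τ' - u x τ) (ENNReal.ofReal (q + 1)) (volume.restrict E) *
      (volume.restrict E) univ ^ (1 / (1 : ENNReal).toReal - 1 / (ENNReal.ofReal (q + 1)).toReal)))
      (𝓝[Icc s t ∩ Ioo 0 T] τ) (𝓝 0) := by
    have h1 := (H.space.continuous_slice E hKc hKΩ τ hτ.2).mono_left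
      (nhdsWithin_le_nhds (s := Icc s t ∩ Ioo 0 T))
    have hexp : 0 ≤ 1 / (1 : ENNReal).toReal - 1 / (ENNReal.ofReal (q + 1)).toReal := by
      rw [ENNReal.toReal_ofReal (by linarith), ENNReal.toReal_one, sub_nonneg, one_div_one,
        div_le_one (by linarith)]
      linarith
    have h2 := ENNReal.Tendsto.mul_const (b := (volume.restrict E) univ ^
      (1 / (1 : ENNReal).toReal - 1 / (ENNReal.ofReal (q + 1)).toReal)) h1
      (Or.inr (ENNReal.rpow_ne_top_of_nonneg hexp (measure_ne_top _ _)))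
    have h3 := ENNReal.Tendsto.const_mul (a := ENNReal.ofReal C) h2 (Or.inr ENNReal.ofReal_ne_top)
    simpa using h3
  refine tendsto_of_tendsto_of_tendsto_of_le_of_le' tendsto_const_nhds hlim
    (Eventually.of_forall fun _ => zero_le) ?_
  filter_upwards [self_mem_nhdsWithin] with τ' hτ'
  rw [edist_eq_enorm_sub, ← integral_sub (H.integrable_slice hk hη hτ')
    (H.integrable_slice hk hη hτ)]
  refine (enorm_integral_le_lintegral_enorm _).trans ?_
  have hm := (H.space.memLp_slice E hKc hKΩ τ hτ.2).1
  have hm' := (H.space.memLp_slice E hKc hKΩ τ' hτ'.2).1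
  have hle : (1 : ENNReal) ≤ ENNReal.ofReal (q + 1) := by
    rw [← ENNReal.ofReal_one]; exact ENNReal.ofReal_le_ofReal (by linarith)
  refine le_trans ?_ (mul_le_mul_right
    (eLpNorm_le_eLpNorm_mul_rpow_measure_univ hle (hm'.sub hm)) (ENNReal.ofReal C))
  rw [eLpNorm_one_eq_lintegral_enorm, ← lintegral_const_mul' _ _ ENNReal.ofReal_ne_top]
  refine lintegral_mono_ae ?_
  filter_upwards [H.slice_bounds H.r'_lt hτ, H.slice_bounds H.r'_lt hτ'] with x hx hx'
  rw [← Real.enorm_of_nonneg hC0, ← enorm_mul, enorm_le_iff_norm_le, norm_mul,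
    Real.norm_of_nonneg hC0, ← sub_mul, norm_mul, Real.norm_of_nonneg (hη0 x)]
  have h1 := abs_signedPow_sub_le (M := max |m| |μ|) hq1 (abs_le_max_abs_abs hx.1 hx.2)
    (abs_le_max_abs_abs hx'.1 hx'.2)
  have h2 : signedPow q μ - signedPow q (u x τ') - (signedPow q μ - signedPow q (u x τ)) =
      signedPow q (u x τ) - signedPow q (u x τ') := by ring
  rw [h2, Pi.sub_apply, Real.norm_eq_abs, Real.norm_eq_abs, abs_sub_comm (u x τ')]
  calc |signedPow q (u x τ) - signedPow q (u x τ')| * η x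
      ≤ |signedPow q (u x τ) - signedPow q (u x τ')| * 1 := by gcongr; exact hη1 x
    _ ≤ _ := by rw [mul_one]; exact h1

section cylinder

variable {a b : ℝ}

theorem cylinder_subset (H : LocalSetting p q K₁ K₂ Ω T A u Du y r r' s t m μ) (ha : s < a)
    (hb : b < t) : Metric.closedBall y r' ×ˢ Icc a b ⊆ Metric.ball y r ×ˢ Ioo s t :=
  prod_mono (Metric.closedBall_subset_ball H.r'_lt) (Icc_subset_Ioo ha hb)

theorem isFiniteMeasure_cylinder (y : RSpace N) (r' a b : ℝ) :
    IsFiniteMeasure ((volume : Measure (RSpace N × ℝ)).restrict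
      (Metric.closedBall y r' ×ˢ Icc a b)) :=
  ⟨by
    rw [Measure.restrict_apply_univ]
    exact ((isCompact_closedBall y r').prod isCompact_Icc).measure_lt_top⟩

theorem ae_cylinder_bounds (H : LocalSetting p q K₁ K₂ Ω T A u Du y r r' s t m μ) (ha : s < a)
    (hb : b < t) : ∀ᵐ z : RSpace N × ℝ ∂(volume.restrict (Metric.closedBall y r' ×ˢ Icc a b)),
      u z.1 z.2 ∈ Icc m μ :=
  ae_restrict_of_ae_restrict_of_subset (H.cylinder_subset ha hb) H.bounds

theorem aestronglyMeasurable_u (H : LocalSetting p q K₁ K₂ Ω T A u Du y r r' s t m μ) (ha : s < a)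
    (hb : b < t) : AEStronglyMeasurable (fun z : RSpace N × ℝ => u z.1 z.2)
      (volume.restrict (Metric.closedBall y r' ×ˢ Icc a b)) :=
  H.space.measurable.mono_measure
    (Measure.restrict_mono ((H.cylinder_subset ha hb).trans H.subset) le_rfl)

theorem memLp_Du (H : LocalSetting p q K₁ K₂ Ω T A u Du y r r' s t m μ) (ha : s < a) (hab : a ≤ b)
    (hb : b < t) : MemLp (fun z : RSpace N × ℝ => Du z.1 z.2) (ENNReal.ofReal p)
      (volume.restrict (Metric.closedBall y r' ×ˢ Icc a b)) :=
  H.space.memLp_gradient _ (isCompact_closedBall y r') (H.closedBall_subset H.r'_lt) a b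
    (H.Ioo_subset ⟨ha, hab.trans_lt hb⟩).1 (H.Ioo_subset ⟨ha.trans_le hab, hb⟩).2

theorem ae_flux (H : LocalSetting p q K₁ K₂ Ω T A u Du y r r' s t m μ) (ha : s < a)
    (hb : b < t) : ∀ᵐ z : RSpace N × ℝ ∂(volume.restrict (Metric.closedBall y r' ×ˢ Icc a b)),
      K₁ * ‖Du z.1 z.2‖ ^ p ≤ inner ℝ (A z.1 z.2 (u z.1 z.2) (Du z.1 z.2)) (Du z.1 z.2) ∧
      ‖A z.1 z.2 (u z.1 z.2) (Du z.1 z.2)‖ ≤ K₂ * ‖Du z.1 z.2‖ ^ (p - 1) := by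
  have hsub := (H.cylinder_subset ha hb).trans H.subset
  filter_upwards [ae_restrict_of_ae_restrict_of_subset hsub H.conditions.coercive,
    ae_restrict_of_ae_restrict_of_subset hsub H.conditions.growth] with z h1 h2
  exact ⟨h1 _ _, h2 _ _⟩

/-- The growth condition bounds the flux by `|Du|^(p-1)`, which lies in the space dual to `L^p`;
every pairing of the flux with a test gradient rests on this. -/
theorem memLp_flux (H : LocalSetting p q K₁ K₂ Ω T A u Du y r r' s t m μ) (ha : s < a)
    (hab : a ≤ b) (hb : b < t) :
    MemLp (fun z : RSpace N × ℝ => A z.1 z.2 (u z.1 z.2) (Du z.1 z.2))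
      (ENNReal.ofReal (p / (p - 1)))
      (volume.restrict (Metric.closedBall y r' ×ˢ Icc a b)) := by
  have hsub := (H.cylinder_subset ha hb).trans H.subset
  have hp := H.one_lt_p
  have hD := H.memLp_Du ha hab hb
  have hm : AEStronglyMeasurable (fun z : RSpace N × ℝ => A z.1 z.2 (u z.1 z.2) (Du z.1 z.2))
      (volume.restrict (Metric.closedBall y r' ×ˢ Icc a b)) :=
    aestronglyMeasurable_caratheodory (B := fun (z : RSpace N × ℝ) (w : ℝ × RSpace N) =>
      A z.1 z.2 w.1 w.2) (fun w => (H.conditions.measurable w.1 w.2).mono_measure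
        (Measure.restrict_mono hsub le_rfl))
      (ae_restrict_of_ae_restrict_of_subset hsub H.conditions.continuous)
      ((H.aestronglyMeasurable_u ha hb).prodMk hD.1)
  have hpow := hD.norm_rpow_div (ENNReal.ofReal (p - 1))
  rw [ENNReal.toReal_ofReal (by linarith), ← ENNReal.ofReal_div_of_pos (by linarith)] at hpow
  refine hpow.of_le_mul hm (c := K₂) ?_
  filter_upwards [H.ae_flux ha hb] with z hz
  refine hz.2.trans_eq ?_
  rw [Real.norm_of_nonneg (by positivity)]

end cylinder

end LocalSetting

/-! ### Test functions built from the solution and the energy inequality -/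

/-- The weight `v ↦ (μ - v + κ)^(-β)` used to build test functions. -/
noncomputable def negPowWeight (μ κ β v : ℝ) : ℝ := (μ - v + κ) ^ (-β)

section negPowWeight

variable {μ κ β v : ℝ}

theorem contDiffAt_negPowWeight (hκ : 0 < κ) (hv : v ≤ μ) :
    ContDiffAt ℝ ∞ (negPowWeight μ κ β) v := by
  have h : ContDiffAt ℝ ∞ (fun v : ℝ => μ - v + κ) v := by fun_prop
  exact h.rpow_const_of_ne (by linarith)

theorem deriv_negPowWeight (hκ : 0 < κ) (hv : v ≤ μ) :
    deriv (negPowWeight μ κ β) v = β * (μ - v + κ) ^ (-β - 1) := by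
  have h : HasDerivAt (fun v : ℝ => μ - v + κ) (-1) v := by
    simpa using ((hasDerivAt_id v).const_sub μ).add_const κ
  have h' := h.rpow_const (p := -β) (Or.inl (by linarith))
  have : HasDerivAt (negPowWeight μ κ β) (-1 * -β * (μ - v + κ) ^ (-β - 1)) v := h'
  rw [this.deriv]
  ring

theorem measurable_negPowWeight : Measurable (negPowWeight μ κ β) := by
  unfold negPowWeight
  fun_prop

theorem negPowWeight_nonneg (hκ : 0 < κ) (hv : v ≤ μ) : 0 ≤ negPowWeight μ κ β v :=
  Real.rpow_nonneg (by linarith) _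

theorem negPowWeight_le (hκ : 0 < κ) (hβ : 0 < β) (hv : v ≤ μ) :
    negPowWeight μ κ β v ≤ κ ^ (-β) :=
  Real.rpow_le_rpow_of_nonpos hκ (by linarith) (by linarith)

theorem deriv_negPowWeight_nonneg (hκ : 0 < κ) (hβ : 0 < β) (hv : v ≤ μ) :
    0 ≤ deriv (negPowWeight μ κ β) v := by
  rw [deriv_negPowWeight hκ hv]
  exact mul_nonneg hβ.le (Real.rpow_nonneg (by linarith) _)

theorem deriv_negPowWeight_le (hκ : 0 < κ) (hβ : 0 < β) (hv : v ≤ μ) :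
    deriv (negPowWeight μ κ β) v ≤ β * κ ^ (-β - 1) := by
  rw [deriv_negPowWeight hκ hv]
  have := Real.rpow_le_rpow_of_nonpos (z := -β - 1) hκ (show κ ≤ μ - v + κ by linarith)
    (by linarith)
  gcongr

end negPowWeight

open scoped ENNReal in
/-- Gradients of products of cutoff functions and functions of a Sobolev function are in `L^P`. -/
theorem memLp_smul_add_smul {α V : Type*} [MeasurableSpace α] {ν : Measure α} [IsFiniteMeasure ν]
    [NormedAddCommGroup V] [NormedSpace ℝ V] {P : ℝ≥0∞} {c d : α → ℝ} {n D : α → V}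
    {C₁ C₂ C₃ : ℝ} (hC₁ : 0 ≤ C₁) (hc : AEStronglyMeasurable c ν) (hn : AEStronglyMeasurable n ν)
    (hd : AEStronglyMeasurable d ν) (hcb : ∀ᵐ x ∂ν, ‖c x‖ ≤ C₁) (hnb : ∀ᵐ x ∂ν, ‖n x‖ ≤ C₂)
    (hdb : ∀ᵐ x ∂ν, ‖d x‖ ≤ C₃) (hD : MemLp D P ν) :
    MemLp (fun x => c x • n x + d x • D x) P ν := by
  have h1 : MemLp (fun x => c x • n x) P ν := by
    refine MemLp.of_bound (hc.smul hn) (C₁ * C₂) ?_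
    filter_upwards [hcb, hnb] with x h1 h2
    rw [norm_smul]
    exact mul_le_mul h1 h2 (norm_nonneg _) hC₁
  have h2 : MemLp (fun x => d x • D x) P ν := by
    refine hD.of_le_mul (hd.smul hD.1) (c := C₃) ?_
    filter_upwards [hdb] with x hx
    rw [norm_smul]
    gcongr
  exact h1.add h2

namespace LocalSetting

variable {N : ℕ} {p q K₁ K₂ : ℝ} {Ω : Set (RSpace N)} {T : ℝ}
  {A : RSpace N → ℝ → ℝ → RSpace N → RSpace N} {u : RSpace N → ℝ → ℝ}
  {Du : RSpace N → ℝ → RSpace N} {y : RSpace N} {r r' s t m μ : ℝ}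

theorem exists_gradient_bound {η : RSpace N → ℝ} (hη : ContDiff ℝ 1 η)
    (hηc : HasCompactSupport η) :
    Continuous (gradient η) ∧ ∃ C, ∀ x, ‖gradient η x‖ ≤ C := by
  have hcg : Continuous (gradient η) :=
    (InnerProductSpace.toDual ℝ _).symm.continuous.comp (hη.continuous_fderiv one_ne_zero)
  exact ⟨hcg, hcg.bounded_above_of_compact_support
    ((hηc.fderiv ℝ).comp_left (g := (InnerProductSpace.toDual ℝ (RSpace N)).symm) (map_zero _))⟩

/-- At almost every time the slices of `u` give admissible test functions. -/
theorem ae_memW0 (H : LocalSetting p q K₁ K₂ Ω T A u Du y r r' s t m μ) {κ β : ℝ} (hκ : 0 < κ)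
    {η : RSpace N → ℝ} (hη : ContDiff ℝ 1 η) (hηs : tsupport η ⊆ Metric.ball y r') {a b : ℝ}
    (ha : s < a) (hab : a ≤ b) (hb : b < t) :
    ∀ᵐ τ ∂(volume.restrict (Icc a b)),
      MemLp (fun x => Du x τ) (ENNReal.ofReal p) (volume.restrict (Metric.closedBall y r')) ∧
      MemW0 p (Metric.closedBall y r') (fun x => η x * negPowWeight μ κ β (u x τ))
        (fun x => negPowWeight μ κ β (u x τ) • gradient η x +
          (η x * deriv (negPowWeight μ κ β) (u x τ)) • Du x τ) := by
  obtain ⟨ρ, hρ', hρ⟩ := exists_between H.r'_lt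
  have hp := H.one_lt_p
  have hpos : 0 < a := (H.Ioo_subset ⟨ha, hab.trans_lt hb⟩).1
  have hbT : b < T := (H.Ioo_subset ⟨ha.trans_le hab, hb⟩).2
  have h1 := H.space.memLp_gradient _ (isCompact_closedBall y ρ) (H.closedBall_subset hρ) a b
    hpos hbT
  rw [volume_restrict_prod] at h1
  have h2 := ae_restrict_of_ae_restrict_of_subset (t := Ioo 0 T) (s := Icc a b)
    (Icc_subset_Ioo hpos hbT) H.space.gradient
  filter_upwards [h1.prodMk_right (ENNReal.ofReal_pos.2 (by linarith)).ne' ENNReal.ofReal_ne_top, h2,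
    ae_restrict_mem measurableSet_Icc] with τ e1 e2 hτ
  have hτ' : τ ∈ Ioo s t := ⟨ha.trans_le hτ.1, hτ.2.trans_lt hb⟩
  have hsub : Metric.closedBall y r' ⊆ Metric.closedBall y ρ :=
    Metric.closedBall_subset_closedBall hρ'.le
  refine ⟨e1.mono_measure (Measure.restrict_mono hsub le_rfl), ?_⟩
  have hmono : volume.restrict (Metric.ball y ρ) ≤ volume.restrict (Metric.closedBall y ρ) :=
    Measure.restrict_mono Metric.ball_subset_closedBall le_rfl
  refine memW0_mul_comp H.isOpen.measurableSet hp hρ' H.le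
    (Metric.ball_subset_closedBall.trans (H.closedBall_subset hρ)) e2 ?_ ?_ (e1.mono_measure hmono)
    hη hηs fun z hz => contDiffAt_negPowWeight hκ hz.2
  · exact ((H.space.memLp_slice _ (isCompact_closedBall y ρ) (H.closedBall_subset hρ) τ
      (H.Ioo_subset hτ')).1).mono_measure hmono
  · exact ae_restrict_of_ae_restrict_of_subset Metric.ball_subset_closedBall
      (H.slice_bounds hρ ⟨Ioo_subset_Icc_self hτ', H.Ioo_subset hτ'⟩)

/-- The gradient of the test function belongs to `L^p` on cylinders. -/
theorem memLp_testGradient (H : LocalSetting p q K₁ K₂ Ω T A u Du y r r' s t m μ) {κ β : ℝ}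
    (hκ : 0 < κ) (hβ : 0 < β) {η : RSpace N → ℝ} (hη : ContDiff ℝ 1 η)
    (hηc : HasCompactSupport η) (hη0 : ∀ x, 0 ≤ η x) (hη1 : ∀ x, η x ≤ 1) {a b : ℝ}
    (ha : s < a) (hab : a ≤ b) (hb : b < t) :
    MemLp (fun z : RSpace N × ℝ => negPowWeight μ κ β (u z.1 z.2) • gradient η z.1 +
      (η z.1 * deriv (negPowWeight μ κ β) (u z.1 z.2)) • Du z.1 z.2) (ENNReal.ofReal p)
      (volume.restrict (Metric.closedBall y r' ×ˢ Icc a b)) := by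
  have hfin := isFiniteMeasure_cylinder y r' a b
  obtain ⟨hcg, C, hC⟩ := exists_gradient_bound hη hηc
  have hum := (H.aestronglyMeasurable_u ha hb).aemeasurable
  refine memLp_smul_add_smul (C₁ := κ ^ (-β)) (C₂ := C) (C₃ := 1 * (β * κ ^ (-β - 1)))
    (by positivity) (measurable_negPowWeight.comp_aemeasurable hum).aestronglyMeasurable
    (hcg.comp continuous_fst).aestronglyMeasurable
    ((hη.continuous.comp continuous_fst).aestronglyMeasurable.mul
      ((measurable_deriv _).comp_aemeasurable hum).aestronglyMeasurable) ?_
    (Eventually.of_forall fun z => hC z.1) ?_ (H.memLp_Du ha hab hb)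
  · filter_upwards [H.ae_cylinder_bounds ha hb] with z hz
    rw [Real.norm_of_nonneg (negPowWeight_nonneg hκ hz.2)]
    exact negPowWeight_le hκ hβ hz.2
  · filter_upwards [H.ae_cylinder_bounds ha hb] with z hz
    have h0 := deriv_negPowWeight_nonneg hκ hβ hz.2
    rw [norm_mul, Real.norm_of_nonneg (hη0 _), Real.norm_of_nonneg h0]
    exact mul_le_mul (hη1 _) (deriv_negPowWeight_le hκ hβ hz.2) h0 zero_le_one

/-- The energy inequality for the test function `η (μ - u + κ)^(-β)`. -/
theorem energy_le (H : LocalSetting p q K₁ K₂ Ω T A u Du y r r' s t m μ) {κ β : ℝ}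
    (hκ : 0 < κ) (hβ : 0 < β) {η : RSpace N → ℝ} (hη : ContDiff ℝ 1 η)
    (hηs : tsupport η ⊆ Metric.ball y r') (hη0 : ∀ x, 0 ≤ η x) (hη1 : ∀ x, η x ≤ 1)
    {t₁ t₂ S : ℝ} (ht₁ : s < t₁) (ht : t₁ ≤ t₂) (ht₂ : t₂ < t)
    (hS : ∀ τ ∈ Ioo s t,
      ∫ x in Metric.closedBall y r', (signedPow q μ - signedPow q (u x τ)) * η x ≤ S) :
    ∫ z in Metric.closedBall y r' ×ˢ Icc t₁ t₂,
      inner ℝ (A z.1 z.2 (u z.1 z.2) (Du z.1 z.2))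
        (negPowWeight μ κ β (u z.1 z.2) • gradient η z.1 +
          (η z.1 * deriv (negPowWeight μ κ β) (u z.1 z.2)) • Du z.1 z.2) ≤ κ ^ (-β) * S := by
  -- The times between `a` and `t₁` leave room for differences taken backwards from `t₁`.
  obtain ⟨a, ha, hat⟩ := exists_between ht₁
  have hp := H.one_lt_p
  have hq := H.one_lt_q
  set E := Metric.closedBall y r' with hE
  have hfin := isFiniteMeasure_ball y r'
  have hfin' := isFiniteMeasure_cylinder y r' a t₂
  have hEc : IsCompact E := isCompact_closedBall y r'
  have hηc : HasCompactSupport η := by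
    refine hEc.of_isClosed_subset (isClosed_tsupport η) ?_
    exact hηs.trans Metric.ball_subset_closedBall
  obtain ⟨hcg, Cg, hCg⟩ := exists_gradient_bound hη hηc
  have hconj : (ENNReal.ofReal (p / (p - 1))).HolderConjugate (ENNReal.ofReal p) :=
    (Real.HolderConjugate.conjExponent hp).symm.ennrealOfReal
  have hP1 : 1 ≤ ENNReal.ofReal (p / (p - 1)) := by
    rw [← ENNReal.ofReal_one]
    refine ENNReal.ofReal_le_ofReal ?_
    rw [one_le_div (by linarith)]
    linarith
  obtain ⟨G, hGc, hGb, hGd⟩ := exists_primitive_signedPow μ hq hβ hκ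
  have hmem : ∀ τ ∈ Icc a t₂, τ ∈ Icc s t ∩ Ioo 0 T := fun τ hτ =>
    ⟨⟨ha.le.trans hτ.1, hτ.2.trans ht₂.le⟩, H.Ioo_subset ⟨ha.trans_le hτ.1, hτ.2.trans_lt ht₂⟩⟩
  have hat₂ : a ≤ t₂ := hat.le.trans ht
  refine integral_inner_le_of_difference (F := fun x τ => A x τ (u x τ) (Du x τ))
    (Φ := fun x τ => negPowWeight μ κ β (u x τ) • gradient η x +
      (η x * deriv (negPowWeight μ κ β) (u x τ)) • Du x τ)
    (Z := fun τ => ∫ x in E, G (u x τ) * η x) hEc.measurableSet hat ht hP1 ENNReal.ofReal_ne_top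
    (H.memLp_flux ha hat₂ ht₂) (H.memLp_testGradient hκ hβ hη hηc hη0 hη1 ht₁ ht ht₂) ?_ ?_ ?_
  · have hum := H.aestronglyMeasurable_u ha ht₂
    obtain ⟨C, hC⟩ := (isCompact_Icc (a := m) (b := μ)).exists_bound_of_continuousOn
      hGc.continuousOn
    have hint : Integrable (fun z : RSpace N × ℝ => G (u z.1 z.2) * η z.1)
        (volume.restrict (E ×ˢ Icc a t₂)) := by
      refine Integrable.of_bound ((hGc.comp_aestronglyMeasurable hum).mul
        (hη.continuous.comp continuous_fst).aestronglyMeasurable) (C * 1) ?_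
      filter_upwards [H.ae_cylinder_bounds ha ht₂] with z hz
      rw [norm_mul]
      refine mul_le_mul (hC _ hz) ?_ (norm_nonneg _) ((norm_nonneg _).trans (hC _ hz))
      rw [Real.norm_of_nonneg (hη0 _)]
      exact hη1 _
    rw [volume_restrict_prod] at hint
    exact hint.integral_prod_right
  · intro τ hτ
    have hτ' := hmem τ hτ
    have hb := H.slice_bounds H.r'_lt hτ'
    constructor
    · refine integral_nonneg_of_ae ?_
      filter_upwards [hb] with x hx
      exact mul_nonneg (hGb _ hx.2).1 (hη0 x)
    · have h1 : ∫ x in E, G (u x τ) * η x ≤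
          ∫ x in E, κ ^ (-β) * ((signedPow q μ - signedPow q (u x τ)) * η x) := by
        refine integral_mono_ae (H.integrable_slice hGc hη.continuous hτ')
          ((H.integrable_slice (continuous_const.sub (continuous_signedPow hq))
            hη.continuous hτ').const_mul _) ?_
        filter_upwards [hb] with x hx
        rw [← mul_assoc]
        exact mul_le_mul_of_nonneg_right (hGb _ hx.2).2 (hη0 x)
      refine h1.trans ?_
      rw [integral_const_mul]
      have := hS τ ⟨ha.trans_le hτ.1, hτ.2.trans_lt ht₂⟩
      gcongr
  · intro h hh0 hh
    filter_upwards [H.ae_memW0 (β := β) hκ hη hηs ht₁ ht ht₂, ae_restrict_mem measurableSet_Icc]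
      with τ hτW hτ
    have hτ1 := hmem τ ⟨hat.le.trans hτ.1, hτ.2⟩
    have hτ2 := hmem (τ - h) ⟨by linarith [hτ.1], by linarith [hτ.2]⟩
    have hb1 := H.slice_bounds H.r'_lt hτ1
    have hb2 := H.slice_bounds H.r'_lt hτ2
    have hum : AEMeasurable (fun x => u x τ) (volume.restrict E) :=
      (H.space.memLp_slice _ hEc (H.closedBall_subset H.r'_lt) τ hτ1.2).1.aemeasurable
    have hfm : AEStronglyMeasurable (fun x => negPowWeight μ κ β (u x τ)) (volume.restrict E) :=
      (measurable_negPowWeight.comp_aemeasurable hum).aestronglyMeasurable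
    have hψm : AEStronglyMeasurable (fun x => η x * negPowWeight μ κ β (u x τ))
        (volume.restrict E) := hη.continuous.aestronglyMeasurable.mul hfm
    have hψb : ∀ᵐ x ∂(volume.restrict E), 0 ≤ η x * negPowWeight μ κ β (u x τ) ∧
        η x * negPowWeight μ κ β (u x τ) ≤ 1 * κ ^ (-β) := by
      filter_upwards [hb1] with x hx
      have h0 := negPowWeight_nonneg (β := β) hκ hx.2
      exact ⟨mul_nonneg (hη0 x) h0,
        mul_le_mul (hη1 x) (negPowWeight_le hκ hβ hx.2) h0 zero_le_one⟩
    have hgL : MemLp (fun x => negPowWeight μ κ β (u x τ) • gradient η x +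
        (η x * deriv (negPowWeight μ κ β) (u x τ)) • Du x τ) (ENNReal.ofReal p)
        (volume.restrict E) := by
      refine memLp_smul_add_smul (C₁ := κ ^ (-β)) (C₂ := Cg) (C₃ := 1 * (β * κ ^ (-β - 1)))
        (by positivity) hfm hcg.aestronglyMeasurable
        (hη.continuous.aestronglyMeasurable.mul
          ((measurable_deriv _).comp_aemeasurable hum).aestronglyMeasurable) ?_
        (Eventually.of_forall fun z => hCg z) ?_ hτW.1
      · filter_upwards [hb1] with x hx
        rw [Real.norm_of_nonneg (negPowWeight_nonneg hκ hx.2)]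
        exact negPowWeight_le hκ hβ hx.2
      · filter_upwards [hb1] with x hx
        have h0 := deriv_negPowWeight_nonneg hκ hβ hx.2
        rw [norm_mul, Real.norm_of_nonneg (hη0 _), Real.norm_of_nonneg h0]
        exact mul_le_mul (hη1 _) (deriv_negPowWeight_le hκ hβ hx.2) h0 zero_le_one
    -- The test function is built from the slice at the later time `τ` and does not vary on `[τ - h,
    -- τ]`, so no time derivative of `u` appears.
    have hid := H.identity (τ - h) τ hτ2.2.1 (by linarith) hτ1.2.2 _ _ _ hψm hψb hgL hτW.2
    have hbint : ∀ τ' ∈ Icc s t ∩ Ioo 0 T,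
        Integrable (fun x => signedPow q (u x τ') * (η x * negPowWeight μ κ β (u x τ)))
          (volume.restrict E) := by
      intro τ' hτ'
      have h1 := (H.integrable_slice (continuous_signedPow hq) hη.continuous hτ').mul_bdd
        (c := κ ^ (-β)) hfm (by
          filter_upwards [hb1] with x hx
          rw [Real.norm_of_nonneg (negPowWeight_nonneg hκ hx.2)]
          exact negPowWeight_le hκ hβ hx.2)
      refine h1.congr (Eventually.of_forall fun x => ?_)
      simp only [mul_assoc]
    -- Concavity of the primitive in the signed power, applied at each `x` with tangent at the later
    -- value `u x τ`. A test function frozen at the earlier time would give the opposite inequality.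
    have hle : (∫ x in E, G (u x (τ - h)) * η x) - ∫ x in E, G (u x τ) * η x ≤
        (∫ x in E, signedPow q (u x τ) * (η x * negPowWeight μ κ β (u x τ))) -
          ∫ x in E, signedPow q (u x (τ - h)) * (η x * negPowWeight μ κ β (u x τ)) := by
      have g1 := H.integrable_slice hGc hη.continuous hτ2
      have g2 := H.integrable_slice hGc hη.continuous hτ1
      rw [← integral_sub g1 g2, ← integral_sub (hbint τ hτ1) (hbint _ hτ2)]
      refine integral_mono_ae (g1.sub g2) ((hbint τ hτ1).sub (hbint _ hτ2)) ?_
      filter_upwards [hb1, hb2] with x h1 h2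
      have := mul_le_mul_of_nonneg_right (hGd _ h2.2 _ h1.2) (hη0 x)
      simp only [negPowWeight]
      linarith
    linarith

/-- The variation in time of the weighted integrals is controlled by the flux. -/
theorem abs_integral_sub_le (H : LocalSetting p q K₁ K₂ Ω T A u Du y r r' s t m μ)
    {η : RSpace N → ℝ} (hη : ContDiff ℝ 1 η)
    (hηs : tsupport η ⊆ Metric.ball y r') (hη0 : ∀ x, 0 ≤ η x) (hη1 : ∀ x, η x ≤ 1)
    {t₁ t₂ : ℝ} (ht₁ : s < t₁) (ht : t₁ < t₂) (ht₂ : t₂ < t) {R : RSpace N × ℝ → ℝ}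
    (hR : IntegrableOn R (Metric.closedBall y r' ×ˢ Icc t₁ t₂))
    (hRle : ∀ z : RSpace N × ℝ, K₂ * ‖Du z.1 z.2‖ ^ (p - 1) * ‖gradient η z.1‖ ≤ R z) :
    |(∫ x in Metric.closedBall y r', (signedPow q μ - signedPow q (u x t₁)) * η x) -
      ∫ x in Metric.closedBall y r', (signedPow q μ - signedPow q (u x t₂)) * η x| ≤
      ∫ z in Metric.closedBall y r' ×ˢ Icc t₁ t₂, R z := by
  have hp := H.one_lt_p
  have hq := H.one_lt_q
  set E := Metric.closedBall y r' with hE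
  have hfin := isFiniteMeasure_ball y r'
  have hfin' := isFiniteMeasure_cylinder y r' t₁ t₂
  have hEc : IsCompact E := isCompact_closedBall y r'
  have hηc : HasCompactSupport η := by
    refine hEc.of_isClosed_subset (isClosed_tsupport η) ?_
    exact hηs.trans Metric.ball_subset_closedBall
  obtain ⟨hcg, Cg, hCg⟩ := exists_gradient_bound hη hηc
  have hmem : ∀ τ ∈ Icc t₁ t₂, τ ∈ Icc s t ∩ Ioo 0 T := fun τ hτ =>
    ⟨⟨ht₁.le.trans hτ.1, hτ.2.trans ht₂.le⟩, H.Ioo_subset ⟨ht₁.trans_le hτ.1, hτ.2.trans_lt ht₂⟩⟩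
  have hm1 := hmem t₁ ⟨le_rfl, ht.le⟩
  have hm2 := hmem t₂ ⟨ht.le, le_rfl⟩
  have hgL : MemLp (gradient η) (ENNReal.ofReal p) (volume.restrict E) :=
    MemLp.of_bound hcg.aestronglyMeasurable Cg (Eventually.of_forall hCg)
  have hW : MemW0 p E η (gradient η) := by
    -- The cutoff alone is admissible by the product result, applied to the zero function composed
    -- with the constant one.
    have h0 : IsWeakGradient Ω (fun _ => (0 : ℝ)) (fun _ : RSpace N => (0 : RSpace N)) := by
      intro θ _
      simp
    have := memW0_mul_comp (m := 0) (M := 0) (f := fun _ => (1 : ℝ)) H.isOpen.measurableSet hp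
      H.r'_lt le_rfl H.ball_subset h0 aestronglyMeasurable_const
      (Eventually.of_forall fun _ => ⟨le_rfl, le_rfl⟩) MemLp.zero hη hηs
      (fun z _ => contDiffAt_const)
    simpa using this
  have hid := H.identity t₁ t₂ hm1.2.1 ht hm2.2.2 η (gradient η) 1
    hη.continuous.aestronglyMeasurable (Eventually.of_forall fun x => ⟨hη0 x, hη1 x⟩) hgL hW
  have hconj : (ENNReal.ofReal (p / (p - 1))).HolderConjugate (ENNReal.ofReal p) :=
    (Real.HolderConjugate.conjExponent hp).symm.ennrealOfReal
  have hgL' : MemLp (fun z : RSpace N × ℝ => gradient η z.1) (ENNReal.ofReal p)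
      (volume.restrict (E ×ˢ Icc t₁ t₂)) :=
    MemLp.of_bound (hcg.comp continuous_fst).aestronglyMeasurable Cg
      (Eventually.of_forall fun z => hCg z.1)
  have hint := (norm_integral_inner_le (H.memLp_flux ht₁ ht.le ht₂) hgL').1
  have hprod : ∫ τ in t₁..t₂, ∫ x in E, inner ℝ (A x τ (u x τ) (Du x τ)) (gradient η x) =
      ∫ z in E ×ˢ Icc t₁ t₂, inner ℝ (A z.1 z.2 (u z.1 z.2) (Du z.1 z.2)) (gradient η z.1) := by
    rw [volume_restrict_prod] at hint ⊢
    rw [integral_prod_symm _ hint, intervalIntegral.integral_of_le ht.le,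
      integral_Icc_eq_integral_Ioc]
  have hsub : (∫ x in E, (signedPow q μ - signedPow q (u x t₁)) * η x) -
      ∫ x in E, (signedPow q μ - signedPow q (u x t₂)) * η x =
      (∫ x in E, signedPow q (u x t₂) * η x) - ∫ x in E, signedPow q (u x t₁) * η x := by
    have k : Continuous fun z => signedPow q μ - signedPow q z :=
      continuous_const.sub (continuous_signedPow hq)
    have hb := continuous_signedPow hq
    rw [← integral_sub (H.integrable_slice k hη.continuous hm1)
      (H.integrable_slice k hη.continuous hm2),
      ← integral_sub (H.integrable_slice hb hη.continuous hm2)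
      (H.integrable_slice hb hη.continuous hm1)]
    refine integral_congr_ae (Eventually.of_forall fun x => ?_)
    simp only
    ring
  rw [hsub, eq_neg_of_add_eq_zero_left hid, abs_neg, hprod, ← Real.norm_eq_abs]
  refine norm_integral_le_of_norm_le hR ?_
  filter_upwards [H.ae_flux ht₁ ht₂] with z hz
  refine (norm_inner_le_norm _ _).trans (le_trans ?_ (hRle z))
  gcongr
  exact hz.2

end LocalSetting

/-! ### Powers of the cutoff and the flux estimate -/

namespace IsCutoff

variable {N : ℕ} {Λ : ℝ} {y : RSpace N} {r σ l : ℝ} {ζ : RSpace N → ℝ}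

theorem contDiff_rpow (h : IsCutoff Λ y r σ ζ) (hl : 1 ≤ l) : ContDiff ℝ 1 fun x => ζ x ^ l :=
  h.contDiff.rpow_const_of_le (by simpa using hl)

theorem rpow_nonneg (h : IsCutoff Λ y r σ ζ) (x : RSpace N) : 0 ≤ ζ x ^ l :=
  Real.rpow_nonneg (h.nonneg x) l

theorem rpow_le_one (h : IsCutoff Λ y r σ ζ) (hl : 0 ≤ l) (x : RSpace N) : ζ x ^ l ≤ 1 :=
  Real.rpow_le_one (h.nonneg x) (h.le_one x) hl

theorem tsupport_rpow_subset (hl : 0 < l) : tsupport (fun x => ζ x ^ l) ⊆ tsupport ζ := by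
  refine closure_mono fun x hx => ?_
  contrapose! hx
  simp [Function.notMem_support.1 hx, Real.zero_rpow hl.ne']

theorem norm_gradient_rpow_le (h : IsCutoff Λ y r σ ζ) (hl : 1 ≤ l) (x : RSpace N) :
    ‖gradient (fun x => ζ x ^ l) x‖ ≤ l * (Λ / (σ * r)) * ζ x ^ (l - 1) := by
  have h1 : HasGradientAt ζ (gradient ζ x) x :=
    (h.contDiff.differentiable one_ne_zero x).hasGradientAt
  have h2 : HasGradientAt (fun x => ζ x ^ l) ((l * ζ x ^ (l - 1)) • gradient ζ x) x := by
    rw [hasGradientAt_iff_hasFDerivAt] at *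
    rw [map_smul]
    exact h1.rpow_const (Or.inr hl)
  have h3 : 0 ≤ ζ x ^ (l - 1) := Real.rpow_nonneg (h.nonneg x) _
  rw [h2.gradient, norm_smul, Real.norm_of_nonneg (by positivity)]
  calc l * ζ x ^ (l - 1) * ‖gradient ζ x‖ ≤ l * ζ x ^ (l - 1) * (Λ / (σ * r)) := by
        gcongr; exact h.gradient_le x
    _ = _ := by ring

end IsCutoff

namespace LocalSetting

variable {N : ℕ} {p q K₁ K₂ : ℝ} {Ω : Set (RSpace N)} {T : ℝ}
  {A : RSpace N → ℝ → ℝ → RSpace N → RSpace N} {u : RSpace N → ℝ → ℝ}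
  {Du : RSpace N → ℝ → RSpace N} {y : RSpace N} {r r' s t m μ : ℝ}

theorem integrable_flux_weight (H : LocalSetting p q K₁ K₂ Ω T A u Du y r r' s t m μ)
    {l K : ℝ} (hl : 1 < l) {ζ : RSpace N → ℝ} (hζc : Continuous ζ) (hζ0 : ∀ x, 0 ≤ ζ x)
    (hζ1 : ∀ x, ζ x ≤ 1) {t₁ t₂ : ℝ} (ht₁ : s < t₁) (ht : t₁ ≤ t₂) (ht₂ : t₂ < t) :
    IntegrableOn (fun z : RSpace N × ℝ => K * ‖Du z.1 z.2‖ ^ (p - 1) * ζ z.1 ^ (l - 1))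
      (Metric.closedBall y r' ×ˢ Icc t₁ t₂) := by
  have hp := H.one_lt_p
  have hfin := isFiniteMeasure_cylinder y r' t₁ t₂
  have hpow := (H.memLp_Du ht₁ ht ht₂).norm_rpow_div (ENNReal.ofReal (p - 1))
  rw [ENNReal.toReal_ofReal (by linarith), ← ENNReal.ofReal_div_of_pos (by linarith)] at hpow
  have hP1 : 1 ≤ ENNReal.ofReal (p / (p - 1)) := by
    rw [← ENNReal.ofReal_one]
    refine ENNReal.ofReal_le_ofReal ?_
    rw [one_le_div (by linarith)]
    linarith
  have hc : Continuous fun z : RSpace N × ℝ => ζ z.1 ^ (l - 1) :=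
    (hζc.comp continuous_fst).rpow_const fun _ => Or.inr (by linarith)
  refine ((hpow.integrable hP1).const_mul K).mul_bdd (c := 1) hc.aestronglyMeasurable
    (Eventually.of_forall fun z => ?_)
  rw [Real.norm_of_nonneg (Real.rpow_nonneg (hζ0 _) _)]
  exact Real.rpow_le_one (hζ0 _) (hζ1 _) (by linarith)

/-- Integral over a cylinder of the normalized weight. -/
theorem integral_weight_le (H : LocalSetting p q K₁ K₂ Ω T A u Du y r r' s t m μ)
    {η : RSpace N → ℝ} (hηc : Continuous η) (hη0 : ∀ x, 0 ≤ η x)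
    (hη1 : ∀ x, η x ≤ 1) {t₁ t₂ S κ : ℝ} (hκ : 0 < κ) (ht₁ : s < t₁) (ht : t₁ ≤ t₂) (ht₂ : t₂ < t)
    (hS : ∀ τ ∈ Ioo s t,
      ∫ x in Metric.closedBall y r', (signedPow q μ - signedPow q (u x τ)) * η x ≤ S) :
    IntegrableOn (fun z : RSpace N × ℝ =>
        1 + (signedPow q μ - signedPow q (u z.1 z.2)) * η z.1 / κ ^ q)
      (Metric.closedBall y r' ×ˢ Icc t₁ t₂) ∧
    ∫ z in Metric.closedBall y r' ×ˢ Icc t₁ t₂,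
        (1 + (signedPow q μ - signedPow q (u z.1 z.2)) * η z.1 / κ ^ q) ≤
      (t - s) * (volume.real (Metric.ball y r) + S / κ ^ q) := by
  set E := Metric.closedBall y r' with hE
  have hq := H.one_lt_q
  have hfin := isFiniteMeasure_cylinder y r' t₁ t₂
  have hfin' := isFiniteMeasure_ball y r'
  have hκq : 0 < κ ^ q := Real.rpow_pos_of_pos hκ q
  have hk : Continuous fun z => signedPow q μ - signedPow q z :=
    continuous_const.sub (continuous_signedPow hq)
  obtain ⟨C, hC⟩ := (isCompact_Icc (a := m) (b := μ)).exists_bound_of_continuousOn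
    hk.continuousOn
  have hint : IntegrableOn (fun z : RSpace N × ℝ =>
      (signedPow q μ - signedPow q (u z.1 z.2)) * η z.1) (E ×ˢ Icc t₁ t₂) := by
    refine Integrable.of_bound ((hk.comp_aestronglyMeasurable
      (H.aestronglyMeasurable_u ht₁ ht₂)).mul
      (hηc.comp continuous_fst).aestronglyMeasurable) (C * 1) ?_
    filter_upwards [H.ae_cylinder_bounds ht₁ ht₂] with z hz
    rw [norm_mul]
    refine mul_le_mul (hC _ hz) ?_ (norm_nonneg _) ((norm_nonneg _).trans (hC _ hz))
    rw [Real.norm_of_nonneg (hη0 _)]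
    exact hη1 _
  have hint1 : IntegrableOn (fun _ : RSpace N × ℝ => (1 : ℝ)) (E ×ˢ Icc t₁ t₂) :=
    integrable_const 1
  refine ⟨hint1.add (hint.div_const _), ?_⟩
  rw [integral_add hint1 (hint.div_const _), integral_div, mul_add]
  have hS0 : 0 ≤ S := by
    have hτ : t₁ ∈ Ioo s t := ⟨ht₁, ht.trans_lt ht₂⟩
    refine le_trans (integral_nonneg_of_ae ?_) (hS t₁ hτ)
    filter_upwards [H.slice_bounds H.r'_lt ⟨Ioo_subset_Icc_self hτ, H.Ioo_subset hτ⟩] with x hx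
    exact mul_nonneg (sub_nonneg.2 (signedPow_mono (by linarith) hx.2)) (hη0 x)
  have hEb : volume.real E ≤ volume.real (Metric.ball y r) :=
    measureReal_mono (Metric.closedBall_subset_ball H.r'_lt) measure_ball_lt_top.ne
  refine add_le_add ?_ ?_
  · rw [integral_const, smul_eq_mul, mul_one, measureReal_restrict_apply_univ,
      Measure.volume_eq_prod, measureReal_prod_prod, Real.volume_real_Icc_of_le ht, mul_comm]
    have : t₂ - t₁ ≤ t - s := by linarith
    gcongr
    linarith
  · rw [← mul_div_assoc]
    refine div_le_div_of_nonneg_right ?_ hκq.le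
    have hint' := hint
    rw [IntegrableOn, volume_restrict_prod] at hint'
    rw [volume_restrict_prod, integral_prod_symm _ hint']
    have h1 : ∫ τ in Icc t₁ t₂, ∫ x in E, (signedPow q μ - signedPow q (u x τ)) * η x ≤
        ∫ τ in Icc t₁ t₂, S := by
      refine setIntegral_mono_on hint'.integral_prod_right (integrable_const S) measurableSet_Icc
        fun τ hτ => hS τ ⟨ht₁.trans_le hτ.1, hτ.2.trans_lt ht₂⟩
    refine h1.trans ?_
    rw [integral_const, smul_eq_mul, measureReal_restrict_apply_univ, Real.volume_real_Icc_of_le ht]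
    have : t₂ - t₁ ≤ t - s := by linarith
    gcongr

/-- The estimate of the flux in terms of the energy. -/
theorem flux_le (H : LocalSetting p q K₁ K₂ Ω T A u Du y r r' s t m μ) (hpq : p - 1 < q)
    (hK₁ : 0 < K₁) (hK₂ : 0 < K₂) {l Λ σ : ℝ} (hl : 2 * q * p ^ 2 / (q - p + 1) ≤ l)
    (hΛ : 1 ≤ Λ) (hσ : 0 < σ) {ζ : RSpace N → ℝ} (hζ : IsCutoff Λ y r σ ζ)
    (hζs : tsupport ζ ⊆ Metric.ball y r') {κ β ε : ℝ} (hκ : 0 < κ)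
    (hβ : β = (q - p + 1) / (2 * (p - 1))) (hε : 0 < ε)
    {t₁ t₂ S K : ℝ} (ht₁ : s < t₁) (ht : t₁ ≤ t₂) (ht₂ : t₂ < t)
    (hK : K = K₂ * (l * (Λ / (σ * r))))
    (hS : ∀ τ ∈ Ioo s t,
      ∫ x in Metric.closedBall y r', (signedPow q μ - signedPow q (u x τ)) * ζ x ^ l ≤ S) :
    ∫ z in Metric.closedBall y r' ×ˢ Icc t₁ t₂,
        K * ‖Du z.1 z.2‖ ^ (p - 1) * ζ z.1 ^ (l - 1) ≤
      ε / (β * K₁) * (S + ∫ z in Metric.closedBall y r' ×ˢ Icc t₁ t₂,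
        K * ‖Du z.1 z.2‖ ^ (p - 1) * ζ z.1 ^ (l - 1)) +
      ε ^ (1 - p) * K ^ p * (1 + 4 ^ q) * κ ^ (p - 1) *
        ((t - s) * (volume.real (Metric.ball y r) + S / κ ^ q)) := by
  have hp := H.one_lt_p
  have hq := H.one_lt_q
  have hr := H.r_pos
  have hD : 0 < q - p + 1 := by linarith
  have hp1 : 0 < p - 1 := by linarith
  have hβ0 : 0 < β := by rw [hβ]; positivity
  have hlD : 2 * q * p ^ 2 ≤ l * (q - p + 1) := (div_le_iff₀ hD).1 hl
  have hl0 : 0 < l := lt_of_lt_of_le (by positivity) hl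
  have hlp : p < l := by
    by_contra! hcon
    have h1 : l * (q - p + 1) ≤ p * q := by
      have : q - p + 1 ≤ q := by linarith
      exact mul_le_mul hcon this hD.le (by linarith)
    nlinarith [mul_pos (show (0 : ℝ) < q by linarith) (show (0 : ℝ) < p by linarith)]
  -- The value of `β` places `a` midway between `p - 1` and `q`. Then `1 - a / q = (q - p + 1) / (2
  -- q)`, and the lower bound on `l` gives `l (1 - a / q) ≥ p² ≥ p`, as `weight_le` requires.
  set a := (p - 1) * (1 + β) with ha
  have ha' : a = (q + p - 1) / 2 := by
    rw [ha, hβ]; field_simp; ring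
  have haq : a < q := by rw [ha']; linarith
  have ha0 : 0 < a := by positivity
  have hlpa : p ≤ l * (1 - a / q) := by
    have h1 : l * (1 - a / q) = l * (q - p + 1) / (2 * q) := by
      rw [ha']; field_simp; ring
    rw [h1, le_div_iff₀ (by linarith)]
    have h2 : 2 * q * p ≤ 2 * q * p ^ 2 := by
      have : p ≤ p ^ 2 := by nlinarith
      gcongr
    linarith
  have hl1 : 1 < l := hp.trans hlp
  have hK0 : 0 ≤ K := by rw [hK]; positivity
  set E := Metric.closedBall y r' with hE
  set η : RSpace N → ℝ := fun x => ζ x ^ l with hη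
  have hηd : ContDiff ℝ 1 η := hζ.contDiff_rpow hl1.le
  have hη0 : ∀ x, 0 ≤ η x := fun x => hζ.rpow_nonneg x
  have hη1 : ∀ x, η x ≤ 1 := fun x => hζ.rpow_le_one hl0.le x
  have hηs : tsupport η ⊆ Metric.ball y r' := (IsCutoff.tsupport_rpow_subset hl0).trans hζs
  have hηc : HasCompactSupport η := hζ.hasCompactSupport.of_isClosed_subset (isClosed_tsupport _)
    (IsCutoff.tsupport_rpow_subset hl0)
  have hfin := isFiniteMeasure_cylinder y r' t₁ t₂
  have hbd := H.ae_cylinder_bounds ht₁ ht₂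
  have hum := (H.aestronglyMeasurable_u ht₁ ht₂).aemeasurable
  set R₀ : RSpace N × ℝ → ℝ := fun z => K * ‖Du z.1 z.2‖ ^ (p - 1) * ζ z.1 ^ (l - 1) with hR₀
  have hR₀i : IntegrableOn R₀ (E ×ˢ Icc t₁ t₂) :=
    H.integrable_flux_weight hl1 hζ.contDiff.continuous hζ.nonneg hζ.le_one ht₁ ht ht₂
  set e₀ : RSpace N × ℝ → ℝ := fun z =>
    ‖Du z.1 z.2‖ ^ p * (μ - u z.1 z.2 + κ) ^ (-β - 1) * ζ z.1 ^ l with he₀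
  have he₀i : IntegrableOn e₀ (E ×ˢ Icc t₁ t₂) := by
    have h1 := (H.memLp_Du ht₁ ht ht₂).integrable_norm_rpow (ENNReal.ofReal_pos.2 (by linarith)).ne'
      ENNReal.ofReal_ne_top
    rw [ENNReal.toReal_ofReal (by linarith)] at h1
    have hmeas : Measurable fun v : ℝ => (μ - v + κ) ^ (-β - 1) := by fun_prop
    have h2 := h1.mul_bdd (c := κ ^ (-β - 1))
      (hmeas.comp_aemeasurable hum).aestronglyMeasurable (by
        filter_upwards [hbd] with z hz
        have : 0 < μ - u z.1 z.2 + κ := by linarith [hz.2]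
        simp only [Function.comp_apply]
        rw [Real.norm_of_nonneg (by positivity)]
        exact Real.rpow_le_rpow_of_nonpos hκ (by linarith [hz.2]) (by linarith))
    refine h2.mul_bdd (c := 1) (hηd.continuous.comp continuous_fst).aestronglyMeasurable
      (Eventually.of_forall fun z => ?_)
    exact (Real.norm_of_nonneg (hη0 z.1)).trans_le (hη1 z.1)
  obtain ⟨hPi, hPle⟩ := H.integral_weight_le hηd.continuous hη0 hη1 hκ ht₁ ht ht₂ hS
  set P₀ : RSpace N × ℝ → ℝ := fun z =>
    1 + (signedPow q μ - signedPow q (u z.1 z.2)) * η z.1 / κ ^ q with hP₀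
  -- The factor `κ ^ β` cancels the `κ ^ (-β)` of the energy inequality, and in the other Young term
  -- `a - β (p - 1) = p - 1` leaves the power `κ ^ (p - 1)`.
  set ε' := κ ^ β * ε with hε'
  have hε'0 : 0 < ε' := by positivity
  set C := ε' ^ (1 - p) * K ^ p * (κ ^ a * (1 + 4 ^ q)) with hC
  have hC0 : 0 ≤ C := by positivity
  have hCeq : C = ε ^ (1 - p) * K ^ p * (1 + 4 ^ q) * κ ^ (p - 1) := by
    have h1 : κ ^ (p - 1) = κ ^ (β * (1 - p)) * κ ^ a := by
      rw [← Real.rpow_add hκ]; congr 1; rw [ha]; ring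
    rw [hC, hε', Real.mul_rpow (by positivity) hε.le, ← Real.rpow_mul hκ.le, h1]
    ring
  have hstep1 : ∫ z in E ×ˢ Icc t₁ t₂, R₀ z ≤
      ε' * (∫ z in E ×ˢ Icc t₁ t₂, e₀ z) + C * ∫ z in E ×ˢ Icc t₁ t₂, P₀ z := by
    rw [← integral_const_mul, ← integral_const_mul,
      ← integral_add (he₀i.const_mul _) (hPi.const_mul _)]
    refine integral_mono_ae hR₀i ((he₀i.const_mul _).add (hPi.const_mul _)) ?_
    filter_upwards [hbd] with z hz
    have hd : 0 ≤ μ - u z.1 z.2 := by linarith [hz.2]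
    have y1 := weighted_young (β := β) (v := μ - u z.1 z.2 + κ) hp hlp hε'0 hK0
      (norm_nonneg (Du z.1 z.2)) (by linarith) (hζ.nonneg z.1)
    have y2 := weight_le hq hlp ha0 haq hlpa (by linarith) hκ hd
      (rpow_sub_le_two_rpow_mul_signedPow hq hz.2) (hζ.nonneg z.1) (hζ.le_one z.1)
    refine y1.trans ?_
    have y3 := mul_le_mul_of_nonneg_left y2 (show 0 ≤ ε' ^ (1 - p) * K ^ p by positivity)
    refine (add_le_add_right y3 _).trans (le_of_eq ?_)
    simp only [he₀, hC, hP₀, hη]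
    ring
  have hen := H.energy_le hκ hβ0 hηd hηs hη0 hη1 ht₁ ht ht₂ hS
  have hconj : (ENNReal.ofReal (p / (p - 1))).HolderConjugate (ENNReal.ofReal p) :=
    (Real.HolderConjugate.conjExponent hp).symm.ennrealOfReal
  have hFi := (norm_integral_inner_le (H.memLp_flux ht₁ ht ht₂)
    (H.memLp_testGradient hκ hβ0 hηd hηc hη0 hη1 ht₁ ht ht₂)).1
  -- Differentiating the weight yields the energy through coercivity; differentiating the cutoff
  -- costs at most `κ ^ (-β)` times the flux integral being estimated, to be absorbed later.
  have hstep2 : β * K₁ * (∫ z in E ×ˢ Icc t₁ t₂, e₀ z) -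
      κ ^ (-β) * (∫ z in E ×ˢ Icc t₁ t₂, R₀ z) ≤ κ ^ (-β) * S := by
    refine le_trans ?_ hen
    rw [← integral_const_mul, ← integral_const_mul,
      ← integral_sub (he₀i.const_mul _) (hR₀i.const_mul _)]
    refine integral_mono_ae ((he₀i.const_mul _).sub (hR₀i.const_mul _)) hFi ?_
    filter_upwards [hbd, H.ae_flux ht₁ ht₂] with z hz hf
    set w := A z.1 z.2 (u z.1 z.2) (Du z.1 z.2) with hw
    have hv : 0 < μ - u z.1 z.2 + κ := by linarith [hz.2]
    simp only [inner_add_right, inner_smul_right]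
    have b1 : β * K₁ * e₀ z ≤
        η z.1 * deriv (negPowWeight μ κ β) (u z.1 z.2) * inner ℝ w (Du z.1 z.2) := by
      rw [deriv_negPowWeight hκ hz.2]
      have h0 : 0 ≤ η z.1 * (β * (μ - u z.1 z.2 + κ) ^ (-β - 1)) :=
        mul_nonneg (hη0 _) (by positivity)
      refine le_trans (le_of_eq ?_) (mul_le_mul_of_nonneg_left hf.1 h0)
      simp only [he₀, hη]
      ring
    have b2 : -(κ ^ (-β) * R₀ z) ≤
        negPowWeight μ κ β (u z.1 z.2) * inner ℝ w (gradient η z.1) := by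
      have h1 : |(inner ℝ w (gradient η z.1) : ℝ)| ≤ R₀ z := by
        refine (abs_real_inner_le_norm _ _).trans ?_
        refine (mul_le_mul hf.2 (hζ.norm_gradient_rpow_le hl1.le z.1) (norm_nonneg _)
          (by positivity)).trans (le_of_eq ?_)
        simp only [hR₀, hK]
        ring
      have h2 := negPowWeight_nonneg (β := β) hκ hz.2
      have h3 := negPowWeight_le hκ hβ0 hz.2
      have h4 : |negPowWeight μ κ β (u z.1 z.2) * inner ℝ w (gradient η z.1)| ≤
          κ ^ (-β) * R₀ z := by
        rw [abs_mul, abs_of_nonneg h2]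
        exact mul_le_mul h3 h1 (abs_nonneg _) (by positivity)
      exact (abs_le.1 h4).1
    linarith
  set R := ∫ z in E ×ˢ Icc t₁ t₂, R₀ z with hR
  set e := ∫ z in E ×ˢ Icc t₁ t₂, e₀ z with he
  have hβK : 0 < β * K₁ := by positivity
  have hκβ : κ ^ β * κ ^ (-β) = 1 := by rw [← Real.rpow_add hκ]; simp
  have hstep3 : κ ^ β * e ≤ (S + R) / (β * K₁) := by
    rw [le_div_iff₀ hβK]
    have h1 : β * K₁ * e ≤ κ ^ (-β) * (S + R) := by linarith
    have h2 := mul_le_mul_of_nonneg_left h1 (show 0 ≤ κ ^ β by positivity)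
    rw [← mul_assoc (κ ^ β) (κ ^ (-β)), hκβ, one_mul] at h2
    linarith
  calc R ≤ ε' * e + C * ∫ z in E ×ˢ Icc t₁ t₂, P₀ z := hstep1
    _ ≤ ε / (β * K₁) * (S + R) + C * ((t - s) * (volume.real (Metric.ball y r) + S / κ ^ q)) := by
        refine add_le_add ?_ (mul_le_mul_of_nonneg_left hPle hC0)
        have h3 := mul_le_mul_of_nonneg_left hstep3 hε.le
        refine le_trans (le_of_eq ?_) (h3.trans (le_of_eq ?_))
        · rw [hε']; ring
        · ring
    _ = _ := by rw [hCeq]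

end LocalSetting

/-! ### Oscillation in time and the estimate for the upper sign -/

namespace LocalSetting

variable {N : ℕ} {p q K₁ K₂ : ℝ} {Ω : Set (RSpace N)} {T : ℝ}
  {A : RSpace N → ℝ → ℝ → RSpace N → RSpace N} {u : RSpace N → ℝ → ℝ}
  {Du : RSpace N → ℝ → RSpace N} {y : RSpace N} {r r' s t m μ : ℝ}

/-- The weighted integrals at two times differ little. -/
theorem integral_sub_le (H : LocalSetting p q K₁ K₂ Ω T A u Du y r r' s t m μ) (hpq : p - 1 < q)
    (hK₁ : 0 < K₁) (hK₂ : 0 < K₂) {l Λ σ δ : ℝ} (hl : 2 * q * p ^ 2 / (q - p + 1) ≤ l)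
    (hΛ : 1 ≤ Λ) (hσ : 0 < σ) (hδ : 0 < δ) (hδ1 : δ < 1) {ζ : RSpace N → ℝ}
    (hζ : IsCutoff Λ y r σ ζ) (hζs : tsupport ζ ⊆ Metric.ball y r') {κ β ε S K : ℝ} (hκ : 0 < κ)
    (hβ : β = (q - p + 1) / (2 * (p - 1))) (hε : ε = β * K₁ * δ / 4)
    (hK : K = K₂ * (l * (Λ / (σ * r))))
    (hκM : κ ^ (q - p + 1) = 4 / δ * (ε ^ (1 - p) * K ^ p * (1 + 4 ^ q) * (t - s)))
    (hS : ∀ τ ∈ Icc s t ∩ Ioo 0 T,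
      ∫ x in Metric.closedBall y r', (signedPow q μ - signedPow q (u x τ)) * ζ x ^ l ≤ S)
    {τ₁ τ₂ : ℝ} (hτ₁ : τ₁ ∈ Icc s t ∩ Ioo 0 T) (hτ₂ : τ₂ ∈ Icc s t ∩ Ioo 0 T) :
    (∫ x in Metric.closedBall y r', (signedPow q μ - signedPow q (u x τ₁)) * ζ x ^ l) -
      ∫ x in Metric.closedBall y r', (signedPow q μ - signedPow q (u x τ₂)) * ζ x ^ l ≤
      δ * (S + κ ^ q * volume.real (Metric.ball y r)) := by
  have hp := H.one_lt_p
  have hq := H.one_lt_q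
  have hr := H.r_pos
  have hst := H.time_lt
  have hD : 0 < q - p + 1 := by linarith
  have hp1 : 0 < p - 1 := by linarith
  have hβ0 : 0 < β := by rw [hβ]; positivity
  have hε0 : 0 < ε := by rw [hε]; positivity
  have hl1 : 1 < l := by
    have hlD : 2 * q * p ^ 2 ≤ l * (q - p + 1) := (div_le_iff₀ hD).1 hl
    by_contra! hcon
    have h1 : l * (q - p + 1) ≤ 1 * (q - p + 1) := mul_le_mul_of_nonneg_right hcon hD.le
    have h2 : 1 < p ^ 2 := by nlinarith
    nlinarith
  have hl0 : 0 < l := by linarith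
  set η : RSpace N → ℝ := fun x => ζ x ^ l with hη
  have hηd : ContDiff ℝ 1 η := hζ.contDiff_rpow hl1.le
  have hη0 : ∀ x, 0 ≤ η x := fun x => hζ.rpow_nonneg x
  have hη1 : ∀ x, η x ≤ 1 := fun x => hζ.rpow_le_one hl0.le x
  have hηs : tsupport η ⊆ Metric.ball y r' := (IsCutoff.tsupport_rpow_subset hl0).trans hζs
  set W : ℝ → ℝ := fun τ => ∫ x in Metric.closedBall y r',
    (signedPow q μ - signedPow q (u x τ)) * η x with hW
  set V := volume.real (Metric.ball y r) with hV
  have hIoo : Ioo s t ⊆ Icc s t ∩ Ioo 0 T := fun τ hτ => ⟨Ioo_subset_Icc_self hτ, H.Ioo_subset hτ⟩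
  have hSI : ∀ τ ∈ Ioo s t, W τ ≤ S := fun τ hτ => hS τ (hIoo hτ)
  have hV0 : 0 ≤ V := measureReal_nonneg
  have hκq : 0 < κ ^ q := Real.rpow_pos_of_pos hκ q
  have hS0 : 0 ≤ S := by
    refine le_trans (integral_nonneg_of_ae ?_) (hS τ₁ hτ₁)
    filter_upwards [H.slice_bounds H.r'_lt hτ₁] with x hx
    exact mul_nonneg (sub_nonneg.2 (signedPow_mono (by linarith) hx.2)) (hη0 x)
  have key : ∀ t₁ t₂, s < t₁ → t₁ < t₂ → t₂ < t → |W t₁ - W t₂| ≤ δ * (S + κ ^ q * V) := by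
    intro t₁ t₂ ht₁ ht ht₂
    have h1 := H.abs_integral_sub_le hηd hηs hη0 hη1 ht₁ ht ht₂
      (H.integrable_flux_weight (K := K) hl1 hζ.contDiff.continuous hζ.nonneg hζ.le_one ht₁ ht.le
        ht₂) (fun z => by
        have h2 := hζ.norm_gradient_rpow_le hl1.le z.1
        calc K₂ * ‖Du z.1 z.2‖ ^ (p - 1) * ‖gradient η z.1‖ ≤
            K₂ * ‖Du z.1 z.2‖ ^ (p - 1) * (l * (Λ / (σ * r)) * ζ z.1 ^ (l - 1)) := by
              gcongr
          _ = _ := by rw [hK]; ring)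
    refine h1.trans ?_
    have h2 := H.flux_le hpq hK₁ hK₂ hl hΛ hσ hζ hζs hκ hβ hε0 ht₁ ht.le ht₂ hK hSI
    have hR0 : 0 ≤ ∫ z in Metric.closedBall y r' ×ˢ Icc t₁ t₂,
        K * ‖Du z.1 z.2‖ ^ (p - 1) * ζ z.1 ^ (l - 1) := by
      refine integral_nonneg fun z => ?_
      have : 0 ≤ ζ z.1 ^ (l - 1) := Real.rpow_nonneg (hζ.nonneg _) _
      have : 0 ≤ K := by rw [hK]; positivity
      simp only [Pi.zero_apply]
      positivity
    set R := ∫ z in Metric.closedBall y r' ×ˢ Icc t₁ t₂,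
      K * ‖Du z.1 z.2‖ ^ (p - 1) * ζ z.1 ^ (l - 1) with hR
    have e1 : ε / (β * K₁) = δ / 4 := by rw [hε]; field_simp
    -- The level `κ` is defined by this identity: it makes the lower-order term contribute `δ / 4`
    -- times `κ ^ q V + S`.
    have e2 : ε ^ (1 - p) * K ^ p * (1 + 4 ^ q) * κ ^ (p - 1) * ((t - s) * (V + S / κ ^ q)) =
        δ / 4 * (κ ^ q * V + S) := by
      have e3 : κ ^ q = κ ^ (q - p + 1) * κ ^ (p - 1) := by
        rw [← Real.rpow_add hκ]; congr 1; ring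
      have e4 : ε ^ (1 - p) * K ^ p * (1 + 4 ^ q) * (t - s) = δ / 4 * κ ^ (q - p + 1) := by
        rw [hκM]; field_simp
      calc _ = (ε ^ (1 - p) * K ^ p * (1 + 4 ^ q) * (t - s)) * κ ^ (p - 1) * (V + S / κ ^ q) := by
            ring
        _ = δ / 4 * κ ^ q * (V + S / κ ^ q) := by rw [e4, e3]; ring
        _ = _ := by field_simp
    rw [e1, e2] at h2
    have h3 : 0 ≤ κ ^ q * V := by positivity
    -- Now `R ≤ δ/4 (S + R) + δ/4 (κ^q V + S)`. Since `δ < 1`, the `R` on the right is at most a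
    -- quarter of the left side and is absorbed.
    nlinarith [mul_nonneg hδ.le hS0, mul_nonneg hδ.le h3, mul_le_of_le_one_left hR0 hδ1.le]
  have keyI : ∀ a ∈ Ioo s t, ∀ b ∈ Ioo s t, W a - W b ≤ δ * (S + κ ^ q * V) := by
    intro a ha b hb
    rcases lt_trichotomy a b with h | h | h
    · exact (le_abs_self _).trans (key a b ha.1 h hb.2)
    · rw [h, sub_self]; positivity
    · rw [← neg_sub]
      exact (neg_le_abs _).trans (key b a hb.1 h ha.2)
  -- The flux estimate needs times strictly inside `(s, t)`; endpoints lying in `(0, T)` are reached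
  -- by continuity, one variable at a time.
  have hne : ∀ τ ∈ Icc s t ∩ Ioo 0 T, (𝓝[Ioo s t] τ).NeBot := fun τ hτ =>
    mem_closure_iff_nhdsWithin_neBot.1 (by rw [closure_Ioo hst.ne]; exact hτ.1)
  have hcont : ∀ τ ∈ Icc s t ∩ Ioo 0 T, Tendsto W (𝓝[Ioo s t] τ) (𝓝 (W τ)) := fun τ hτ =>
    (H.continuousWithinAt_integral hηd.continuous hη0 hη1 hτ).mono hIoo
  have key1 : ∀ b ∈ Ioo s t, W τ₁ - W b ≤ δ * (S + κ ^ q * V) := by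
    intro b hb
    have := hne τ₁ hτ₁
    refine le_of_tendsto ((hcont τ₁ hτ₁).sub_const (W b)) ?_
    filter_upwards [self_mem_nhdsWithin] with a ha
    exact keyI a ha b hb
  have := hne τ₂ hτ₂
  refine le_of_tendsto ((hcont τ₂ hτ₂).const_sub (W τ₁)) ?_
  filter_upwards [self_mem_nhdsWithin] with b hb
  exact key1 b hb

end LocalSetting

theorem exists_radius_tsupport_subset {N : ℕ} {Λ σ r : ℝ} {y : RSpace N} {ζ : RSpace N → ℝ}
    (hζ : IsCutoff Λ y r σ ζ) : ∃ r' < r, tsupport ζ ⊆ Metric.ball y r' := by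
  rcases (tsupport ζ).eq_empty_or_nonempty with he | hne
  · exact ⟨r - 1, by linarith, by simp [he]⟩
  · obtain ⟨x, hx, hmax⟩ := IsCompact.exists_isMaxOn hζ.hasCompactSupport hne
      (f := fun x => dist x y) (by fun_prop)
    obtain ⟨r', h1, h2⟩ := exists_between (Metric.mem_ball.1 (hζ.tsupport_subset hx))
    exact ⟨r', h2, fun z hz => lt_of_le_of_lt (hmax hz) h1⟩

/-- Passage from the comparison at two times to a Harnack type inequality. -/
theorem sSup_le_of_sub_le {ι : Type*} {I : ι → ℝ} {X : Set ι} (hX : X.Nonempty) {δ c : ℝ}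
    (hδ1 : δ < 1) (h : ∀ a ∈ X, ∀ b ∈ X, I a - I b ≤ δ * sSup (I '' X) + c) :
    sSup (I '' X) ≤ 1 / (1 - δ) * sInf (I '' X) + c / (1 - δ) := by
  have h1 : ∀ b ∈ X, sSup (I '' X) ≤ I b + (δ * sSup (I '' X) + c) := by
    intro b hb
    refine csSup_le (hX.image I) ?_
    rintro _ ⟨a, ha, rfl⟩
    linarith [h a ha b hb]
  have h2 : (1 - δ) * sSup (I '' X) - c ≤ sInf (I '' X) := by
    refine le_csInf (hX.image I) ?_
    rintro _ ⟨b, hb, rfl⟩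
    linarith [h1 b hb]
  have h3 : 0 < 1 - δ := by linarith
  rw [one_div_mul_eq_div, ← add_div, le_div_iff₀ h3]
  linarith

/-- The estimate for the positive sign, with an explicit constant. -/
theorem signedAverage_estimate {N : ℕ} {p q K₁ K₂ : ℝ} (hp : 1 < p) (hq : 1 < q)
    (hpq : p - 1 < q) (hK₁ : 0 < K₁) (hK₂ : 0 < K₂) {l : ℝ}
    (hl : 2 * q * p ^ 2 / (q - p + 1) ≤ l) {Λ : ℝ} (hΛ : 1 ≤ Λ) {γ : ℝ}
    (hγ : (4 * ((q - p + 1) / (2 * (p - 1)) * K₁ / 4) ^ (1 - p) * (K₂ * l * Λ) ^ p *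
      (1 + 4 ^ q)) ^ (q / (q - p + 1)) + p * (q / (q - p + 1)) ≤ γ)
    {Ω : Set (RSpace N)} {T : ℝ} {A : RSpace N → ℝ → ℝ → RSpace N → RSpace N}
    {u : RSpace N → ℝ → ℝ} (hΩ : IsOpen Ω) (hA : StructureConditions p K₁ K₂ Ω T A)
    (hu : IsLocalWeakSolution p q Ω T A u) {y : RSpace N} {r s t m μ : ℝ} (hr : 0 < r)
    (hst : s < t) (hsub : Metric.ball y r ×ˢ Ioo s t ⊆ spaceTime Ω T)
    (hb : ∀ᵐ z : RSpace N × ℝ ∂(volume.restrict (Metric.ball y r ×ˢ Ioo s t)),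
      m ≤ u z.1 z.2 ∧ u z.1 z.2 ≤ μ)
    {δ σ : ℝ} (hδ : δ ∈ Ioo (0 : ℝ) 1) (hσ : σ ∈ Ioo (0 : ℝ) 1) {ζ : RSpace N → ℝ}
    (hζ : IsCutoff Λ y r σ ζ) :
    (∀ τ ∈ Icc s t ∩ Ioo 0 T,
      IntegrableOn (signedIntegrand q l 1 μ u ζ τ) (Metric.ball y r)) ∧
    BddAbove (signedAverage q l 1 μ u ζ y r '' (Icc s t ∩ Ioo 0 T)) ∧
    BddBelow (signedAverage q l 1 μ u ζ y r '' (Icc s t ∩ Ioo 0 T)) ∧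
    sSup (signedAverage q l 1 μ u ζ y r '' (Icc s t ∩ Ioo 0 T)) ≤
      1 / (1 - δ) * sInf (signedAverage q l 1 μ u ζ y r '' (Icc s t ∩ Ioo 0 T)) +
        γ / ((1 - δ) * δ ^ γ * σ ^ γ) * ((t - s) / r ^ p) ^ (q / (q - p + 1)) := by
  -- Compact support of the cutoff gives a strictly smaller ball on which the local integrability of
  -- `u` and `Du` is available, even if `B_r(y)` touches the boundary of `Ω`.
  obtain ⟨r', hr', hζs⟩ := exists_radius_tsupport_subset hζ
  obtain ⟨Du, hspace, hid⟩ := hu.exists_gradient hp hΩ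
  obtain ⟨ρ, hρ', hρ⟩ := exists_between hr'
  have hballΩ : Metric.ball y r ⊆ Ω := fun x hx =>
    (hsub (mk_mem_prod hx (⟨left_lt_add_div_two.2 hst, add_div_two_lt_right.2 hst⟩ :
      (s + t) / 2 ∈ Ioo s t))).1
  have H : LocalSetting p q K₁ K₂ Ω T A u Du y r r' s t m μ :=
    { one_lt_p := hp, one_lt_q := hq, isOpen := hΩ, conditions := hA, space := hspace,
      r_pos := hr, r'_lt := hr', time_lt := hst, subset := hsub, bounds := hb,
      identity := hid y ρ r' hρ' ((Metric.closedBall_subset_ball hρ).trans hballΩ) }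
  obtain ⟨hδ0, hδ1⟩ := hδ
  obtain ⟨hσ0, hσ1⟩ := hσ
  have hD : 0 < q - p + 1 := by linarith
  have hp1 : 0 < p - 1 := by linarith
  have hl0 : 0 < l := lt_of_lt_of_le (by positivity) hl
  set E := Metric.closedBall y r' with hE
  have hEb : E ⊆ Metric.ball y r := Metric.closedBall_subset_ball hr'
  set V := volume.real (Metric.ball y r) with hV
  have hV0 : 0 < V := ENNReal.toReal_pos (Metric.measure_ball_pos volume y hr).ne'
    measure_ball_lt_top.ne
  set η : RSpace N → ℝ := fun x => ζ x ^ l with hη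
  have hηc : Continuous η := hζ.contDiff.continuous.rpow_const fun _ => Or.inr hl0.le
  have hη0 : ∀ x, 0 ≤ η x := fun x => hζ.rpow_nonneg x
  have hη1 : ∀ x, η x ≤ 1 := fun x => hζ.rpow_le_one hl0.le x
  have hηz : ∀ x ∉ E, η x = 0 := by
    intro x hx
    have : ζ x = 0 := image_eq_zero_of_notMem_tsupport fun h =>
      hx (Metric.ball_subset_closedBall (hζs h))
    simp [hη, this, Real.zero_rpow hl0.ne']
  set X := Icc s t ∩ Ioo 0 T with hX
  have hXne : X.Nonempty := by
    have hmid : (s + t) / 2 ∈ Ioo s t :=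
      ⟨left_lt_add_div_two.2 hst, add_div_two_lt_right.2 hst⟩
    exact ⟨_, Ioo_subset_Icc_self hmid, H.Ioo_subset hmid⟩
  set W : ℝ → ℝ := fun τ => ∫ x in E, (signedPow q μ - signedPow q (u x τ)) * η x with hW
  have hint : ∀ τ ∈ X, IntegrableOn (fun x => (signedPow q μ - signedPow q (u x τ)) * η x) E :=
    fun τ hτ => H.integrable_slice (continuous_const.sub (continuous_signedPow hq)) hηc hτ
  have hse : ∀ τ, signedIntegrand q l 1 μ u ζ τ =
      fun x => (signedPow q μ - signedPow q (u x τ)) * η x := by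
    intro τ
    ext x
    simp [signedIntegrand, hη]
  have hbm : MeasurableSet (Metric.ball y r) := Metric.isOpen_ball.measurableSet
  have havg : ∀ τ, signedAverage q l 1 μ u ζ y r τ = V⁻¹ * W τ := by
    intro τ
    rw [signedAverage, setAverage_eq, smul_eq_mul, hse]
    congr 1
    exact setIntegral_eq_of_subset_of_forall_sdiff_eq_zero hbm hEb fun x hx => by
      simp [hηz x hx.2]
  have hW0 : ∀ τ ∈ X, 0 ≤ W τ := by
    intro τ hτ
    refine integral_nonneg_of_ae ?_
    filter_upwards [H.slice_bounds hr' hτ] with x hx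
    exact mul_nonneg (sub_nonneg.2 (signedPow_mono (by linarith) hx.2)) (hη0 x)
  have hfin := LocalSetting.isFiniteMeasure_ball y r'
  have hWle : ∀ τ ∈ X, W τ ≤ ∫ _ in E, (signedPow q μ - signedPow q m) := by
    intro τ hτ
    refine integral_mono_ae (hint τ hτ) (integrable_const _) ?_
    filter_upwards [H.slice_bounds hr' hτ] with x hx
    have h1 := signedPow_mono (show 0 < q by linarith) hx.1
    have h2 := signedPow_mono (show 0 < q by linarith) hx.2
    calc (signedPow q μ - signedPow q (u x τ)) * η x
        ≤ (signedPow q μ - signedPow q (u x τ)) * 1 := by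
          have := hη1 x
          have : 0 ≤ signedPow q μ - signedPow q (u x τ) := by linarith
          gcongr
      _ ≤ _ := by linarith
  have hbdd : BddAbove (signedAverage q l 1 μ u ζ y r '' X) := by
    refine ⟨V⁻¹ * ∫ _ in E, (signedPow q μ - signedPow q m), ?_⟩
    rintro _ ⟨τ, hτ, rfl⟩
    rw [havg]
    have := hWle τ hτ
    gcongr
  refine ⟨fun τ hτ => ?_, hbdd, ⟨0, ?_⟩, ?_⟩
  · rw [hse]
    exact (hint τ hτ).of_forall_sdiff_eq_zero hbm fun x hx => by simp [hηz x hx.2]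
  · rintro _ ⟨τ, hτ, rfl⟩
    rw [havg]
    exact mul_nonneg (by positivity) (hW0 τ hτ)
  set θ := q / (q - p + 1) with hθ
  have hθ0 : 0 < θ := by positivity
  set β := (q - p + 1) / (2 * (p - 1)) with hβ
  have hβ0 : 0 < β := by positivity
  set ε := β * K₁ * δ / 4 with hε
  have hε0 : 0 < ε := by positivity
  set K := K₂ * (l * (Λ / (σ * r))) with hK
  have hK0 : 0 < K := by positivity
  have hts : 0 < t - s := by linarith
  set M := 4 / δ * (ε ^ (1 - p) * K ^ p * (1 + 4 ^ q) * (t - s)) with hM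
  have hM0 : 0 < M := by positivity
  set κ := M ^ (1 / (q - p + 1)) with hκ
  have hκ0 : 0 < κ := by positivity
  have hκM : κ ^ (q - p + 1) = M := by
    rw [hκ, ← Real.rpow_mul hM0.le, one_div_mul_cancel hD.ne', Real.rpow_one]
  have hκq : κ ^ q = M ^ θ := by
    rw [hκ, ← Real.rpow_mul hM0.le]; congr 1; rw [hθ]; ring
  set C := 4 * (β * K₁ / 4) ^ (1 - p) * (K₂ * l * Λ) ^ p * (1 + 4 ^ q) with hC
  have hC0 : 0 < C := by positivity
  -- The dependence on the parameters is made explicit: `ε` is proportional to `δ`, so `ε^(1-p) / δ`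
  -- gives `δ^(-p)`, and `K` is proportional to `1 / (σ r)`, so `K^p` gives `σ^(-p) r^(-p)`.
  have hMC : M = C * (δ ^ (-p) * σ ^ (-p) * ((t - s) / r ^ p)) := by
    have e1 : ε ^ (1 - p) = (β * K₁ / 4) ^ (1 - p) * (δ * δ ^ (-p)) := by
      rw [hε, show β * K₁ * δ / 4 = β * K₁ / 4 * δ by ring,
        Real.mul_rpow (by positivity) hδ0.le, sub_eq_add_neg 1 p, Real.rpow_add hδ0 1 (-p),
        Real.rpow_one]
    have e2 : K ^ p = (K₂ * l * Λ) ^ p * (σ ^ (-p) / r ^ p) := by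
      rw [hK, show K₂ * (l * (Λ / (σ * r))) = K₂ * l * Λ * (1 / (σ * r)) by ring,
        Real.mul_rpow (by positivity) (by positivity), Real.div_rpow (by norm_num) (by positivity),
        Real.one_rpow, Real.mul_rpow hσ0.le hr.le, Real.rpow_neg hσ0.le]
      field_simp
    rw [hM, e1, e2, hC]
    field_simp
  clear_value C
  have hmain : ∀ a ∈ X, ∀ b ∈ X,
      signedAverage q l 1 μ u ζ y r a - signedAverage q l 1 μ u ζ y r b ≤
        δ * sSup (signedAverage q l 1 μ u ζ y r '' X) + δ * κ ^ q := by
    intro a ha b hb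
    set S' := sSup (signedAverage q l 1 μ u ζ y r '' X) with hS'
    -- The a priori bound is the supremum itself, finite because `u` is bounded on the cylinder;
    -- dividing by `V` later returns to averages.
    have hS : ∀ τ ∈ X, W τ ≤ V * S' := by
      intro τ hτ
      have := le_csSup hbdd (mem_image_of_mem _ hτ)
      rw [havg, inv_mul_le_iff₀ hV0] at this
      exact this
    have := H.integral_sub_le hpq hK₁ hK₂ hl hΛ hσ0 hδ0 hδ1 hζ hζs hκ0 hβ hε hK hκM hS ha hb
    rw [havg, havg, ← mul_sub, inv_mul_le_iff₀ hV0]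
    refine this.trans (le_of_eq ?_)
    ring
  refine (sSup_le_of_sub_le hXne hδ1 hmain).trans (add_le_add le_rfl ?_)
  have hd : 0 < 1 - δ := by linarith
  have hγ1 : C ^ θ ≤ γ := by
    have : 0 ≤ p * θ := by positivity
    linarith
  have hγ2 : p * θ ≤ γ := by
    have : 0 ≤ C ^ θ := by positivity
    linarith
  set Y := ((t - s) / r ^ p) ^ θ with hY
  have hY0 : 0 ≤ Y := by positivity
  have hγ0 : 0 ≤ γ := le_trans (by positivity) hγ1
  have hκle : κ ^ q ≤ γ * (δ ^ (-γ) * σ ^ (-γ) * Y) := by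
    have e1 : κ ^ q = C ^ θ * (δ ^ (-(p * θ)) * σ ^ (-(p * θ)) * Y) := by
      rw [hκq, hMC, Real.mul_rpow hC0.le (by positivity), Real.mul_rpow (by positivity)
        (by positivity), Real.mul_rpow (by positivity) (by positivity), ← Real.rpow_mul hδ0.le,
        ← Real.rpow_mul hσ0.le, neg_mul]
    rw [e1]
    have f1 : δ ^ (-(p * θ)) ≤ δ ^ (-γ) :=
      Real.rpow_le_rpow_of_exponent_ge hδ0 hδ1.le (by linarith)
    have f2 : σ ^ (-(p * θ)) ≤ σ ^ (-γ) :=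
      Real.rpow_le_rpow_of_exponent_ge hσ0 hσ1.le (by linarith)
    gcongr
  calc δ * κ ^ q / (1 - δ) ≤ 1 * (γ * (δ ^ (-γ) * σ ^ (-γ) * Y)) / (1 - δ) := by
        gcongr
    _ = γ / ((1 - δ) * δ ^ γ * σ ^ γ) * Y := by
        rw [Real.rpow_neg hδ0.le, Real.rpow_neg hσ0.le]
        field_simp

/-! ### Reflection `u ↦ -u` and the two signs -/

section Reflection

variable {N : ℕ} {p q K₁ K₂ : ℝ} {Ω : Set (RSpace N)} {T : ℝ}
  {A : RSpace N → ℝ → ℝ → RSpace N → RSpace N} {u : RSpace N → ℝ → ℝ}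
  {Du : RSpace N → ℝ → RSpace N}

/-- Both structure conditions are even under the simultaneous change of sign of `v`, `ξ` and the
flux, so the reflected problem keeps the constants `K₁` and `K₂`. -/
theorem StructureConditions.neg (h : StructureConditions p K₁ K₂ Ω T A) :
    StructureConditions p K₁ K₂ Ω T fun x t v ξ => -A x t (-v) (-ξ) where
  measurable v ξ := (h.measurable (-v) (-ξ)).neg
  continuous := by
    filter_upwards [h.continuous] with z hz
    exact (hz.comp (by fun_prop : Continuous fun w : ℝ × RSpace N => (-w.1, -w.2))).neg
  coercive := by
    filter_upwards [h.coercive] with z hz v ξ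
    simpa using hz (-v) (-ξ)
  growth := by
    filter_upwards [h.growth] with z hz v ξ
    simpa using hz (-v) (-ξ)

theorem IsWeakGradient.neg {v : RSpace N → ℝ} {g : RSpace N → RSpace N}
    (h : IsWeakGradient Ω v g) : IsWeakGradient Ω (fun x => -v x) (fun x => -g x) := by
  intro φ hφ
  simp only [neg_smul, smul_neg, integral_neg, h φ hφ]

theorem InSolutionSpace.neg (h : InSolutionSpace p q Ω T u Du) :
    InSolutionSpace p q Ω T (fun x t => -u x t) (fun x t => -Du x t) where
  measurable := h.measurable.neg
  memLp_slice K hK hKΩ t ht := (h.memLp_slice K hK hKΩ t ht).neg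
  continuous_slice K hK hKΩ t ht := by
    refine (h.continuous_slice K hK hKΩ t ht).congr fun τ => ?_
    rw [← eLpNorm_neg]
    congr 1
    ext x
    simp only [Pi.neg_apply]
    ring
  memLp K hK hKΩ t₁ t₂ h₁ h₂ := (h.memLp K hK hKΩ t₁ t₂ h₁ h₂).neg
  memLp_gradient K hK hKΩ t₁ t₂ h₁ h₂ := (h.memLp_gradient K hK hKΩ t₁ t₂ h₁ h₂).neg
  gradient := by
    filter_upwards [h.gradient] with t ht
    exact ht.neg

theorem weakForm_neg (E : Set (RSpace N)) (t₁ t₂ : ℝ) (ζ ζt : RSpace N → ℝ → ℝ)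
    (Dζ : RSpace N → ℝ → RSpace N) :
    weakForm q (fun x t v ξ => -A x t (-v) (-ξ)) (fun x t => -u x t) (fun x t => -Du x t)
      E t₁ t₂ ζ ζt Dζ = -weakForm q A u Du E t₁ t₂ ζ ζt Dζ := by
  have h : ∀ τ x, signedPow q (u x τ) * ζt x τ +
      -(inner ℝ (A x τ (u x τ) (Du x τ)) (Dζ x τ)) =
      -(-(signedPow q (u x τ) * ζt x τ) + inner ℝ (A x τ (u x τ) (Du x τ)) (Dζ x τ)) :=
    fun τ x => by ring
  simp only [weakForm, signedPow_neg, neg_neg, inner_neg_left, h, integral_neg,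
    intervalIntegral.integral_neg, neg_mul]
  ring

/-- The weak form is odd under reflection, so sub- and supersolutions exchange roles, each taking
its gradient along. -/
theorem IsLocalWeakSolution.neg (h : IsLocalWeakSolution p q Ω T A u) :
    IsLocalWeakSolution p q Ω T (fun x t v ξ => -A x t (-v) (-ξ)) (fun x t => -u x t) := by
  obtain ⟨⟨Du, hs, hsub⟩, ⟨Du', hs', hsup⟩⟩ := h
  refine ⟨⟨_, hs'.neg, fun E hE hEΩ t₁ t₂ h₁ h₁₂ h₂ ζ ζt Dζ hζ => ?_⟩,
    ⟨_, hs.neg, fun E hE hEΩ t₁ t₂ h₁ h₁₂ h₂ ζ ζt Dζ hζ => ?_⟩⟩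
  · rw [weakForm_neg]
    exact neg_nonpos.2 (hsup E hE hEΩ t₁ t₂ h₁ h₁₂ h₂ ζ ζt Dζ hζ)
  · rw [weakForm_neg]
    exact neg_nonneg.2 (hsub E hE hEΩ t₁ t₂ h₁ h₁₂ h₂ ζ ζt Dζ hζ)

theorem signedIntegrand_neg_one (l μ : ℝ) (ζ : RSpace N → ℝ) :
    signedIntegrand q l (-1) μ u ζ = signedIntegrand q l 1 (-μ) (fun x t => -u x t) ζ := by
  ext τ x
  simp only [signedIntegrand, signedPow_neg]
  ring

theorem signedAverage_neg_one (l μ : ℝ) (ζ : RSpace N → ℝ) (y : RSpace N) (r : ℝ) :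
    signedAverage q l (-1) μ u ζ y r =
      signedAverage q l 1 (-μ) (fun x t => -u x t) ζ y r := by
  ext τ
  simp only [signedAverage, signedIntegrand_neg_one]

end Reflection

theorem theorem1p3 (N : ℕ) (hN : 1 ≤ N) (p q K₁ K₂ : ℝ) (hp : 1 < p) (hq : 1 < q)
    (hpq : p - 1 < q) (hK₁ : 0 < K₁) (hK₂ : 0 < K₂)
    (l : ℝ) (hl : 2 * q * p ^ 2 / (q - p + 1) ≤ l) (Λ : ℝ) (hΛ : 1 ≤ Λ) :
    ∃ γ : ℝ, 0 < γ ∧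
      ∀ (Ω : Set (RSpace N)) (T : ℝ) (A : RSpace N → ℝ → ℝ → RSpace N → RSpace N)
        (u : RSpace N → ℝ → ℝ),
        IsOpen Ω → 0 < T →
        StructureConditions p K₁ K₂ Ω T A →
        IsLocalWeakSolution p q Ω T A u →
        IsLocallyBounded Ω T u →
      ∀ (y : RSpace N) (r s t μp μm : ℝ), 0 < r → s < t →
        Metric.ball y r ×ˢ Ioo s t ⊆ spaceTime Ω T →
        (∀ᵐ z : RSpace N × ℝ ∂(volume.restrict (Metric.ball y r ×ˢ Ioo s t)),
          μm ≤ u z.1 z.2 ∧ u z.1 z.2 ≤ μp) →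
      ∀ (δ σ : ℝ), δ ∈ Ioo (0 : ℝ) 1 → σ ∈ Ioo (0 : ℝ) 1 →
      ∀ ζ : RSpace N → ℝ, IsCutoff Λ y r σ ζ →
      ∀ e μ : ℝ, (e = 1 ∧ μ = μp ∨ e = -1 ∧ μ = μm) →
        (∀ τ ∈ Icc s t ∩ Ioo 0 T,
          IntegrableOn (signedIntegrand q l e μ u ζ τ) (Metric.ball y r)) ∧
        BddAbove (signedAverage q l e μ u ζ y r '' (Icc s t ∩ Ioo 0 T)) ∧
        BddBelow (signedAverage q l e μ u ζ y r '' (Icc s t ∩ Ioo 0 T)) ∧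
        sSup (signedAverage q l e μ u ζ y r '' (Icc s t ∩ Ioo 0 T)) ≤
          1 / (1 - δ) * sInf (signedAverage q l e μ u ζ y r '' (Icc s t ∩ Ioo 0 T)) +
            γ / ((1 - δ) * δ ^ γ * σ ^ γ) * ((t - s) / r ^ p) ^ (q / (q - p + 1)) := by
  have hD : 0 < q - p + 1 := by linarith
  have hl0 : 0 < l := lt_of_lt_of_le (by positivity) hl
  have hp1 : 0 < p - 1 := by linarith
  -- The single `γ` occurs both as a factor and as the exponent of `δ` and `σ`. As a sum of two
  -- positive numbers it dominates the factor `C^(q/(q-p+1))` and the exponent `p q / (q - p + 1)`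
  -- at once; raising exponents is harmless as `δ, σ < 1`.
  refine ⟨(4 * ((q - p + 1) / (2 * (p - 1)) * K₁ / 4) ^ (1 - p) * (K₂ * l * Λ) ^ p *
      (1 + 4 ^ q)) ^ (q / (q - p + 1)) + p * (q / (q - p + 1)), by positivity, ?_⟩
  rintro Ω T A u hΩ - hA hu - y r s t μp μm hr hst hsub hb δ σ hδ hσ ζ hζ e μ
    (⟨rfl, rfl⟩ | ⟨rfl, rfl⟩)
  · exact signedAverage_estimate hp hq hpq hK₁ hK₂ hl hΛ le_rfl hΩ hA hu hr hst hsub hb hδ hσ hζ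
  -- For `-u` the upper bound is `-μ⁻` and the lower bound is `-μ⁺`, so the lower sign is the
  -- upper-sign estimate with the same `γ`.
  · rw [signedIntegrand_neg_one, signedAverage_neg_one]
    refine signedAverage_estimate hp hq hpq hK₁ hK₂ hl hΛ le_rfl hΩ hA.neg hu.neg (m := -μp) hr hst
      hsub ?_ hδ hσ hζ
    filter_upwards [hb] with z hz
    exact ⟨neg_le_neg hz.2, neg_le_neg hz.1⟩
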